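/- **Proposition 2.3.** Let $\mathbf k$ be a field of characteristic $0$, let $\mathfrak h\subset\mathfrak g$ be an inclusion of Lie algebras over $\mathbf k$, and let $\mathfrak m\subset\mathfrak g$ be a linear complement of $\mathfrak h$, $\mathfrak g=\mathfrak h\oplus\mathfrak m$, with $[\mathfrak h,\mathfrak m]\subset\mathfrak m$. *Notation.* For an element $P$ of a tensor product of enveloping algebras and disjoint sets $I_1,I_2,\dots$ of tensor factors, $P^{I_1,I_2,\dots}$ is obtained by applying to each tensor factor of $P$ the iterated coproduct with values in the factors $I_1,I_2,\dots$ (the counit $\varepsilon$ if the set is empty). Let $\mathfrak g_2^n=((U\mathfrak g)^{\otimes n}\otimes U\mathfrak h)^{\mathfrak h}$ for $n\ge 0$ (invariants of the diagonal adjoint action). For $P\in\mathfrak g_2^n$ put $$bP=P^{2,\dots,n+2}+\sum_{i=1}^{n+1}(-1)^iP^{1,\dots,i\,i+1,\dots,n+2}\in\mathfrak g_2^{n+1},$$ and for $P\in\mathfrak g_2^p$, $Q\in\mathfrak g_2^q$, $n=p+q-1$, put $[P,Q]_G=\{P|Q\}-(-1)^{(p-1)(q-1)}\{Q|P\}$ with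 $$\{P|Q\}=\sum_{i=0}^{p-1}(-1)^{(q-1)i}\,P^{1,\dots,i,\;i+1\cdots i+q,\;i+q+1,\dots,n+1}\;Q^{i+1,\dots,i+q,\;i+q+1\cdots n+1}.$$ (So $[P,Q]_G=0$ if $p=q=0$.) Let $(U\mathfrak h)_{\le k}=\ker\big((\mathrm{id}-\eta\varepsilon)^{\otimes (k+1)}\circ\Delta^{(k)}\big)$, where $\eta:\mathbf k\to U\mathfrak h$ is the unit and $\Delta^{(k)}:U\mathfrak h\to (U\mathfrak h)^{\otimes(k+1)}$ the iterated coproduct, and let $(\mathfrak g_2)_{\le k}$ be the space of invariants with last tensor factor in $(U\mathfrak h)_{\le k}$. Let $U\mathfrak m\subset U\mathfrak g$ be the image of $S\mathfrak m$ under the symmetrization map, and let $b_{\mathfrak m}$ be the restriction to $T^*U\mathfrak m$ of the Hochschild coboundary operator of the coalgebra $U\mathfrak g$, $$P\mapsto 1\otimes P+\sum_{i=1}^n(-1)^iP^{1,\dots,i\,i+1,\dots,n+1}+(-1)^{n+1}P\otimes 1 .$$ A dgla is understood here with the sign convention usual for Hochschild complexes, in which the differential is a derivation from the right: $d[P,Q]=[P,dQ]+(-1)^{|Q|-1}[dP,Q]$,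 where $|Q|$ is the unshifted degree. *Statement.* One has $U\mathfrak g=U\mathfrak m\oplus U\mathfrak g\cdot\mathfrak h$. Let $p:U\mathfrak g\to U\mathfrak m$ be the projection along $U\mathfrak g\cdot\mathfrak h$, let $[\cdot,\cdot]_{G,\mathfrak m}=(\otimes p)\circ[\cdot,\cdot]_G$ on $(T^*U\mathfrak m)^{\mathfrak h}$, where $[\cdot,\cdot]_G$ is the Gerstenhaber bracket of $T^*U\mathfrak g$ (the bracket above with $\mathfrak h=0$), and let $p_2=(\otimes p)\otimes\varepsilon$. 1. $(\mathfrak g_2[1],b,[\cdot,\cdot]_G)$ and $((T^*U\mathfrak m)^{\mathfrak h}[1],b_{\mathfrak m},[\cdot,\cdot]_{G,\mathfrak m})$ are dgla's, and $p_2$ restricts to a morphism of dgla's from the first to the second. 2. There is a linear operator $\kappa:\mathfrak g_2^*\to\mathfrak g_2^{*-1}$ such that $\kappa b+b\kappa=\mathrm{id}-p_2$ (where $(T^*U\mathfrak m)^{\mathfrak h}$ is embedded in $\mathfrak g_2$ by $P\mapsto P\otimes 1$), $\kappa\circ\kappa=0$, and $\kappa((\mathfrak g_2)_{\le k})\subset(\mathfrak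 g_2)_{\le k+1}$ for all $k\ge 0$. 3. In particular, $p_2$ induces an isomorphism in cohomology. -/

import Mathlib

open scoped TensorProduct

namespace DynTwist

/-! ### Differential graded Lie algebras given by graded subspaces

`V n` is the degree `n` part of a graded vector space concentrated in degrees `n ≥ 0`, and
`C n ⊆ V n` is a graded subspace. A Lie bracket on the shifted space `C[1]` has degree `-1` with
respect to the unshifted degree, so it maps degrees `p, q` to `p + q - 1`. It is given by maps
`br p q n : V p → V q → V n`, of which only those with `n = p + q - 1` have a meaning; the bracket
of two elements of degree `0` lies in degree `-1`, hence is zero. -/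

/-- `(C[1], d, [ , ])` is a differential graded Lie algebra. As for every Hochschild-type complex
with Gerstenhaber bracket, the differential acts as a derivation from the right:
`d[P,Q] = [P,dQ] + (-1)^(|Q|-1) [dP,Q]`; this means that `P ↦ (-1)^(|P|-1) dP` is a derivation
from the left. The signs are written with `p + 1` in place of `p - 1`. -/
structure IsDGLA (k : Type*) [Field k] {V : ℕ → Type*} [∀ n, AddCommGroup (V n)]
    [∀ n, Module k (V n)] (C : ∀ n, Submodule k (V n)) (d : ∀ n, V n →ₗ[k] V (n + 1))
    (br : ∀ p q n, V p →ₗ[k] V q →ₗ[k] V n) : Prop where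
  d_mem : ∀ n, ∀ P ∈ C n, d n P ∈ C (n + 1)
  br_mem : ∀ p q n, n + 1 = p + q → ∀ P ∈ C p, ∀ Q ∈ C q, br p q n P Q ∈ C n
  br_zero_zero : ∀ n, ∀ P ∈ C 0, ∀ Q ∈ C 0, br 0 0 n P Q = 0
  d_d : ∀ n, ∀ P ∈ C n, d (n + 1) (d n P) = 0
  antisymm : ∀ p q n, n + 1 = p + q → ∀ P ∈ C p, ∀ Q ∈ C q,
    br p q n P Q = -((-1 : k) ^ ((p + 1) * (q + 1)) • br q p n Q P)
  jacobi : ∀ p q r n, n + 2 = p + q + r → ∀ P ∈ C p, ∀ Q ∈ C q, ∀ R ∈ C r,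
    br p (q + r - 1) n P (br q r (q + r - 1) Q R) =
      br (p + q - 1) r n (br p q (p + q - 1) P Q) R +
        (-1 : k) ^ ((p + 1) * (q + 1)) • br q (p + r - 1) n Q (br p r (p + r - 1) P R)
  leibniz : ∀ p q n, n + 1 = p + q → ∀ P ∈ C p, ∀ Q ∈ C q,
    d n (br p q n P Q) =
      br p (q + 1) (n + 1) P (d q Q) + (-1 : k) ^ (q + 1) • br (p + 1) q (n + 1) (d p P) Q
  /-- the derivation property for two elements of degree `0`, whose bracket is zero -/
  leibniz_zero : ∀ P ∈ C 0, ∀ Q ∈ C 0, 0 = br 0 1 0 P (d 0 Q) - br 1 0 0 (d 0 P) Q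

/-- `f : C → C'` (of degree zero) is compatible with the differentials and the brackets. -/
structure IsDGLAHom (k : Type*) [Field k] {V V' : ℕ → Type*} [∀ n, AddCommGroup (V n)]
    [∀ n, Module k (V n)] [∀ n, AddCommGroup (V' n)] [∀ n, Module k (V' n)]
    (C : ∀ n, Submodule k (V n)) (d : ∀ n, V n →ₗ[k] V (n + 1))
    (br : ∀ p q n, V p →ₗ[k] V q →ₗ[k] V n)
    (C' : ∀ n, Submodule k (V' n)) (d' : ∀ n, V' n →ₗ[k] V' (n + 1))
    (br' : ∀ p q n, V' p →ₗ[k] V' q →ₗ[k] V' n)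
    (f : ∀ n, V n →ₗ[k] V' n) : Prop where
  map_mem : ∀ n, ∀ P ∈ C n, f n P ∈ C' n
  map_d : ∀ n, ∀ P ∈ C n, f (n + 1) (d n P) = d' n (f n P)
  map_br : ∀ p q n, n + 1 = p + q → ∀ P ∈ C p, ∀ Q ∈ C q,
    f n (br p q n P Q) = br' p q n (f p P) (f q Q)

section Cohomology

variable {k : Type*} [Field k] {V : ℕ → Type*} [∀ n, AddCommGroup (V n)] [∀ n, Module k (V n)]

/-- The `n`-cocycles of `(C, d)`. -/
def cocycles (C : ∀ n, Submodule k (V n)) (d : ∀ n, V n →ₗ[k] V (n + 1)) (n : ℕ) :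
    Submodule k (V n) :=
  C n ⊓ LinearMap.ker (d n)

/-- The `n`-coboundaries of `(C, d)`. -/
def coboundaries (C : ∀ n, Submodule k (V n)) (d : ∀ n, V n →ₗ[k] V (n + 1)) :
    ∀ n, Submodule k (V n)
  | 0 => ⊥
  | n + 1 => (C n).map (d n)

/-- The `n`-th cohomology space of the complex `(C, d)`. -/
abbrev Cohomology (C : ∀ n, Submodule k (V n)) (d : ∀ n, V n →ₗ[k] V (n + 1)) (n : ℕ) :=
  cocycles C d n ⧸ (coboundaries C d n).comap (cocycles C d n).subtype

/-- The class of a cocycle. -/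
def cohomologyClass (C : ∀ n, Submodule k (V n)) (d : ∀ n, V n →ₗ[k] V (n + 1)) (n : ℕ) :
    cocycles C d n →ₗ[k] Cohomology C d n :=
  Submodule.mkQ _

end Cohomology

/-! ### Enveloping algebras and their tensor powers -/

section Enveloping

variable (k : Type*) [Field k] (L : Type*) [LieRing L] [LieAlgebra k L]

/-- `U L` -/
abbrev U := UniversalEnvelopingAlgebra k L

/-- `(U L)^{⊗ N}`, an algebra under the factorwise product -/
abbrev T (N : ℕ) := ⨂[k] _ : Fin N, U k L

attribute [local instance 100] LieRing.ofAssociativeRing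

/-- The counit of `U L`: the algebra morphism that vanishes on `L`. -/
noncomputable def counit : U k L →ₐ[k] k :=
  UniversalEnvelopingAlgebra.lift k (0 : L →ₗ⁅k⁆ k)

/-- `a ↦ 1 ⊗ ⋯ ⊗ a ⊗ ⋯ ⊗ 1`, with `a` in the factor number `s` -/
noncomputable abbrev place {N : ℕ} (s : Fin N) : U k L →ₐ[k] T k L N :=
  PiTensorProduct.singleAlgHom (R := k) (A := fun _ : Fin N => U k L) s

theorem place_commute {N : ℕ} {s t : Fin N} (hst : s ≠ t) (a b : U k L) :
    place k L s a * place k L t b = place k L t b * place k L s a := by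
  simp only [PiTensorProduct.singleAlgHom_apply]
  exact Commute.tprod (R := k) (A := fun _ : Fin N => U k L)
    (Pi.mulSingle_commute (f := fun _ : Fin N => U k L) hst a b)

variable {k L} in
/-- The iterated coproduct `U L → (U L)^{⊗ N}` with values in the factors with number in `I`
(and `1` in all other factors): the algebra morphism that sends `x ∈ L` to the sum over `s ∈ I` of
`1 ⊗ ⋯ ⊗ x ⊗ ⋯ ⊗ 1`, with `x` in the factor `s`. If `I` is empty, it is the counit; if `I = {s}`,
it puts an element of `U L` into the factor `s`. -/
noncomputable def cop {N : ℕ} (I : Finset (Fin N)) : U k L →ₐ[k] T k L N :=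
  UniversalEnvelopingAlgebra.lift k
    { (∑ s ∈ I, (place k L s).toLinearMap ∘ₗ (UniversalEnvelopingAlgebra.ι k : L →ₗ⁅k⁆ U k L) :
        L →ₗ[k] T k L N) with
      map_lie' := by
        intro x y
        simp only [AddHom.toFun_eq_coe, LinearMap.coe_toAddHom, LinearMap.sum_apply,
          LinearMap.comp_apply, LieHom.coe_toLinearMap, AlgHom.toLinearMap_apply,
          LieHom.map_lie, LieRing.of_associative_ring_bracket, map_sub, map_mul,
          Finset.sum_mul_sum]
        rw [Finset.sum_comm (s := I) (t := I) (f := fun i j =>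
          place k L i (UniversalEnvelopingAlgebra.ι k y) *
            place k L j (UniversalEnvelopingAlgebra.ι k x)), ← Finset.sum_sub_distrib]
        refine Finset.sum_congr rfl fun s hs => ?_
        rw [← Finset.sum_sub_distrib, Finset.sum_eq_single s]
        · intro t _ hts
          rw [place_commute k L hts.symm, sub_self]
        · exact fun hn => absurd hs hn }

/-- The term `(U L)_{≤ m}` of the coradical filtration of `U L`: the kernel of
`(id - η ∘ ε)^{⊗ (m+1)} ∘ Δ^{(m)}`. -/
noncomputable def filtU (m : ℕ) : Submodule k (U k L) :=
  LinearMap.ker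
    ((PiTensorProduct.map fun _ : Fin (m + 1) =>
        (LinearMap.id - Algebra.linearMap k (U k L) ∘ₗ (counit k L).toLinearMap :
          U k L →ₗ[k] U k L)) ∘ₗ
      (cop (Finset.univ : Finset (Fin (m + 1)))).toLinearMap)

/-! The sets of tensor factors that occur below; factors are numbered from `0`. -/

/-- `q` factors are substituted for the factor `i`: the factor `l` becomes the factor `l` if
`l < i`, the factors `i, …, i+q-1` if `l = i`, and the factor `l + q - 1` if `l > i`. -/
def blk (N i q l : ℕ) : Finset (Fin N) :=
  Finset.univ.filter fun s : Fin N =>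
    if l < i then (s : ℕ) = l
    else if l = i then i ≤ (s : ℕ) ∧ (s : ℕ) < i + q
    else (s : ℕ) + 1 = l + q

/-- The factor `l` becomes the factor `i + l`. -/
def shift (N i l : ℕ) : Finset (Fin N) := Finset.univ.filter fun s : Fin N => (s : ℕ) = i + l

/-- All factors from the factor `i` on. -/
def fromOn (N i : ℕ) : Finset (Fin N) := Finset.univ.filter fun s : Fin N => i ≤ (s : ℕ)

variable {k L} in
/-- `P ↦ P^{I 0, …, I (n-1)}`: the coproduct is applied to every factor of `P`, with values in
the factors with number in `I l` for the factor number `l`. The sets `I l` are always disjoint. -/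
noncomputable def insT {n N : ℕ} (I : ℕ → Finset (Fin N)) : T k L n →ₗ[k] T k L N :=
  PiTensorProduct.lift
    ((MultilinearMap.mkPiAlgebraFin k n (T k L N)).compLinearMap
      fun l : Fin n => (cop (I l)).toLinearMap)

/-- The Hochschild coboundary operator of the coalgebra `U L`:
`1 ⊗ P + ∑_{i=1}^n (-1)^i P^{1,…,ii+1,…,n+1} + (-1)^{n+1} P ⊗ 1`. -/
noncomputable def bT (n : ℕ) : T k L n →ₗ[k] T k L (n + 1) :=
  insT (shift (n + 1) 1) + ∑ j ∈ Finset.range n, (-1 : k) ^ (j + 1) • insT (blk (n + 1) j 2) +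
    (-1 : k) ^ (n + 1) • insT (shift (n + 1) 0)

/-- `{P|Q} = ∑_{i=0}^{p-1} (-1)^{(q-1)i} P^{1,…,i,i+1…i+q,…,n} Q^{i+1,…,i+q}` on `T^* U L`,
where `n = p + q - 1`. -/
noncomputable def braceT (p q n : ℕ) : T k L p →ₗ[k] T k L q →ₗ[k] T k L n :=
  ∑ i ∈ Finset.range p, (-1 : k) ^ ((q + 1) * i) •
    (LinearMap.mul k (T k L n)).compl₁₂ (insT (blk n i q)) (insT (shift n i))

/-- The Gerstenhaber bracket on `T^* U L`: `{P|Q} - (-1)^{(p-1)(q-1)} {Q|P}`. -/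
noncomputable def bracketT (p q n : ℕ) : T k L p →ₗ[k] T k L q →ₗ[k] T k L n :=
  braceT k L p q n - (-1 : k) ^ ((p + 1) * (q + 1)) • (braceT k L q p n).flip

end Enveloping

/-! ### The pair `𝔥 ⊆ 𝔤` -/

section Pair

variable {k : Type*} [Field k] {g : Type*} [LieRing g] [LieAlgebra k g] (h : LieSubalgebra k g)

attribute [local instance 100] LieRing.ofAssociativeRing

/-- The component of degree `n` of `T^* U𝔤 ⊗ U𝔥`. Its last factor `U𝔥` is not numbered. -/
abbrev A (n : ℕ) := T k g n ⊗[k] U k h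

/-- The coproduct `U𝔥 → (U𝔤)^{⊗ n} ⊗ U𝔥` with values in the factors with number in `J` and in the
last factor: the algebra morphism that sends `x ∈ 𝔥` to
`1 ⊗ x + ∑_{s ∈ J} (1 ⊗ ⋯ ⊗ x ⊗ ⋯ ⊗ 1) ⊗ 1`. -/
noncomputable def copLast {n : ℕ} (J : Finset (Fin n)) : U k h →ₐ[k] A h n :=
  UniversalEnvelopingAlgebra.lift k
    { ((Algebra.TensorProduct.includeLeft : T k g n →ₐ[k] A h n).toLinearMap ∘ₗ
          (cop J).toLinearMap ∘ₗ (UniversalEnvelopingAlgebra.ι k : g →ₗ⁅k⁆ U k g) ∘ₗ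
          (h.incl : h →ₗ[k] g) +
        (Algebra.TensorProduct.includeRight : U k h →ₐ[k] A h n).toLinearMap ∘ₗ
          (UniversalEnvelopingAlgebra.ι k : h →ₗ⁅k⁆ U k h) : h →ₗ[k] A h n) with
      map_lie' := by
        intro x y
        simp [LieRing.of_associative_ring_bracket, mul_add, add_mul, TensorProduct.sub_tmul,
          TensorProduct.tmul_sub]
        abel }

/-- `P ↦ P^{I 0, …, I (n-1), J ∪ {last}}` for `P ∈ (U𝔤)^{⊗ n} ⊗ U𝔥`. -/
noncomputable def insA {n N : ℕ} (I : ℕ → Finset (Fin N)) (J : Finset (Fin N)) :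
    A h n →ₗ[k] A h N :=
  LinearMap.mul' k (A h N) ∘ₗ
    TensorProduct.map
      ((Algebra.TensorProduct.includeLeft : T k g N →ₐ[k] A h N).toLinearMap ∘ₗ insT I)
      (copLast h J).toLinearMap

/-- `b(P) = P^{2,…,n+2} + ∑_{i=1}^{n+1} (-1)^i P^{1,…,ii+1,…,n+2}`. The term with `i = n + 1`, in
which the coproduct is applied to the last factor, is written separately. -/
noncomputable def b (n : ℕ) : A h n →ₗ[k] A h (n + 1) :=
  insA h (shift (n + 1) 1) ∅ +
    ∑ j ∈ Finset.range n, (-1 : k) ^ (j + 1) • insA h (blk (n + 1) j 2) ∅ +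
    (-1 : k) ^ (n + 1) • insA h (shift (n + 1) 0) (fromOn (n + 1) n)

/-- `{P|Q} = ∑_{i=0}^{p-1} (-1)^{(q-1)i} P^{1,…,i,i+1…i+q,…,n+1} Q^{i+1,…,i+q,i+q+1…n+1}`,
where `n = p + q - 1`. -/
noncomputable def brace (p q n : ℕ) : A h p →ₗ[k] A h q →ₗ[k] A h n :=
  ∑ i ∈ Finset.range p, (-1 : k) ^ ((q + 1) * i) •
    (LinearMap.mul k (A h n)).compl₁₂ (insA h (blk n i q) ∅)
      (insA h (shift n i) (fromOn n (i + q)))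

/-- `[P,Q]_G = {P|Q} - (-1)^{(p-1)(q-1)} {Q|P}` -/
noncomputable def bracketG (p q n : ℕ) : A h p →ₗ[k] A h q →ₗ[k] A h n :=
  brace h p q n + (-(-1 : k) ^ ((p + 1) * (q + 1))) • (brace h q p n).flip

/-- `𝔤₂ = (T^* U𝔤 ⊗ U𝔥)^𝔥` in degree `n`. The diagonal adjoint action of `x ∈ 𝔥` is the commutator
with the iterated coproduct of `x`. -/
noncomputable def g2 (n : ℕ) : Submodule k (A h n) :=
  ⨅ x : h, LinearMap.ker
    (LinearMap.mulLeft k (copLast h Finset.univ (UniversalEnvelopingAlgebra.ι k x) : A h n) -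
      LinearMap.mulRight k (copLast h Finset.univ (UniversalEnvelopingAlgebra.ι k x) : A h n))

/-- `(𝔤₂)_{≤ m}` in degree `n`: the invariant elements of `(U𝔤)^{⊗ n} ⊗ (U𝔥)_{≤ m}`. -/
noncomputable def g2Filt (m n : ℕ) : Submodule k (A h n) :=
  g2 h n ⊓ LinearMap.range (LinearMap.lTensor (T k g n) (filtU k h m).subtype)

/-- `((U𝔤)^{⊗ n})^𝔥` -/
noncomputable def tInv (n : ℕ) : Submodule k (T k g n) :=
  ⨅ x : h, LinearMap.ker
    (LinearMap.mulLeft k (cop Finset.univ (UniversalEnvelopingAlgebra.ι k (x : g)) : T k g n) -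
      LinearMap.mulRight k (cop Finset.univ (UniversalEnvelopingAlgebra.ι k (x : g)) : T k g n))

/-- `U𝔤 · 𝔥`, the left ideal of `U𝔤` generated by `𝔥` -/
noncomputable def Ugh : Submodule k (U k g) :=
  (Ideal.span (Set.range fun x : h => UniversalEnvelopingAlgebra.ι k (x : g))).restrictScalars k

/-- `U𝔪 = sym(S𝔪)`: the span of the symmetrized products
`(1/n!) ∑_σ y_{σ(1)} ⋯ y_{σ(n)}` of elements of `𝔪`. -/
noncomputable def Um (m : Submodule k g) : Submodule k (U k g) :=
  Submodule.span k {u | ∃ (n : ℕ) (y : Fin n → m), u = (n.factorial : k)⁻¹ •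
    ∑ σ : Equiv.Perm (Fin n),
      (List.ofFn fun i => UniversalEnvelopingAlgebra.ι k (y (σ i) : g)).prod}

/-- `(T^* U𝔪)^𝔥` in degree `n`, as a subspace of `(U𝔤)^{⊗ n}` -/
noncomputable def TUmInv (m : Submodule k g) (n : ℕ) : Submodule k (T k g n) :=
  LinearMap.range (PiTensorProduct.map fun _ : Fin n => (Um m).subtype) ⊓ tInv h n

/-- The inclusion `T^* U𝔤 → T^* U𝔤 ⊗ U𝔥`, `P ↦ P ⊗ 1`, in degree `n` -/
noncomputable def incl (n : ℕ) : T k g n →ₗ[k] A h n :=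
  (Algebra.TensorProduct.includeLeft : T k g n →ₐ[k] A h n).toLinearMap

variable {h} {m : Submodule k g}

/-- `⊗ p : T^* U𝔤 → T^* U𝔪 ⊆ T^* U𝔤`, where `p` is the projection of `U𝔤` on `U𝔪` along
`U𝔤 · 𝔥`. -/
noncomputable def tensorProj (hc : IsCompl (Um m) (Ugh h)) (n : ℕ) : T k g n →ₗ[k] T k g n :=
  PiTensorProduct.map fun _ : Fin n => (Um m).projection (Ugh h) hc

/-- `p₂ = (⊗ p) ⊗ ε` -/
noncomputable def p2 (hc : IsCompl (Um m) (Ugh h)) (n : ℕ) : A h n →ₗ[k] T k g n :=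
  tensorProj hc n ∘ₗ (TensorProduct.rid k (T k g n)).toLinearMap ∘ₗ
    LinearMap.lTensor (T k g n) (counit k h).toLinearMap

/-- `[ , ]_{G,𝔪} = (⊗ p) ∘ [ , ]_G` on `(T^* U𝔪)^𝔥` -/
noncomputable def bracketM (hc : IsCompl (Um m) (Ugh h)) (p q n : ℕ) :
    T k g p →ₗ[k] T k g q →ₗ[k] T k g n :=
  (bracketT k g p q n).compr₂ (tensorProj hc n)

end Pair

end DynTwist

/-! An assignment `f` of target factors to source factors defines an algebra morphism `ins`, and
composing assignments composes morphisms (`ins_comp`). Identities between terms with superscripts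
thus become arithmetic of assignments. The partial compositions `circ` behave like those of a
non-symmetric operad. Sequential associativity holds for all elements (`circ_circ`). Parallel
associativity needs invariance (`circ_circ_of_lt`), because the last factor of one argument acts
diagonally on the other argument. Hence the brace is graded pre-Lie (`brace_assoc_symm`) and its
commutator satisfies the Jacobi identity. Since `b` is minus the bracket with the unit of degree 2,
whose bracket with itself is zero, `g2` is a dgla.

The homotopy needs Poincaré–Birkhoff–Witt coordinates on U𝔤. Powers of elements span U L, and the
Adams operation, with eigenvalue 2^n on x^n, makes the exponent well defined. L embeds in U L: for
free Lie algebras by means of the Euler derivation, in general by passing to a quotient. The map x^n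
↦ ∑ C(n,i) y^i z^(n-i), for x = y + z with y ∈ 𝔪 and z ∈ 𝔥, is unipotent, hence bijective. This
yields an 𝔥-equivariant map `coord` : U𝔤 → 𝔥 and an operator `weight` with eigenvalue l on y^n z^l.
Its weight 0 part is U𝔪, and its part of positive weight is U𝔤·𝔥.

The contraction C is of Koszul type: it sends a factor to 𝔥 by `coord` and multiplies the result,
through its coproduct, into the factors that follow; the alternating sum over the factors is taken.
It satisfies bC + Cb = -W, where W is the total weight (`b_contraction_add`). The projection on the
kernel of W is p₂ (`weightProj_eq`). On invariants W commutes with b, so H = -W⁻¹C(1 - p₂) is a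
homotopy, and κ = HbH is a homotopy with κκ = 0. On invariants κ = H - HHb, so the filtration
estimate says that HH raises the filtration by 1 and not by 2. The reason is that, modulo lower
terms, C acts through the last factor only, and two such contractions anticommute up to a commutator
in 𝔥.

As a spectral projection of W, p₂ commutes with b. For brackets, consider the left ideal generated
by 𝔥 in all factors: p₂ kills it, every X is congruent to p₂X modulo it, and the brace respects it
in both arguments, provided in one of them that the other entry has the form t ⊗ 1 with t invariant.
The dgla axioms on the target then follow from surjectivity of p₂, and the statement on cohomology
follows from κ. -/

namespace DynTwist

/-! ### Morphisms out of enveloping algebras and their tensor powers, determined on generators -/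

section Generators

attribute [local instance 100] LieRing.ofAssociativeRing

theorem prod_ofFn_mul {M : Type*} [Monoid M] : ∀ {n : ℕ} (a b : Fin n → M),
    (∀ i j, i ≠ j → Commute (a i) (b j)) →
      (List.ofFn fun i => a i * b i).prod = (List.ofFn a).prod * (List.ofFn b).prod
  | 0, _, _, _ => by simp
  | n + 1, a, b, hab => by
    have hc : Commute (List.ofFn fun i : Fin n => a i.succ).prod (b 0) := by
      refine Commute.list_prod_left _ _ fun x hx => ?_
      obtain ⟨i, rfl⟩ := (List.mem_ofFn' _ _).1 hx
      exact hab _ _ (Fin.succ_ne_zero i)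
    rw [List.ofFn_succ, List.ofFn_succ, List.ofFn_succ, List.prod_cons, List.prod_cons,
      List.prod_cons, prod_ofFn_mul (fun i : Fin n => a i.succ) (fun i => b i.succ)
        fun i j hij => hab _ _ fun h => hij (Fin.succ_injective _ h)]
    simp only [mul_assoc]
    rw [← mul_assoc (b 0), ← hc.eq, mul_assoc]

variable {k : Type*} [Field k] {L : Type*} [LieRing L] [LieAlgebra k L]

/-- The universal property gives a morphism from `U k L` to `S`; followed by the inclusion it fixes
the generators, so it is the identity. -/
theorem U_subalgebra_eq_top (S : Subalgebra k (U k L))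
    (hS : ∀ x, UniversalEnvelopingAlgebra.ι k x ∈ S) (u : U k L) : u ∈ S := by
  let f : L →ₗ⁅k⁆ S :=
    { toFun := fun x => ⟨UniversalEnvelopingAlgebra.ι k x, hS x⟩
      map_add' := fun x y => Subtype.ext (by simp)
      map_smul' := fun c x => Subtype.ext (by simp)
      map_lie' := fun {x y} => Subtype.ext (by
        simp only [LieHom.map_lie, LieRing.of_associative_ring_bracket]
        rfl) }
  have h : S.val.comp (UniversalEnvelopingAlgebra.lift k f) = AlgHom.id k _ := by
    apply UniversalEnvelopingAlgebra.hom_ext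
    ext x
    change ((UniversalEnvelopingAlgebra.lift k f (UniversalEnvelopingAlgebra.ι k x) : S) : U k L) = _
    rw [UniversalEnvelopingAlgebra.lift_ι_apply]
    rfl
  have := DFunLike.congr_fun h u
  rw [← AlgHom.id_apply (R := k) u, ← this]
  exact Subtype.property _

theorem U_algHom_ext {B : Type*} [Ring B] [Algebra k B] {φ ψ : U k L →ₐ[k] B}
    (h : ∀ x, φ (UniversalEnvelopingAlgebra.ι k x) = ψ (UniversalEnvelopingAlgebra.ι k x)) :
    φ = ψ := by
  apply UniversalEnvelopingAlgebra.hom_ext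
  ext x
  exact h x

theorem U_commute {B : Type*} [Ring B] [Algebra k B] (φ : U k L →ₐ[k] B) (c : B)
    (h : ∀ x, Commute (φ (UniversalEnvelopingAlgebra.ι k x)) c) (u : U k L) :
    Commute (φ u) c := by
  have := U_subalgebra_eq_top ((Subalgebra.centralizer k {c}).comap φ) (fun x => by
    rw [Subalgebra.mem_comap, Subalgebra.mem_centralizer_iff]
    rintro _ rfl
    exact (h x).eq.symm) u
  rw [Subalgebra.mem_comap, Subalgebra.mem_centralizer_iff] at this
  exact (this c rfl).symm

theorem counit_ι (x : L) : counit k L (UniversalEnvelopingAlgebra.ι k x) = 0 := by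
  rw [counit, UniversalEnvelopingAlgebra.lift_ι_apply]
  rfl

theorem cop_ι {N : ℕ} (I : Finset (Fin N)) (x : L) :
    cop I (UniversalEnvelopingAlgebra.ι k x) =
      ∑ s ∈ I, place k L s (UniversalEnvelopingAlgebra.ι k x) := by
  rw [cop, UniversalEnvelopingAlgebra.lift_ι_apply]
  change (∑ s ∈ I, (place k L s).toLinearMap ∘ₗ
    (UniversalEnvelopingAlgebra.ι k : L →ₗ⁅k⁆ U k L) : L →ₗ[k] T k L N) x = _
  rw [LinearMap.sum_apply]
  rfl

/-- The algebra morphism out of a tensor power that is given on the factors by morphisms with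
commuting values. -/
noncomputable def liftT {B : Type*} [Ring B] [Algebra k B] {n : ℕ} (F : Fin n → U k L →ₐ[k] B)
    (hF : ∀ i j, i ≠ j → ∀ a b, Commute (F i a) (F j b)) : T k L n →ₐ[k] B :=
  PiTensorProduct.liftAlgHom
    ((MultilinearMap.mkPiAlgebraFin k n B).compLinearMap fun l => (F l).toLinearMap)
    (by simp [MultilinearMap.mkPiAlgebraFin_apply, List.ofFn_const])
    (by
      intro x y
      simp only [MultilinearMap.compLinearMap_apply, MultilinearMap.mkPiAlgebraFin_apply,
        Pi.mul_apply, AlgHom.toLinearMap_apply, map_mul]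
      exact prod_ofFn_mul _ _ fun i j hij => hF i j hij _ _)

theorem liftT_place {B : Type*} [Ring B] [Algebra k B] {n : ℕ} (F : Fin n → U k L →ₐ[k] B)
    (hF : ∀ i j, i ≠ j → ∀ a b, Commute (F i a) (F j b)) (i : Fin n) (a : U k L) :
    liftT F hF (place k L i a) = F i a := by
  classical
  simp only [liftT, PiTensorProduct.singleAlgHom_apply, PiTensorProduct.liftAlgHom_apply,
    PiTensorProduct.lift.tprod, MultilinearMap.compLinearMap_apply,
    MultilinearMap.mkPiAlgebraFin_apply, AlgHom.toLinearMap_apply]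
  have : (fun j => F j ((Pi.mulSingle i a : Fin n → U k L) j)) = Pi.mulSingle i (F i a) := by
    funext j
    rcases eq_or_ne j i with rfl | hj
    · simp
    · simp [Pi.mulSingle_eq_of_ne hj]
  erw [this]
  clear this
  generalize F i a = c
  clear hF F a
  induction n with
  | zero => exact i.elim0
  | succ n ih =>
    rw [List.ofFn_succ, List.prod_cons]
    refine Fin.cases ?_ (fun i => ?_) i
    · simp [Pi.mulSingle_eq_of_ne, List.ofFn_const]
    · have : (fun j : Fin n => (Pi.mulSingle i.succ c : Fin (n+1) → B) j.succ) =
          Pi.mulSingle i c := by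
        funext j
        simp [Pi.mulSingle_apply]
      rw [this, ih]
      simp

theorem liftT_tprod {B : Type*} [Ring B] [Algebra k B] {n : ℕ} (F : Fin n → U k L →ₐ[k] B)
    (hF : ∀ i j, i ≠ j → ∀ a b, Commute (F i a) (F j b)) (u : Fin n → U k L) :
    liftT F hF (PiTensorProduct.tprod k u) = (List.ofFn fun i => F i (u i)).prod := by
  simp only [liftT, PiTensorProduct.liftAlgHom_apply,
    PiTensorProduct.lift.tprod, MultilinearMap.compLinearMap_apply,
    MultilinearMap.mkPiAlgebraFin_apply, AlgHom.toLinearMap_apply]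

theorem tprod_eq_prod {n : ℕ} (u : Fin n → U k L) :
    PiTensorProduct.tprod k u = (List.ofFn fun i => place k L i (u i)).prod := by
  have hc : ∀ i j : Fin n, i ≠ j → ∀ a b, Commute (place k L i a) (place k L j b) :=
    fun i j hij a b => place_commute k L hij a b
  rw [← liftT_tprod _ hc]
  have : liftT _ hc = AlgHom.id k _ := by
    apply PiTensorProduct.algHom_ext
    intro t
    apply AlgHom.ext
    intro a
    exact liftT_place _ hc t a
  rw [this, AlgHom.id_apply]

end Generators

/-! ### Insertion morphisms attached to assignments of factors -/

section Insertion

attribute [local instance 100] LieRing.ofAssociativeRing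

variable {k : Type*} [Field k] {g : Type*} [LieRing g] [LieAlgebra k g] (h : LieSubalgebra k g)

/-- An element of `U𝔤` in the factor `t` of `(U𝔤)^{⊗ n} ⊗ U𝔥` -/
noncomputable def slotU {n : ℕ} (t : Fin n) : U k g →ₐ[k] A h n :=
  (Algebra.TensorProduct.includeLeft : T k g n →ₐ[k] A h n).comp (place k g t)

/-- An element of `U𝔥` in the last factor of `(U𝔤)^{⊗ n} ⊗ U𝔥` -/
noncomputable def lastU (n : ℕ) : U k h →ₐ[k] A h n :=
  (Algebra.TensorProduct.includeRight : U k h →ₐ[k] A h n)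

/-- A generator of `(U𝔤)^{⊗ n} ⊗ U𝔥` in the factor `t` -/
noncomputable def slot {n : ℕ} (t : Fin n) (x : g) : A h n :=
  slotU h t (UniversalEnvelopingAlgebra.ι k x)

/-- A generator of `(U𝔤)^{⊗ n} ⊗ U𝔥` in the last factor -/
noncomputable def last (n : ℕ) (z : h) : A h n :=
  lastU h n (UniversalEnvelopingAlgebra.ι k z)

variable {h}

theorem slotU_commute {n : ℕ} {s t : Fin n} (hst : s ≠ t) (a b : U k g) :
    Commute (slotU h s a) (slotU h t b) := by
  have := place_commute k g hst a b
  change slotU h s a * slotU h t b = slotU h t b * slotU h s a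
  simp only [slotU, AlgHom.comp_apply, ← map_mul, this]

theorem slotU_lastU_commute {n : ℕ} (t : Fin n) (a : U k g) (w : U k h) :
    Commute (slotU h t a) (lastU h n w) := by
  change (place k g t a ⊗ₜ[k] (1 : U k h)) * ((1 : T k g n) ⊗ₜ[k] w) =
    ((1 : T k g n) ⊗ₜ[k] w) * (place k g t a ⊗ₜ[k] (1 : U k h))
  simp [Algebra.TensorProduct.tmul_mul_tmul]

theorem slot_commute {n : ℕ} {s t : Fin n} (hst : s ≠ t) (x y : g) :
    Commute (slot h s x) (slot h t y) :=
  slotU_commute hst _ _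

theorem slot_last_commute {n : ℕ} (t : Fin n) (x : g) (z : h) :
    Commute (slot h t x) (last h n z) :=
  slotU_lastU_commute t _ _

theorem copLast_ι {n : ℕ} (J : Finset (Fin n)) (z : h) :
    copLast h J (UniversalEnvelopingAlgebra.ι k z) = ∑ s ∈ J, slot h s (z : g) + last h n z := by
  rw [copLast, UniversalEnvelopingAlgebra.lift_ι_apply]
  change (Algebra.TensorProduct.includeLeft : T k g n →ₐ[k] A h n)
    (cop J (UniversalEnvelopingAlgebra.ι k (z : g))) + last h n z = _
  rw [cop_ι, map_sum]
  rfl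

theorem A_algHom_ext {B : Type*} [Ring B] [Algebra k B] {n : ℕ} {φ ψ : A h n →ₐ[k] B}
    (h₁ : ∀ t x, φ (slot h t x) = ψ (slot h t x)) (h₂ : ∀ z, φ (last h n z) = ψ (last h n z)) :
    φ = ψ := by
  apply Algebra.TensorProduct.ext
  · apply PiTensorProduct.algHom_ext
    intro t
    exact U_algHom_ext fun x => h₁ t x
  · exact U_algHom_ext fun z => h₂ z

theorem A_subalgebra_eq_top {n : ℕ} (S : Subalgebra k (A h n)) (h₁ : ∀ t x, slot h t x ∈ S)
    (h₂ : ∀ z, last h n z ∈ S) (X : A h n) : X ∈ S := by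
  have h₃ : ∀ t u, slotU h t u ∈ S := fun t =>
    U_subalgebra_eq_top (S.comap (slotU h t)) (h₁ t)
  have h₄ : ∀ w, lastU h n w ∈ S := U_subalgebra_eq_top (S.comap (lastU h n)) h₂
  induction X using TensorProduct.induction_on with
  | zero => exact zero_mem _
  | add x y hx hy => exact add_mem hx hy
  | tmul t w =>
    have h₅ : t ⊗ₜ[k] w = (Algebra.TensorProduct.includeLeft : T k g n →ₐ[k] A h n) t *
        lastU h n w := by
      change _ = (t ⊗ₜ[k] (1 : U k h)) * ((1 : T k g n) ⊗ₜ[k] w)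
      simp [Algebra.TensorProduct.tmul_mul_tmul]
    rw [h₅]
    refine mul_mem ?_ (h₄ w)
    induction t using PiTensorProduct.induction_on with
    | smul_tprod r u =>
      rw [map_smul]
      refine S.smul_mem ?_ r
      rw [DynTwist.tprod_eq_prod, map_list_prod]
      refine list_prod_mem fun y hy => ?_
      rw [List.mem_map] at hy
      obtain ⟨z, hz, rfl⟩ := hy
      obtain ⟨i, rfl⟩ := (List.mem_ofFn' _ _).1 hz
      exact h₃ i (u i)
    | add x y hx hy => rw [map_add]; exact add_mem (hx (by
        change _ = (x ⊗ₜ[k] (1 : U k h)) * ((1 : T k g n) ⊗ₜ[k] w)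
        simp [Algebra.TensorProduct.tmul_mul_tmul])) (hy (by
        change _ = (y ⊗ₜ[k] (1 : U k h)) * ((1 : T k g n) ⊗ₜ[k] w)
        simp [Algebra.TensorProduct.tmul_mul_tmul]))

theorem A_commute {B : Type*} [Ring B] [Algebra k B] {n : ℕ} (φ : A h n →ₐ[k] B) (c : B)
    (h₁ : ∀ t x, Commute (φ (slot h t x)) c) (h₂ : ∀ z, Commute (φ (last h n z)) c)
    (X : A h n) : Commute (φ X) c := by
  have := A_subalgebra_eq_top ((Subalgebra.centralizer k {c}).comap φ) (fun t x => by
    rw [Subalgebra.mem_comap, Subalgebra.mem_centralizer_iff]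
    rintro _ rfl
    exact (h₁ t x).eq.symm) (fun z => by
    rw [Subalgebra.mem_comap, Subalgebra.mem_centralizer_iff]
    rintro _ rfl
    exact (h₂ z).eq.symm) X
  rw [Subalgebra.mem_comap, Subalgebra.mem_centralizer_iff] at this
  exact (this c rfl).symm

theorem cop_commute {n : ℕ} {I J : Finset (Fin n)} (hIJ : Disjoint I J) (a b : U k g) :
    Commute (cop I a) (cop J b) := by
  refine U_commute (cop I) _ (fun x => ?_) a
  refine (U_commute (cop J) _ (fun y => ?_) b).symm
  rw [cop_ι, cop_ι]
  refine Commute.sum_left _ _ _ fun s hs => Commute.sum_right _ _ _ fun t ht => ?_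
  refine place_commute k g ?_ _ _
  rintro rfl
  exact Finset.disjoint_left.1 hIJ (by assumption) (by assumption)

theorem cop_copLast_commute {n : ℕ} {I J : Finset (Fin n)} (hIJ : Disjoint I J) (a : U k g)
    (w : U k h) : Commute ((Algebra.TensorProduct.includeLeft : T k g n →ₐ[k] A h n) (cop I a))
      (copLast h J w) := by
  refine U_commute ((Algebra.TensorProduct.includeLeft : T k g n →ₐ[k] A h n).comp (cop I)) _
    (fun x => ?_) a
  refine (U_commute (copLast h J) _ (fun y => ?_) w).symm
  rw [copLast_ι, AlgHom.comp_apply, cop_ι, map_sum]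
  refine Commute.sum_right _ _ _ fun s hs => Commute.add_left ?_ ?_
  · refine Commute.sum_left _ _ _ fun t ht => slot_commute ?_ _ _
    rintro rfl
    exact Finset.disjoint_left.1 hIJ (by assumption) (by assumption)
  · exact (slot_last_commute s x y).symm

/-- The set of factors at which `f` takes the value `l` -/
def fib (f : ℕ → ℕ) (n l : ℕ) : Finset (Fin n) := Finset.univ.filter fun s : Fin n => f s = l

theorem mem_fib {f : ℕ → ℕ} {n l : ℕ} {s : Fin n} : s ∈ fib f n l ↔ f s = l := by
  simp [fib]

theorem fib_disjoint (f : ℕ → ℕ) (n : ℕ) {l l' : ℕ} (hl : l ≠ l') :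
    Disjoint (fib f n l) (fib f n l') := by
  rw [Finset.disjoint_left]
  intro s hs hs'
  exact hl ((mem_fib.1 hs).symm.trans (mem_fib.1 hs'))

variable (h)

/-- The algebra morphism `(U𝔤)^{⊗ p} ⊗ U𝔥 → (U𝔤)^{⊗ n} ⊗ U𝔥` for which the factor `t` of the
target receives the factor `f t` of the source, where `p` is the number of the last factor, and
larger values of `f` mean that the factor `t` receives nothing. -/
noncomputable def ins (f : ℕ → ℕ) (p n : ℕ) : A h p →ₐ[k] A h n :=
  Algebra.TensorProduct.lift
    (liftT (fun l : Fin p => (Algebra.TensorProduct.includeLeft : T k g n →ₐ[k] A h n).comp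
        (cop (fib f n l)))
      fun i j hij a b => by
        simp only [AlgHom.comp_apply]
        exact (cop_commute (fib_disjoint f n fun hl => hij (Fin.ext hl)) a b).map _)
    (copLast h (fib f n p))
    (by
      intro t w
      induction t using PiTensorProduct.induction_on with
      | smul_tprod r u =>
        rw [map_smul]
        refine Commute.smul_left ?_ r
        rw [liftT_tprod]
        refine Commute.list_prod_left _ _ fun x hx => ?_
        obtain ⟨i, rfl⟩ := (List.mem_ofFn' _ _).1 hx
        exact cop_copLast_commute (fib_disjoint f n i.2.ne) _ _
      | add x y hx hy => rw [map_add]; exact hx.add_left hy)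

variable {h}

theorem ins_slotU (f : ℕ → ℕ) (p n : ℕ) (s : Fin p) (u : U k g) :
    ins h f p n (slotU h s u) =
      (Algebra.TensorProduct.includeLeft : T k g n →ₐ[k] A h n) (cop (fib f n s) u) := by
  change ins h f p n (place k g s u ⊗ₜ[k] 1) = _
  rw [ins, Algebra.TensorProduct.lift_tmul, map_one, mul_one, liftT_place]
  rfl

theorem ins_slot (f : ℕ → ℕ) (p n : ℕ) (s : Fin p) (x : g) :
    ins h f p n (slot h s x) = ∑ t ∈ fib f n s, slot h t x := by
  rw [slot, ins_slotU, cop_ι, map_sum]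
  rfl

theorem ins_lastU (f : ℕ → ℕ) (p n : ℕ) (w : U k h) :
    ins h f p n (lastU h p w) = copLast h (fib f n p) w := by
  change ins h f p n (1 ⊗ₜ[k] w) = _
  rw [ins, Algebra.TensorProduct.lift_tmul, map_one, one_mul]

theorem ins_last (f : ℕ → ℕ) (p n : ℕ) (z : h) :
    ins h f p n (last h p z) = ∑ t ∈ fib f n p, slot h t (z : g) + last h n z := by
  rw [last, ins_lastU, copLast_ι]

/-- This translates superscripts given by sets of factors into assignments, on which all later
identities are checked. -/
theorem insA_eq_ins (f : ℕ → ℕ) (p n : ℕ) (I : ℕ → Finset (Fin n)) (J : Finset (Fin n))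
    (hI : ∀ l < p, I l = fib f n l) (hJ : J = fib f n p) :
    insA h I J = (ins h f p n).toLinearMap := by
  apply TensorProduct.ext'
  intro t w
  rw [AlgHom.toLinearMap_apply, ins, Algebra.TensorProduct.lift_tmul]
  subst hJ
  change (Algebra.TensorProduct.includeLeft : T k g n →ₐ[k] A h n) (insT I t) *
    copLast h (fib f n p) w = _
  congr 1
  induction t using PiTensorProduct.induction_on with
  | smul_tprod r u =>
    rw [map_smul, map_smul, map_smul]
    congr 1
    rw [liftT_tprod]
    simp only [insT, PiTensorProduct.lift.tprod, MultilinearMap.compLinearMap_apply,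
      MultilinearMap.mkPiAlgebraFin_apply, AlgHom.toLinearMap_apply]
    rw [map_list_prod, List.map_ofFn]
    congr 2
    funext i
    simp [hI i i.2]
  | add x y hx hy => rw [map_add, map_add, map_add, hx, hy]

theorem ins_congr {f f' : ℕ → ℕ} (p : ℕ) {n : ℕ} (hf : ∀ t < n, f t = f' t) :
    ins h f p n = ins h f' p n := by
  have : ∀ l, fib f n l = fib f' n l := fun l => by
    ext s
    rw [mem_fib, mem_fib, hf s s.2]
  apply A_algHom_ext
  · intro t x
    rw [ins_slot, ins_slot, this]
  · intro z
    rw [ins_last, ins_last, this]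

theorem sum_fib_fib {M : Type*} [AddCommMonoid M] {f f' : ℕ → ℕ} {n N s : ℕ}
    (hf : ∀ t < N, f' (f t) = s → f t < n) (F : Fin N → M) :
    ∑ t ∈ fib f' n s, ∑ r ∈ fib f N t, F r = ∑ r ∈ fib (fun t => f' (f t)) N s, F r := by
  rw [← Finset.sum_biUnion]
  · refine Finset.sum_congr ?_ fun _ _ => rfl
    ext r
    simp only [Finset.mem_biUnion, mem_fib]
    constructor
    · rintro ⟨t, ht, hr⟩
      rw [hr, ht]
    · intro hr
      exact ⟨⟨f r, hf r r.2 hr⟩, hr, rfl⟩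
  · intro t _ t' _ htt
    exact fib_disjoint f N fun hl => htt (Fin.ext hl)

/-- Both sides agree on generators. The hypotheses say that the last factor is matched with the last
factor, and that a factor receiving nothing from the middle term still receives nothing from the
source. -/
theorem ins_comp {f f' : ℕ → ℕ} {p n N : ℕ} (hn : f' n = p)
    (hf : ∀ t < N, n < f t → p < f' (f t)) (X : A h p) :
    ins h f n N (ins h f' p n X) = ins h (fun t => f' (f t)) p N X := by
  have key : (ins h f n N).comp (ins h f' p n) = ins h (fun t => f' (f t)) p N := by
    apply A_algHom_ext
    · intro s x
      rw [AlgHom.comp_apply, ins_slot, map_sum, ins_slot]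
      simp only [ins_slot]
      refine sum_fib_fib (fun t ht hs => ?_) _
      rcases lt_trichotomy (f t) n with h1 | h1 | h1
      · exact h1
      · rw [h1, hn] at hs
        exact absurd hs s.2.ne'
      · have := hf t ht h1
        omega
    · intro z
      rw [AlgHom.comp_apply, ins_last, map_add, map_sum, ins_last, ins_last, ← add_assoc]
      congr 1
      simp only [ins_slot]
      -- The source's last factor reaches a target factor either through the last middle factor or
      -- through an earlier one. The value `p + 1` removes the first kind from the fibre.
      rw [show fib (fun t => f' (f t)) N p =
        (fib (fun t => if f t = n then p + 1 else f' (f t)) N p) ∪ fib f N n by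
          ext r
          simp only [mem_fib, Finset.mem_union]
          by_cases hr : f r = n
          · simp [hr, hn]
          · simp [hr], Finset.sum_union]
      · congr 1
        have := sum_fib_fib (f := f) (f' := fun t => if t = n then p + 1 else f' t) (n := n)
          (N := N) (s := p) (fun t ht hs => by
            rcases lt_trichotomy (f t) n with h1 | h1 | h1
            · exact h1
            · simp [h1] at hs
            · have := hf t ht h1
              rw [if_neg h1.ne'] at hs
              omega) (fun r => slot h r (z : g))
        rw [← this]
        refine Finset.sum_congr ?_ fun _ _ => rfl
        ext t
        rw [mem_fib, mem_fib, if_neg t.2.ne]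
      · rw [Finset.disjoint_left]
        intro r hr hr'
        rw [mem_fib] at hr hr'
        simp [hr'] at hr
  exact DFunLike.congr_fun key X

end Insertion

/-! ### Partial compositions and their associativity -/

section Operad

attribute [local instance 100] LieRing.ofAssociativeRing

variable {k : Type*} [Field k] {g : Type*} [LieRing g] [LieAlgebra k g] {h : LieSubalgebra k g}

variable (h) in
/-- The iterated coproduct of `z ∈ 𝔥` -/
noncomputable def diag (n : ℕ) (z : h) : A h n :=
  ∑ s : Fin n, slot h s (z : g) + last h n z

theorem mem_g2 {n : ℕ} {P : A h n} : P ∈ g2 h n ↔ ∀ z, Commute (diag h n z) P := by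
  rw [g2, Submodule.mem_iInf]
  refine forall_congr' fun z => ?_
  rw [LinearMap.mem_ker, LinearMap.sub_apply, LinearMap.mulLeft_apply, LinearMap.mulRight_apply,
    sub_eq_zero, copLast_ι]
  rfl

theorem mul_mem_g2 {n : ℕ} {P Q : A h n} (hP : P ∈ g2 h n) (hQ : Q ∈ g2 h n) :
    P * Q ∈ g2 h n :=
  mem_g2.2 fun z => (mem_g2.1 hP z).mul_right (mem_g2.1 hQ z)

theorem one_mem_g2 (n : ℕ) : (1 : A h n) ∈ g2 h n := mem_g2.2 fun _ => Commute.one_right _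

theorem ins_diag {f : ℕ → ℕ} {p n : ℕ} (z : h) :
    ins h f p n (diag h p z) =
      ∑ t ∈ Finset.univ.filter fun t : Fin n => f t ≤ p, slot h t (z : g) + last h n z := by
  rw [diag, map_add, map_sum, ins_last, ← add_assoc]
  congr 1
  simp only [ins_slot]
  have h1 : (Finset.univ.filter fun t : Fin n => f t ≤ p) =
      (Finset.univ.filter fun t : Fin n => f t < p) ∪ fib f n p := by
    ext t
    simp only [Finset.mem_filter, Finset.mem_union, mem_fib, Finset.mem_univ, true_and]
    omega
  rw [h1, Finset.sum_union]
  · congr 1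
    rw [← Finset.sum_biUnion]
    · refine Finset.sum_congr ?_ fun _ _ => rfl
      ext t
      simp only [Finset.mem_biUnion, Finset.mem_univ, true_and, mem_fib, Finset.mem_filter]
      exact ⟨fun ⟨a, ha⟩ => ha ▸ a.2, fun ht => ⟨⟨f t, ht⟩, rfl⟩⟩
    · intro t _ t' _ htt
      exact fib_disjoint f n fun hl => htt (Fin.ext hl)
  · rw [Finset.disjoint_left]
    intro t ht ht'
    rw [mem_fib] at ht'
    simp only [Finset.mem_filter, Finset.mem_univ, true_and] at ht
    omega

/-- An element of a factor that receives nothing commutes with the image of `ins`. -/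
theorem slot_commute_ins {f : ℕ → ℕ} {p n : ℕ} {t : Fin n} (ht : p < f t) (x : g) (X : A h p) :
    Commute (slot h t x) (ins h f p n X) := by
  refine (A_commute (ins h f p n) _ (fun s y => ?_) (fun z => ?_) X).symm
  · rw [ins_slot]
    refine Commute.sum_left _ _ _ fun r hr => slot_commute ?_ _ _
    rintro rfl
    rw [mem_fib] at hr
    omega
  · rw [ins_last]
    refine Commute.add_left (Commute.sum_left _ _ _ fun r hr => slot_commute ?_ _ _)
      (slot_last_commute _ _ _).symm
    rintro rfl
    rw [mem_fib] at hr
    omega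

/-- The diagonal element of the target is the image of the diagonal element of the source plus terms
in factors that receive nothing; both parts commute with the image of `X`. -/
theorem ins_mem_g2 {f : ℕ → ℕ} {p n : ℕ} {X : A h p} (hX : X ∈ g2 h p) :
    ins h f p n X ∈ g2 h n := by
  rw [mem_g2]
  intro z
  have h1 : diag h n z = ins h f p n (diag h p z) +
      ∑ t ∈ Finset.univ.filter fun t : Fin n => ¬ f t ≤ p, slot h t (z : g) := by
    rw [ins_diag, diag, ← Finset.sum_filter_add_sum_filter_not Finset.univ
      (fun t : Fin n => f t ≤ p)]
    abel
  rw [h1]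
  refine Commute.add_left ((mem_g2.1 hX z).map _) (Commute.sum_left _ _ _ fun t ht => ?_)
  simp only [Finset.mem_filter, Finset.mem_univ, true_and] at ht
  exact slot_commute_ins (by omega) _ _

/-- `q` factors are substituted for the factor `i`. -/
def blkF (i q s : ℕ) : ℕ := if s < i then s else if s < i + q then i else s + 1 - q

/-- The factors before `i` receive nothing, and the factors from `i + q` on receive the last
factor. Here `n` is the number of the last factor of the target. -/
def shF (i q n s : ℕ) : ℕ :=
  if s < i then q + 1 else if s < i + q then s - i else if s ≤ n then q else q + 1

/-- The partial composition: `Q` is substituted for the factor `i` of `P`. -/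
noncomputable def circ (i p q n : ℕ) (P : A h p) (Q : A h q) : A h n :=
  ins h (blkF i q) p n P * ins h (shF i q n) q n Q

theorem circ_mem {i p q n : ℕ} {P : A h p} {Q : A h q} (hP : P ∈ g2 h p) (hQ : Q ∈ g2 h q) :
    circ i p q n P Q ∈ g2 h n :=
  mul_mem_g2 (ins_mem_g2 hP) (ins_mem_g2 hQ)

/-- Sequential associativity. Both sides are products of insertions of `P`, `Q`, `R` in this order,
so only the three assignments have to be compared. -/
theorem circ_circ {i j p q r n₁ m n : ℕ} (hi : i < p) (hj : j < q) (h₁ : n₁ + 1 = p + q)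
    (h₂ : n + 1 = n₁ + r) (h₃ : m + 1 = q + r) (P : A h p) (Q : A h q) (R : A h r) :
    circ (i + j) n₁ r n (circ i p q n₁ P Q) R = circ i p m n P (circ j q r m Q R) := by
  simp only [circ, map_mul]
  rw [ins_comp, ins_comp, ins_comp, ins_comp, mul_assoc]
  · congr 1
    · exact DFunLike.congr_fun (ins_congr _ fun t ht => by
        simp only [blkF]; split_ifs <;> omega) P
    · congr 1
      · exact DFunLike.congr_fun (ins_congr _ fun t ht => by
          simp only [blkF, shF]; split_ifs <;> omega) Q
      · exact DFunLike.congr_fun (ins_congr _ fun t ht => by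
          simp only [shF]; split_ifs <;> omega) R
  all_goals (try intro t ht); simp only [blkF, shF]; split_ifs <;> omega

/-- The generators in the numbered factors of `Q` land before the block of `R`. A generator z of the
last factor of `Q` is spread over everything after the block of `Q`: over factors that `R` does not
reach, and over the image of the diagonal element z of `R`, which commutes with `R` by invariance.
-/
theorem ins_shF_commute {i j q r n : ℕ} (hij : i + q ≤ j) {R : A h r} (hR : R ∈ g2 h r)
    (Q : A h q) : Commute (ins h (shF i q n) q n Q) (ins h (shF j r n) r n R) := by
  refine A_commute _ _ (fun s x => ?_) (fun z => ?_) Q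
  · rw [ins_slot]
    refine Commute.sum_left _ _ _ fun t ht => slot_commute_ins ?_ _ _
    have := s.2
    rw [mem_fib] at ht
    simp only [shF] at ht ⊢
    split_ifs at ht ⊢ <;> omega
  · have h1 := ((mem_g2.1 hR z).map (ins h (shF j r n) r n))
    rw [ins_diag] at h1
    have h2 : ins h (shF i q n) q n (last h q z) = ∑ t ∈ (fib (shF i q n) n q).filter
        (fun t : Fin n => ¬ shF j r n t ≤ r), slot h t (z : g) +
        (∑ t ∈ Finset.univ.filter fun t : Fin n => shF j r n t ≤ r, slot h t (z : g) +
          last h n z) := by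
      rw [ins_last, ← Finset.sum_filter_add_sum_filter_not (fib (shF i q n) n q)
        (fun t : Fin n => shF j r n t ≤ r), ← add_assoc]
      congr 1
      rw [add_comm]
      congr 1
      refine Finset.sum_congr ?_ fun _ _ => rfl
      ext t
      simp only [Finset.mem_filter, mem_fib, Finset.mem_univ, true_and, and_iff_right_iff_imp]
      simp only [shF]
      split_ifs <;> omega
    rw [h2]
    refine Commute.add_left (Commute.sum_left _ _ _ fun t ht => slot_commute_ins ?_ _ _) h1
    simp only [Finset.mem_filter] at ht
    omega

/-- Parallel associativity. The insertions of `Q` and `R` appear in opposite orders on the two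
sides, and `ins_shF_commute` exchanges them. -/
theorem circ_circ_of_lt {i l p q r n₁ m n : ℕ} (hil : i ≤ l) (hl : l + 1 < p)
    (h₁ : n₁ + 1 = p + q) (h₂ : n + 1 = n₁ + r) (h₃ : m + 1 = p + r) (P : A h p) (Q : A h q)
    {R : A h r} (hR : R ∈ g2 h r) :
    circ (l + q) n₁ r n (circ i p q n₁ P Q) R = circ i m q n (circ (l + 1) p r m P R) Q := by
  simp only [circ, map_mul]
  rw [ins_comp, ins_comp, ins_comp, ins_comp, mul_assoc, mul_assoc]
  · congr 1
    · exact DFunLike.congr_fun (ins_congr _ fun t ht => by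
        simp only [blkF]; split_ifs <;> omega) P
    · have e1 : ins h (fun t => shF i q n₁ (blkF (l + q) r t)) q n Q = ins h (shF i q n) q n Q :=
        DFunLike.congr_fun (ins_congr _ fun t ht => by
          simp only [blkF, shF]; split_ifs <;> omega) Q
      have e2 : ins h (fun t => shF (l + 1) r m (blkF i q t)) r n R =
          ins h (shF (l + q) r n) r n R :=
        DFunLike.congr_fun (ins_congr _ fun t ht => by
          simp only [blkF, shF]; split_ifs <;> omega) R
      rw [e1, e2]
      exact (ins_shF_commute (by omega) hR Q).eq
  all_goals (try intro t ht); simp only [blkF, shF]; split_ifs <;> omega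

end Operad

/-! ### The brace as a graded pre-Lie product -/

section Bracket

attribute [local instance 100] LieRing.ofAssociativeRing

variable {k : Type*} [Field k] {g : Type*} [LieRing g] [LieAlgebra k g] {h : LieSubalgebra k g}

theorem neg_one_pow_congr {a b : ℕ} (hab : a % 2 = b % 2) : (-1 : k) ^ a = (-1) ^ b := by
  rw [← Nat.div_add_mod a 2, ← Nat.div_add_mod b 2, hab]
  simp [pow_add, pow_mul]

theorem brace_apply {p q n : ℕ} (hn : n + 1 = p + q) (P : A h p) (Q : A h q) :
    brace h p q n P Q = ∑ i ∈ Finset.range p, (-1 : k) ^ ((q + 1) * i) • circ i p q n P Q := by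
  simp only [brace, LinearMap.sum_apply, LinearMap.smul_apply]
  refine Finset.sum_congr rfl fun i hi => ?_
  rw [Finset.mem_range] at hi
  congr 1
  have h1 : insA h (blk n i q) ∅ = (ins h (blkF i q) p n).toLinearMap := by
    refine insA_eq_ins _ _ _ _ _ (fun l hl => ?_) ?_
    · ext s
      have := s.2
      simp only [blk, mem_fib, Finset.mem_filter, Finset.mem_univ, true_and]
      simp only [blkF]
      split_ifs <;> omega
    · ext s
      have := s.2
      simp only [mem_fib, Finset.notMem_empty, false_iff]
      simp only [blkF]
      split_ifs <;> omega
  have h2 : insA h (shift n i) (fromOn n (i + q)) = (ins h (shF i q n) q n).toLinearMap := by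
    refine insA_eq_ins _ _ _ _ _ (fun l hl => ?_) ?_
    · ext s
      have := s.2
      simp only [shift, mem_fib, Finset.mem_filter, Finset.mem_univ, true_and]
      simp only [shF]
      split_ifs <;> omega
    · ext s
      have := s.2
      simp only [mem_fib, fromOn, Finset.mem_filter, Finset.mem_univ, true_and]
      simp only [shF]
      split_ifs <;> omega
  rw [h1, h2]
  rfl

theorem brace_zero_left {q n : ℕ} : brace h 0 q n = 0 := by
  simp [brace]

theorem brace_mem {p q n : ℕ} (hn : n + 1 = p + q) {P : A h p} {Q : A h q} (hP : P ∈ g2 h p)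
    (hQ : Q ∈ g2 h q) : brace h p q n P Q ∈ g2 h n := by
  rw [brace_apply hn]
  exact Submodule.sum_mem _ fun i _ => Submodule.smul_mem _ _ (circ_mem hP hQ)

theorem circ_sum_left {ι : Type*} (s : Finset ι) (c : ι → k) {i p q n : ℕ} (P : ι → A h p)
    (Q : A h q) : circ i p q n (∑ a ∈ s, c a • P a) Q = ∑ a ∈ s, c a • circ i p q n (P a) Q := by
  simp only [circ, map_sum, map_smul, Finset.sum_mul, smul_mul_assoc]

theorem circ_sum_right {ι : Type*} (s : Finset ι) (c : ι → k) {i p q n : ℕ} (P : A h p)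
    (Q : ι → A h q) : circ i p q n P (∑ a ∈ s, c a • Q a) = ∑ a ∈ s, c a • circ i p q n P (Q a) := by
  simp only [circ, map_sum, map_smul, Finset.mul_sum, mul_smul_comm]

/-- The part of `{{P|Q}|R}` in which `R` is substituted for a factor of `P` before `Q`. -/
noncomputable def braceBefore (p q r n₁ n : ℕ) (P : A h p) (Q : A h q) (R : A h r) : A h n :=
  ∑ a ∈ Finset.range p, ∑ l ∈ Finset.range a,
    (-1 : k) ^ ((q + 1) * a + (r + 1) * l) • circ l n₁ r n (circ a p q n₁ P Q) R

/-- The factors of a composite are those before the block of `Q`, those of the block, and those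
after it; `a - 1 + q` is the new place of the factor `a` of `P`. -/
theorem sum_range_split {M : Type*} [AddCommMonoid M] {p i q n₁ : ℕ} (hi : i < p)
    (hn : n₁ + 1 = p + q) (F : ℕ → M) :
    ∑ l ∈ Finset.range n₁, F l = ∑ l ∈ Finset.range i, F l + ∑ j ∈ Finset.range q, F (i + j) +
      ∑ a ∈ Finset.Ico (i + 1) p, F (a - 1 + q) := by
  obtain ⟨c, rfl⟩ := Nat.exists_eq_add_of_lt hi
  obtain rfl : n₁ = i + q + c := by omega
  rw [Finset.sum_range_add, Finset.sum_range_add, Finset.sum_Ico_eq_sum_range]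
  congr 1
  rw [show i + c + 1 - (i + 1) = c by omega]
  refine Finset.sum_congr rfl fun x _ => ?_
  congr 1
  omega

/-- `R` enters a factor of `P` before `Q`, or `Q` itself, or a factor of `P` after `Q`. By parallel
associativity the third case is the first one with `Q` and `R` exchanged. For `q = 0` the brace
`{Q|R}` is zero, and `m` is left free to allow for `q = r = 0`. -/
theorem brace_brace {p q r n₁ n₂ m n : ℕ} (hn₁ : n₁ + 1 = p + q) (hn₂ : n₂ + 1 = p + r)
    (hn : n + 1 = n₁ + r) (hm : 0 < q → m + 1 = q + r)
    (P : A h p) (Q : A h q) {R : A h r} (hR : R ∈ g2 h r) :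
    brace h n₁ r n (brace h p q n₁ P Q) R =
      brace h p m n P (brace h q r m Q R) + braceBefore p q r n₁ n P Q R +
        (-1 : k) ^ ((q + 1) * (r + 1)) • braceBefore p r q n₂ n P R Q := by
  have h0 : brace h p m n P (brace h q r m Q R) = ∑ i ∈ Finset.range p, ∑ j ∈ Finset.range q,
      ((-1 : k) ^ ((q + r) * i) * (-1) ^ ((r + 1) * j)) •
        circ i p m n P (circ j q r m Q R) := by
    rcases Nat.eq_zero_or_pos q with rfl | hq
    · simp [brace_zero_left]
    · rw [brace_apply (show n + 1 = p + m by have := hm hq; omega), brace_apply (hm hq), hm hq]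
      simp only [circ_sum_right, Finset.smul_sum, smul_smul]
  rw [h0, brace_apply hn, brace_apply hn₁]
  simp only [circ_sum_left, Finset.smul_sum, smul_smul]
  rw [Finset.sum_comm]
  have h1 : ∀ i ∈ Finset.range p, ∑ l ∈ Finset.range n₁,
      ((-1 : k) ^ ((r + 1) * l) * (-1) ^ ((q + 1) * i)) •
        circ l n₁ r n (circ i p q n₁ P Q) R =
      (∑ l ∈ Finset.range i,
        (-1 : k) ^ ((q + 1) * i + (r + 1) * l) • circ l n₁ r n (circ i p q n₁ P Q) R +
      ∑ j ∈ Finset.range q, ((-1 : k) ^ ((q + r) * i) * (-1) ^ ((r + 1) * j)) •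
        circ i p m n P (circ j q r m Q R)) +
      ∑ a ∈ Finset.Ico (i + 1) p, ((-1 : k) ^ ((q + 1) * (r + 1)) *
        (-1 : k) ^ ((r + 1) * a + (q + 1) * i)) • circ i n₂ q n (circ a p r n₂ P R) Q := by
    intro i hi
    rw [Finset.mem_range] at hi
    rw [sum_range_split hi hn₁]
    congr 1
    · congr 1
      · refine Finset.sum_congr rfl fun l _ => ?_
        rw [pow_add, mul_comm]
      · refine Finset.sum_congr rfl fun j hj => ?_
        rw [Finset.mem_range] at hj
        rw [circ_circ hi hj hn₁ hn (hm (by omega)), ← pow_add, ← pow_add]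
        congr 1
        apply neg_one_pow_congr
        rw [show (r + 1) * (i + j) + (q + 1) * i = (q + r) * i + (r + 1) * j + 2 * i by ring]
        omega
    · refine Finset.sum_congr rfl fun a ha => ?_
      rw [Finset.mem_Ico] at ha
      obtain ⟨l, rfl⟩ : ∃ l, a = l + 1 := ⟨a - 1, by omega⟩
      rw [Nat.add_sub_cancel, circ_circ_of_lt (by omega) (by omega) hn₁ hn hn₂ P Q hR,
        ← pow_add, ← pow_add]
      congr 1
      apply neg_one_pow_congr
      rw [show (q + 1) * (r + 1) + ((r + 1) * (l + 1) + (q + 1) * i) =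
        (r + 1) * (l + q) + (q + 1) * i + 2 * (r + 1) by ring]
      omega
  rw [Finset.sum_congr rfl h1, Finset.sum_add_distrib, Finset.sum_add_distrib, braceBefore,
    braceBefore, Finset.smul_sum]
  congr 1
  · rw [add_comm]
  · simp only [Finset.smul_sum, smul_smul]
    refine Finset.sum_comm' fun x y => ?_
    simp only [Finset.mem_range, Finset.mem_Ico]
    omega

theorem bracketG_apply (p q n : ℕ) (P : A h p) (Q : A h q) :
    bracketG h p q n P Q =
      brace h p q n P Q - (-1 : k) ^ ((p + 1) * (q + 1)) • brace h q p n Q P := by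
  simp [bracketG, sub_eq_add_neg]

theorem bracketG_antisymm (p q n : ℕ) (P : A h p) (Q : A h q) :
    bracketG h p q n P Q = -((-1 : k) ^ ((p + 1) * (q + 1)) • bracketG h q p n Q P) := by
  rw [bracketG_apply, bracketG_apply, smul_sub, smul_smul, mul_comm (q + 1), ← pow_add,
    ← two_mul, pow_mul]
  simp

/-- The graded symmetry of the associator of the brace -/
theorem brace_assoc_symm {p q r n₁ n₂ m n : ℕ} (hn₁ : n₁ = p + q - 1) (hn₂ : n₂ = p + r - 1)
    (hn : n + 2 = p + q + r) (hm : m = q + r - 1)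
    (P : A h p) {Q : A h q} (hQ : Q ∈ g2 h q) {R : A h r} (hR : R ∈ g2 h r) :
    brace h n₁ r n (brace h p q n₁ P Q) R - brace h p m n P (brace h q r m Q R) =
      (-1 : k) ^ ((q + 1) * (r + 1)) •
        (brace h n₂ q n (brace h p r n₂ P R) Q - brace h p m n P (brace h r q m R Q)) := by
  -- For `p = 0` all terms vanish; for `p > 0` the subtractions in `n₁` and `n₂` are not truncated.
  rcases Nat.eq_zero_or_pos p with rfl | hp
  · simp [brace_zero_left]
  rw [brace_brace (n₂ := n₂) (m := m) (by omega) (by omega) (by omega) (by omega) P Q hR,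
    brace_brace (n₂ := n₁) (m := m) (by omega) (by omega) (by omega) (by omega) P R hQ]
  rw [mul_comm (r + 1)]
  have : (-1 : k) ^ ((q + 1) * (r + 1)) * (-1 : k) ^ ((q + 1) * (r + 1)) = 1 := by
    rw [← pow_add, ← two_mul, pow_mul]; simp
  generalize (-1 : k) ^ ((q + 1) * (r + 1)) = e at this
  simp only [smul_add, smul_sub, smul_smul, this]
  module

end Bracket

/-! ### The Jacobi identity and the inner differential -/

section DGLA

attribute [local instance 100] LieRing.ofAssociativeRing

variable {k : Type*} [Field k] {g : Type*} [LieRing g] [LieAlgebra k g] {h : LieSubalgebra k g}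

theorem bracketG_mem {p q n : ℕ} (hn : n + 1 = p + q) {P : A h p} {Q : A h q} (hP : P ∈ g2 h p)
    (hQ : Q ∈ g2 h q) : bracketG h p q n P Q ∈ g2 h n := by
  rw [bracketG_apply]
  exact sub_mem (brace_mem hn hP hQ) (Submodule.smul_mem _ _ (brace_mem (by omega) hQ hP))

theorem bracketG_zero_zero (n : ℕ) : bracketG h 0 0 n = 0 := by
  refine LinearMap.ext₂ fun P Q => ?_
  simp [bracketG_apply, brace_zero_left]

/-- The sign is split into those of the pairs (P,Q) and (P,R), the form needed to compare the three
terms of the Jacobi identity. The case `q = r = 0`, where `m + 1 ≠ q + r`, is trivial. -/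
theorem bracketG_bracketG {p q r m n : ℕ} (hm : m = q + r - 1) (P : A h p) (Q : A h q)
    (R : A h r) : bracketG h p m n P (bracketG h q r m Q R) =
      brace h p m n P (brace h q r m Q R) -
        (-1 : k) ^ ((q + 1) * (r + 1)) • brace h p m n P (brace h r q m R Q) -
        ((-1 : k) ^ ((p + 1) * (q + 1)) * (-1 : k) ^ ((p + 1) * (r + 1))) •
          (brace h m p n (brace h q r m Q R) P -
            (-1 : k) ^ ((q + 1) * (r + 1)) • brace h m p n (brace h r q m R Q) P) := by
  rcases Nat.eq_zero_or_pos (q + r) with hqr | hqr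
  · obtain rfl : q = 0 := by omega
    obtain rfl : r = 0 := by omega
    simp [bracketG_zero_zero, brace_zero_left]
  · rw [bracketG_apply, bracketG_apply, map_sub, map_sub, map_smul, map_smul,
      LinearMap.sub_apply, LinearMap.smul_apply]
    congr 2
    rw [← pow_add]
    apply neg_one_pow_congr
    rw [show (p + 1) * (q + 1) + (p + 1) * (r + 1) = (p + 1) * (q + r) + 2 * (p + 1) by ring,
      show m + 1 = q + r by omega]
    omega

/-- The commutator of a graded pre-Lie product satisfies the Jacobi identity. The `a`s are the
twelve double braces of P, Q, R; `x`, `y`, `z` are the signs of the pairs (P,Q), (Q,R), (P,R); the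
hypotheses are the symmetry of the associator with P, Q, R in first place, respectively. -/
theorem jacobi_of_assoc {M : Type*} [AddCommGroup M] [Module k M] {x y z : k}
    (hx : x = 1 ∨ x = -1) (hy : y = 1 ∨ y = -1) (hz : z = 1 ∨ z = -1)
    {a1 a2 a3 a4 a5 a6 a7 a8 a9 a10 a11 a12 : M} (h1 : a5 - a1 = y • (a11 - a2))
    (h2 : a6 - a9 = z • (a3 - a10)) (h3 : a12 - a7 = x • (a4 - a8)) :
    a1 - y • a2 - (x * z) • (a3 - y • a4) =
      -((z * y) • (a7 - x • a8 - (z * y) • (a5 - x • a6))) +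
        x • (a9 - z • a10 - (x * y) • (a11 - z • a12)) := by
  obtain rfl : a5 = y • (a11 - a2) + a1 := sub_eq_iff_eq_add.1 h1
  obtain rfl : a6 = z • (a3 - a10) + a9 := sub_eq_iff_eq_add.1 h2
  obtain rfl : a12 = x • (a4 - a8) + a7 := sub_eq_iff_eq_add.1 h3
  rcases hx with rfl | rfl <;> rcases hy with rfl | rfl <;> rcases hz with rfl | rfl <;> module

theorem bracketG_jacobi {p q r n₁ n₂ m n : ℕ} (hn₁ : n₁ = p + q - 1) (hn₂ : n₂ = p + r - 1)
    (hn : n + 2 = p + q + r) (hm : m = q + r - 1) {P : A h p} (hP : P ∈ g2 h p)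
    {Q : A h q} (hQ : Q ∈ g2 h q) {R : A h r} (hR : R ∈ g2 h r) :
    bracketG h p m n P (bracketG h q r m Q R) =
      bracketG h n₁ r n (bracketG h p q n₁ P Q) R +
        (-1 : k) ^ ((p + 1) * (q + 1)) • bracketG h q n₂ n Q (bracketG h p r n₂ P R) := by
  have e : bracketG h n₁ r n (bracketG h p q n₁ P Q) R =
      -(((-1 : k) ^ ((p + 1) * (r + 1)) * (-1 : k) ^ ((q + 1) * (r + 1))) •
        bracketG h r n₁ n R (bracketG h p q n₁ P Q)) := by
    rcases Nat.eq_zero_or_pos (p + q) with hpq | hpq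
    · obtain rfl : p = 0 := by omega
      obtain rfl : q = 0 := by omega
      simp [bracketG_zero_zero]
    · rw [bracketG_antisymm n₁ r]
      congr 2
      rw [← pow_add]
      apply neg_one_pow_congr
      rw [show (p + 1) * (r + 1) + (q + 1) * (r + 1) = (p + q) * (r + 1) + 2 * (r + 1) by ring,
        show n₁ + 1 = p + q by omega]
      omega
  have h1 := brace_assoc_symm hn₁ hn₂ hn hm P hQ hR
  have h2 := brace_assoc_symm (n₁ := n₁) (n₂ := m) (n := n) (m := n₂) (by omega) hm (by omega)
    (by omega) Q hP hR
  have h3 := brace_assoc_symm (n₁ := n₂) (n₂ := m) (n := n) (m := n₁) (by omega) (by omega)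
    (by omega) (by omega) R hP hQ
  rw [e, bracketG_bracketG hm, bracketG_bracketG hn₁, bracketG_bracketG hn₂,
    mul_comm (r + 1) (p + 1), mul_comm (r + 1) (q + 1), mul_comm (q + 1) (p + 1)]
  generalize brace h p m n P (brace h q r m Q R) = a1 at *
  generalize brace h p m n P (brace h r q m R Q) = a2 at *
  generalize brace h m p n (brace h q r m Q R) P = a3 at *
  generalize brace h m p n (brace h r q m R Q) P = a4 at *
  generalize brace h n₁ r n (brace h p q n₁ P Q) R = a5 at *
  generalize brace h n₁ r n (brace h q p n₁ Q P) R = a6 at *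
  generalize brace h r n₁ n R (brace h p q n₁ P Q) = a7 at *
  generalize brace h r n₁ n R (brace h q p n₁ Q P) = a8 at *
  generalize brace h q n₂ n Q (brace h p r n₂ P R) = a9 at *
  generalize brace h q n₂ n Q (brace h r p n₂ R P) = a10 at *
  generalize brace h n₂ q n (brace h p r n₂ P R) Q = a11 at *
  generalize brace h n₂ q n (brace h r p n₂ R P) Q = a12 at *
  generalize ((p + 1) * (q + 1)) = x at *
  generalize ((q + 1) * (r + 1)) = y at *
  generalize ((p + 1) * (r + 1)) = z at *
  exact jacobi_of_assoc (neg_one_pow_eq_or k x) (neg_one_pow_eq_or k y) (neg_one_pow_eq_or k z)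
    h1 h2 h3

/-- For `i ≥ 1` the factor `i - 1` is doubled; for `i = 0` the factor `0` receives nothing. -/
def dblF (n i s : ℕ) : ℕ := if s < i then s else if s = 0 then n + 1 else s - 1

theorem b_apply (n : ℕ) (P : A h n) :
    b h n P = ∑ i ∈ Finset.range (n + 2), (-1 : k) ^ i • ins h (dblF n i) n (n + 1) P := by
  have h1 : insA h (shift (n + 1) 1) ∅ = (ins h (dblF n 0) n (n + 1)).toLinearMap := by
    refine insA_eq_ins _ _ _ _ _ (fun l hl => ?_) ?_
    · ext s
      have := s.2
      simp only [shift, mem_fib, Finset.mem_filter, Finset.mem_univ, true_and]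
      simp only [dblF]
      split_ifs <;> omega
    · ext s
      have := s.2
      simp only [mem_fib, Finset.notMem_empty, false_iff]
      simp only [dblF]
      split_ifs <;> omega
  have h2 : ∀ j ∈ Finset.range n, insA h (blk (n + 1) j 2) ∅ =
      (ins h (dblF n (j + 1)) n (n + 1)).toLinearMap := by
    intro j hj
    rw [Finset.mem_range] at hj
    refine insA_eq_ins _ _ _ _ _ (fun l hl => ?_) ?_
    · ext s
      have := s.2
      simp only [blk, mem_fib, Finset.mem_filter, Finset.mem_univ, true_and]
      simp only [dblF]
      split_ifs <;> omega
    · ext s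
      have := s.2
      simp only [mem_fib, Finset.notMem_empty, false_iff]
      simp only [dblF]
      split_ifs <;> omega
  have h3 : insA h (shift (n + 1) 0) (fromOn (n + 1) n) =
      (ins h (dblF n (n + 1)) n (n + 1)).toLinearMap := by
    refine insA_eq_ins _ _ _ _ _ (fun l hl => ?_) ?_
    · ext s
      have := s.2
      simp only [shift, mem_fib, Finset.mem_filter, Finset.mem_univ, true_and]
      simp only [dblF]
      split_ifs
      omega
    · ext s
      have := s.2
      simp only [mem_fib, fromOn, Finset.mem_filter, Finset.mem_univ, true_and]
      simp only [dblF]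
      split_ifs <;> omega
  rw [Finset.sum_range_succ, Finset.sum_range_succ', b, h1, h3, Finset.sum_congr rfl
    fun j hj => by rw [h2 j hj]]
  simp only [LinearMap.add_apply, LinearMap.sum_apply, LinearMap.smul_apply,
    AlgHom.toLinearMap_apply, pow_zero, one_smul]
  abel

/-- The doublings of the numbered factors come from `{P|1}`, the two outer terms from `{1|P}`. As
the differential is inner, its square and its derivation property are instances of the Jacobi
identity. -/
theorem b_eq_neg_bracketG (n : ℕ) (P : A h n) :
    b h n P = -bracketG h n 2 (n + 1) P (1 : A h 2) := by
  rw [b_apply, bracketG_apply, brace_apply (by omega), brace_apply (by omega)]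
  simp only [circ, map_one, mul_one, one_mul]
  rw [Finset.sum_range_succ, Finset.sum_range_succ', Finset.sum_range_succ, Finset.sum_range_one]
  have e0 : ins h (shF 0 n (n + 1)) n (n + 1) = ins h (dblF n (n + 1)) n (n + 1) :=
    ins_congr _ fun t ht => by simp only [dblF, shF]; split_ifs <;> omega
  have e1 : ins h (shF 1 n (n + 1)) n (n + 1) = ins h (dblF n 0) n (n + 1) :=
    ins_congr _ fun t ht => by simp only [dblF, shF]; split_ifs <;> omega
  have e2 : ∀ j ∈ Finset.range n, (-1 : k) ^ ((2 + 1) * j) •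
      ins h (blkF j 2) n (n + 1) P =
      -((-1 : k) ^ (j + 1) • ins h (dblF n (j + 1)) n (n + 1) P) := by
    intro j hj
    rw [Finset.mem_range] at hj
    rw [show ins h (blkF j 2) n (n + 1) = ins h (dblF n (j + 1)) n (n + 1) from
      ins_congr _ fun t ht => by simp only [dblF, blkF]; split_ifs <;> omega,
      neg_one_pow_congr (show ((2 + 1) * j) % 2 = j % 2 by omega), pow_succ]
    module
  rw [e0, e1, Finset.sum_congr rfl e2, Finset.sum_neg_distrib, smul_add, smul_smul, smul_smul,
    ← pow_add, ← pow_add, neg_one_pow_congr (show ((n + 1) * (2 + 1) + (n + 1) * 0) % 2 =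
      (n + 1) % 2 by omega), neg_one_pow_congr (show ((n + 1) * (2 + 1) + (n + 1) * 1) % 2 =
      0 % 2 by omega)]
  abel

theorem isDGLA_g2 [CharZero k] : IsDGLA k (g2 h) (b h) (bracketG h) where
  d_mem n P hP := by
    rw [b_eq_neg_bracketG]
    exact neg_mem (bracketG_mem (by omega) hP (one_mem_g2 2))
  br_mem p q n hn P hP Q hQ := bracketG_mem hn hP hQ
  br_zero_zero n P _ Q _ := by rw [bracketG_zero_zero]; rfl
  d_d n P hP := by
    -- The two insertions of the unit into the unit have opposite signs.
    have hμ : bracketG h 2 2 3 (1 : A h 2) (1 : A h 2) = 0 := by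
      rw [bracketG_apply, brace_apply (by omega)]
      simp only [circ, map_one, mul_one, Finset.sum_range_succ, Finset.sum_range_zero]
      norm_num
      module
    -- Jacobi for `P, 1, 1` becomes `0 = 2 • [[P,1],1]`, and 2 is invertible.
    have hj := bracketG_jacobi (n₁ := n + 1) (n₂ := n + 1) (m := 3) (n := n + 2) (by omega)
      (by omega) (by omega) (by omega) hP (one_mem_g2 2) (one_mem_g2 2)
    rw [hμ, map_zero, bracketG_antisymm 2 (n + 1), smul_neg, smul_smul, ← pow_add,
      neg_one_pow_congr (show ((n + 1) * (2 + 1) + (2 + 1) * (n + 1 + 1)) % 2 = 1 % 2 by omega),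
      pow_one, neg_smul, one_smul, neg_neg, ← two_smul k] at hj
    rw [b_eq_neg_bracketG, b_eq_neg_bracketG, map_neg, LinearMap.neg_apply, neg_neg]
    exact (smul_eq_zero.1 hj.symm).resolve_left two_ne_zero
  antisymm p q n _ P _ Q _ := bracketG_antisymm p q n P Q
  jacobi p q r n hn P hP Q hQ R hR := bracketG_jacobi rfl rfl hn rfl hP hQ hR
  leibniz p q n hn P hP Q hQ := by
    have hj := bracketG_jacobi (n₁ := n) (n₂ := p + 1) (m := q + 1) (n := n + 1) (by omega)
      (by omega) (by omega) (by omega) hP hQ (one_mem_g2 2)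
    rw [bracketG_antisymm q (p + 1), smul_neg, smul_smul, ← pow_add,
      neg_one_pow_congr (show ((p + 1) * (q + 1) + (q + 1) * (p + 1 + 1)) % 2 = (q + 1) % 2 by
        rw [show (p + 1) * (q + 1) + (q + 1) * (p + 1 + 1) = (q + 1) + 2 * ((q + 1) * (p + 1)) by
          ring]
        omega)] at hj
    rw [b_eq_neg_bracketG, b_eq_neg_bracketG, b_eq_neg_bracketG, map_neg, map_neg,
      LinearMap.neg_apply, hj, smul_neg]
    abel
  leibniz_zero P hP Q hQ := by
    have hj := bracketG_jacobi (n₁ := 0) (n₂ := 1) (m := 1) (n := 0) (by omega)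
      (by omega) (by omega) (by omega) hP hQ (one_mem_g2 2)
    rw [bracketG_zero_zero, bracketG_antisymm 0 1 0 Q] at hj
    rw [b_eq_neg_bracketG, b_eq_neg_bracketG, map_neg, map_neg, LinearMap.neg_apply, hj]
    simp

end DGLA

/-! ### Diagonalizable operators and comparison of coefficients -/

section LinearAlgebra

variable {k : Type*} [Field k] {V : Type*} [AddCommGroup V] [Module k V]

/-- If `V` is spanned by eigenvectors of `W` with eigenvalues among the distinct scalars `c n`, a
linear map can be prescribed on every eigenspace. -/
theorem exists_linearMap_of_eigenspaces {V' : Type*} [AddCommGroup V'] [Module k V']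
    (W : Module.End k V) {c : ℕ → k} (hc : Function.Injective c)
    (hW : ⨆ n, Module.End.eigenspace W (c n) = ⊤) (F : ℕ → V →ₗ[k] V') :
    ∃ Φ : V →ₗ[k] V', ∀ n v, W v = c n • v → Φ v = F n v := by
  classical
  have hind : iSupIndep fun n => Module.End.eigenspace W (c n) :=
    (Module.End.eigenspaces_iSupIndep W).comp hc
  have hint := DirectSum.isInternal_submodule_of_iSupIndep_of_iSup_eq_top hind hW
  let e := LinearEquiv.ofBijective
    (DirectSum.coeLinearMap fun n => Module.End.eigenspace W (c n)) hint
  refine ⟨(DirectSum.toModule k ℕ V' fun n =>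
    F n ∘ₗ (Module.End.eigenspace W (c n)).subtype) ∘ₗ e.symm.toLinearMap, fun n v hv => ?_⟩
  have hv' : v ∈ Module.End.eigenspace W (c n) := Module.End.mem_eigenspace_iff.2 hv
  have h1 : e.symm v = DirectSum.lof k ℕ (fun n => Module.End.eigenspace W (c n)) n ⟨v, hv'⟩ := by
    rw [LinearEquiv.symm_apply_eq]
    exact (DirectSum.coeLinearMap_lof _ n ⟨v, hv'⟩).symm
  rw [LinearMap.comp_apply, LinearEquiv.coe_coe, h1, DirectSum.toModule_lof]
  rfl

theorem iSup_eigenspace_eq_top {W : Module.End k V} {c : ℕ → k} {S : Set V}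
    (hS : Submodule.span k S = ⊤) (h : ∀ v ∈ S, ∃ n, W v = c n • v) :
    ⨆ n, Module.End.eigenspace W (c n) = ⊤ := by
  rw [eq_top_iff, ← hS, Submodule.span_le]
  intro v hv
  obtain ⟨n, hn⟩ := h v hv
  exact Submodule.mem_iSup_of_mem n (Module.End.mem_eigenspace_iff.2 hn)

/-- Applying `W - c a` kills one component and multiplies the others by nonzero scalars, which
allows induction on their number. -/
theorem mem_of_sum_eigenvectors_mem {W : Module.End k V} {c : ℕ → k}
    (hc : Function.Injective c) {S : Submodule k V} (hS : ∀ v ∈ S, W v ∈ S) (F : Finset ℕ)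
    (v : ℕ → V) (hv : ∀ n, W (v n) = c n • v n) (hF : ∑ n ∈ F, v n ∈ S) : ∀ n ∈ F, v n ∈ S := by
  classical
  induction F using Finset.induction_on generalizing v with
  | empty => simp
  | insert a F ha ih =>
    have h1 : ∑ n ∈ F, (c n - c a) • v n ∈ S := by
      have h2 := sub_mem (hS _ hF) (S.smul_mem (c a) hF)
      rw [map_sum, Finset.smul_sum, ← Finset.sum_sub_distrib, Finset.sum_insert ha] at h2
      simpa [hv, sub_smul] using h2
    have h3 := ih (fun n => (c n - c a) • v n) (fun n => by
      rw [map_smul, hv, smul_comm]) h1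
    have h4 : ∀ n ∈ F, v n ∈ S := fun n hn => by
      have h5 : c n - c a ≠ 0 := sub_ne_zero.2 fun h => ha (hc h ▸ hn)
      exact (S.smul_mem_iff h5).1 (h3 n hn)
    intro n hn
    rcases Finset.mem_insert.1 hn with rfl | hn
    · rw [Finset.sum_insert ha] at hF
      exact (S.add_mem_iff_left (S.sum_mem h4)).1 hF
    · exact h4 n hn

theorem exists_sum_eigenvectors {W : Module.End k V} {c : ℕ → k}
    (hW : ⨆ n, Module.End.eigenspace W (c n) = ⊤) (x : V) :
    ∃ (F : Finset ℕ) (v : ℕ → V), (∀ n, W (v n) = c n • v n) ∧ ∑ n ∈ F, v n = x := by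
  obtain ⟨f, hf, rfl⟩ := (Submodule.mem_iSup_iff_exists_finsupp _ x).1 (hW ▸ Submodule.mem_top)
  exact ⟨f.support, f, fun n => Module.End.mem_eigenspace_iff.1 (hf n), rfl⟩

/-- A subspace that is stable under `W` is spanned by the eigenvectors of `W` that it contains. -/
theorem exists_sum_eigenvectors_of_mem {W : Module.End k V} {c : ℕ → k}
    (hc : Function.Injective c) (hW : ⨆ n, Module.End.eigenspace W (c n) = ⊤)
    {S : Submodule k V} (hS : ∀ v ∈ S, W v ∈ S) {x : V} (hx : x ∈ S) :
    ∃ (F : Finset ℕ) (v : ℕ → V), (∀ n, W (v n) = c n • v n) ∧ (∀ n ∈ F, v n ∈ S) ∧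
      ∑ n ∈ F, v n = x := by
  obtain ⟨F, v, hv, rfl⟩ := exists_sum_eigenvectors hW x
  exact ⟨F, v, hv, mem_of_sum_eigenvectors_mem hc hS F v hv hx, rfl⟩

/-- Linear functionals reduce this to scalar polynomials, and a polynomial that vanishes on an
infinite field is zero. -/
theorem eq_zero_of_sum_pow_smul [CharZero k] {N : ℕ} {a : ℕ → V}
    (h : ∀ s : k, ∑ i ∈ Finset.range N, s ^ i • a i = 0) : ∀ i < N, a i = 0 := by
  intro i hi
  refine (Module.forall_dual_apply_eq_zero_iff k _).1 fun f => ?_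
  have h1 : (∑ j ∈ Finset.range N, Polynomial.C (f (a j)) * Polynomial.X ^ j : Polynomial k) = 0 := by
    refine Polynomial.funext fun s => ?_
    rw [Polynomial.eval_finsetSum, Polynomial.eval_zero]
    have := congrArg f (h s)
    rw [map_sum, map_zero] at this
    rw [← this]
    refine Finset.sum_congr rfl fun j _ => ?_
    rw [Polynomial.eval_mul, Polynomial.eval_C, Polynomial.eval_pow, Polynomial.eval_X, map_smul,
      smul_eq_mul, mul_comm]
  have h2 := congrArg (fun p => Polynomial.coeff p i) h1
  simpa [Polynomial.finsetSum_coeff, Polynomial.coeff_C_mul_X_pow, hi] using h2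

/-- `f s` is a polynomial in `s` with constant term `a₀` and linear term `a₁`. -/
def HasExpansion {R : Type*} [Ring R] [Algebra k R] (f : k → R) (a₀ a₁ : R) : Prop :=
  ∃ p : Polynomial R, p.coeff 0 = a₀ ∧ p.coeff 1 = a₁ ∧
    ∀ s, f s = p.eval (algebraMap k R s)

theorem HasExpansion.mul {R : Type*} [Ring R] [Algebra k R] {f f' : k → R} {a₀ a₁ b₀ b₁ : R}
    (hf : HasExpansion f a₀ a₁) (hf' : HasExpansion f' b₀ b₁) :
    HasExpansion (fun s => f s * f' s) (a₀ * b₀) (a₀ * b₁ + a₁ * b₀) := by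
  obtain ⟨p, rfl, rfl, hp⟩ := hf
  obtain ⟨q, rfl, rfl, hq⟩ := hf'
  refine ⟨p * q, by simp, ?_, fun s => ?_⟩
  · rw [Polynomial.mul_coeff_one]
  · beta_reduce
    rw [hp, hq, Polynomial.eval, Polynomial.eval, Polynomial.eval,
      Polynomial.eval₂_mul_noncomm _ _ fun i => (Algebra.commutes s _).symm]

theorem HasExpansion.add_smul {R : Type*} [Ring R] [Algebra k R] (x y : R) :
    HasExpansion (fun s : k => x + s • y) x y :=
  ⟨Polynomial.C x + Polynomial.C y * Polynomial.X, by simp, by simp [Polynomial.coeff_C], fun s => by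
    simp [Algebra.smul_def, Algebra.commutes]⟩

theorem HasExpansion.pow {R : Type*} [Ring R] [Algebra k R] {f : k → R} {a₀ a₁ : R}
    (hf : HasExpansion f a₀ a₁) (n : ℕ) : HasExpansion (fun s => f s ^ n) (a₀ ^ n)
      (∑ i ∈ Finset.range n, a₀ ^ i * a₁ * a₀ ^ (n - 1 - i)) := by
  induction n with
  | zero => exact ⟨1, by simp, by simp [Polynomial.coeff_one], fun s => by simp⟩
  | succ n ih =>
    have h1 := ih.mul hf
    simp only [← pow_succ] at h1
    convert h1 using 1
    rw [Finset.sum_range_succ, Finset.sum_mul, add_comm]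
    congr 1
    · simp
    · refine Finset.sum_congr rfl fun i hi => ?_
      rw [Finset.mem_range] at hi
      rw [mul_assoc _ (a₀ ^ (n - 1 - i)), ← pow_succ]
      congr 2
      omega

/-- This differentiates at `s = 0` in a noncommutative algebra. It is applied to products of powers
of elements `x + s • y`, whose linear terms are sums of words with one `y`. -/
theorem HasExpansion.map_eq [CharZero k] {R : Type*} [Ring R] [Algebra k R] {f : k → R}
    {a₀ a₁ : R} (hf : HasExpansion f a₀ a₁) (φ : R →ₗ[k] V) {w₀ w₁ : V}
    (h : ∀ s, φ (f s) = w₀ + s • w₁) : φ a₁ = w₁ := by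
  obtain ⟨p, rfl, rfl, hp⟩ := hf
  have h1 : ∀ s : k, ∑ i ∈ Finset.range (p.natDegree + 2),
      s ^ i • (φ (p.coeff i) - if i = 0 then w₀ else if i = 1 then w₁ else 0) = 0 := by
    intro s
    have h2 : φ (f s) = ∑ i ∈ Finset.range (p.natDegree + 2), s ^ i • φ (p.coeff i) := by
      rw [hp, Polynomial.eval_eq_sum_range' (show p.natDegree < p.natDegree + 2 by omega), map_sum]
      refine Finset.sum_congr rfl fun i _ => ?_
      rw [← map_pow, ← Algebra.commutes, ← Algebra.smul_def, map_smul]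
    simp only [smul_sub, Finset.sum_sub_distrib]
    rw [← h2, h, Finset.sum_range_succ', Finset.sum_range_succ']
    simp [add_comm]
  have h3 := eq_zero_of_sum_pow_smul h1 1 (by omega)
  simpa [sub_eq_zero] using h3

theorem HasExpansion.mem [CharZero k] {R : Type*} [Ring R] [Algebra k R] {f : k → R}
    {a₀ a₁ : R} (hf : HasExpansion f a₀ a₁) {S : Submodule k R} (h : ∀ s, f s ∈ S) : a₁ ∈ S := by
  rw [← Submodule.Quotient.mk_eq_zero]
  exact hf.map_eq S.mkQ (w₀ := 0) (w₁ := 0) fun s => by simp [h s]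

end LinearAlgebra

/-! ### Powers of elements span the enveloping algebra; the Adams operation -/

section Powers

attribute [local instance 100] LieRing.ofAssociativeRing

variable (k : Type*) [Field k] (L : Type*) [LieRing L] [LieAlgebra k L]

local notation "ι" => UniversalEnvelopingAlgebra.ι k

/-- The standard filtration of the enveloping algebra -/
noncomputable def stdFilt (n : ℕ) : Submodule k (U k L) :=
  (1 ⊔ LinearMap.range (ι : L →ₗ⁅k⁆ U k L).toLinearMap) ^ n

variable {k L}

theorem stdFilt_zero : stdFilt k L 0 = 1 := pow_zero _

theorem stdFilt_add (a b : ℕ) : stdFilt k L (a + b) = stdFilt k L a * stdFilt k L b := pow_add _ _ _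

theorem mul_mem_stdFilt {a b c : ℕ} (h : a + b = c) {u v : U k L} (hu : u ∈ stdFilt k L a)
    (hv : v ∈ stdFilt k L b) : u * v ∈ stdFilt k L c := by
  rw [← h, stdFilt_add]
  exact Submodule.mul_mem_mul hu hv

theorem stdFilt_mono {a b : ℕ} (h : a ≤ b) : stdFilt k L a ≤ stdFilt k L b :=
  pow_le_pow_right₀ (M₀ := Submodule k (U k L)) (by exact le_sup_left) h

theorem ι_mem_stdFilt (x : L) : ι x ∈ stdFilt k L 1 := by
  rw [stdFilt, pow_one]
  exact Submodule.mem_sup_right ⟨x, rfl⟩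

theorem one_mem_stdFilt (n : ℕ) : (1 : U k L) ∈ stdFilt k L n := by
  refine stdFilt_mono (Nat.zero_le n) ?_
  rw [stdFilt_zero]
  exact Submodule.one_le.1 le_rfl

theorem ι_pow_mem_stdFilt (x : L) (n : ℕ) : (ι x : U k L) ^ n ∈ stdFilt k L n := by
  induction n with
  | zero => rw [pow_zero]; exact one_mem_stdFilt 0
  | succ n ih => rw [pow_succ]; exact mul_mem_stdFilt rfl ih (ι_mem_stdFilt x)

theorem exists_mem_stdFilt (u : U k L) : ∃ n, u ∈ stdFilt k L n := by
  let S : Subalgebra k (U k L) :=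
    { carrier := {u | ∃ n, u ∈ stdFilt k L n}
      mul_mem' := fun {a b} ⟨m, hm⟩ ⟨n, hn⟩ => ⟨m + n, mul_mem_stdFilt rfl hm hn⟩
      add_mem' := fun {a b} ⟨m, hm⟩ ⟨n, hn⟩ => ⟨max m n, add_mem
        (stdFilt_mono (le_max_left _ _) hm) (stdFilt_mono (le_max_right _ _) hn)⟩
      algebraMap_mem' := fun r => ⟨0, by
        rw [stdFilt_zero, Algebra.algebraMap_eq_smul_one]
        exact Submodule.smul_mem _ _ (Submodule.one_le.1 le_rfl)⟩ }
  exact U_subalgebra_eq_top S (fun x => ⟨1, ι_mem_stdFilt x⟩) u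

theorem stdFilt_succ_induction {n : ℕ} {S : Submodule k (U k L)} (h₁ : stdFilt k L n ≤ S)
    (h₂ : ∀ x : L, ∀ u ∈ stdFilt k L n, ι x * u ∈ S) : stdFilt k L (n + 1) ≤ S := by
  rw [stdFilt, pow_succ', Submodule.mul_le]
  intro a ha u hu
  obtain ⟨b, hb, _, ⟨x, rfl⟩, rfl⟩ := Submodule.mem_sup.1 ha
  rw [add_mul]
  refine S.add_mem ?_ (h₂ x u hu)
  obtain ⟨r, rfl⟩ := Submodule.mem_one.1 hb
  rw [← Algebra.smul_def]
  exact S.smul_mem r (h₁ hu)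

theorem ι_mul_sub_mul_ι (x y : L) :
    ι x * ι y - ι y * ι x = (ι ⁅x, y⁆ : U k L) := by
  rw [LieHom.map_lie, LieRing.of_associative_ring_bracket]

/-- The commutator with `x` is a derivation that maps generators to generators, so it does not raise
the degree. -/
theorem commutator_mem_stdFilt (x : L) (n : ℕ) :
    ∀ u ∈ stdFilt k L n, ι x * u - u * ι x ∈ stdFilt k L n := by
  induction n with
  | zero =>
    intro u hu
    rw [stdFilt_zero] at hu
    obtain ⟨r, rfl⟩ := Submodule.mem_one.1 hu
    rw [Algebra.commutes, sub_self]
    exact zero_mem _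
  | succ n ih =>
    let S : Submodule k (U k L) := (stdFilt k L (n + 1)).comap
      (LinearMap.mulLeft k (ι x) - LinearMap.mulRight k (ι x))
    have : stdFilt k L (n + 1) ≤ S := by
      refine stdFilt_succ_induction (fun u hu => stdFilt_mono (Nat.le_succ n) (ih u hu))
        fun y u hu => ?_
      change ι x * (ι y * u) - ι y * u * ι x ∈ stdFilt k L (n + 1)
      have h1 : ι x * (ι y * u) - ι y * u * ι x = ι ⁅x, y⁆ * u + ι y * (ι x * u - u * ι x) := by
        rw [← ι_mul_sub_mul_ι]
        noncomm_ring
      rw [h1]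
      exact add_mem (mul_mem_stdFilt (add_comm 1 n) (ι_mem_stdFilt _) hu)
        (mul_mem_stdFilt (add_comm 1 n) (ι_mem_stdFilt _) (ih u hu))
    exact fun u hu => this hu

variable (k L) in
/-- The span of the powers of elements of `L` with exponents `≤ n` -/
noncomputable def powSpan (n : ℕ) : Submodule k (U k L) :=
  Submodule.span k {u | ∃ (x : L) (j : ℕ), j ≤ n ∧ u = (ι x) ^ j}

theorem powSpan_le_stdFilt (n : ℕ) : powSpan k L n ≤ stdFilt k L n := by
  rw [powSpan, Submodule.span_le]
  rintro _ ⟨x, j, hj, rfl⟩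
  exact stdFilt_mono hj (ι_pow_mem_stdFilt x j)

theorem powSpan_mono {a b : ℕ} (h : a ≤ b) : powSpan k L a ≤ powSpan k L b :=
  Submodule.span_mono fun _ ⟨x, j, hj, hu⟩ => ⟨x, j, hj.trans h, hu⟩

/-- Modulo lower degree, (j+1) y x^j is the coefficient of s in (x + s y)^(j+1), and that
coefficient lies in the span of the powers. -/
theorem stdFilt_le_powSpan [CharZero k] (n : ℕ) : stdFilt k L n ≤ powSpan k L n := by
  induction n with
  | zero =>
    rw [stdFilt_zero, Submodule.one_le]
    exact Submodule.subset_span ⟨0, 0, le_rfl, by simp⟩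
  | succ n ih =>
    refine stdFilt_succ_induction (ih.trans (powSpan_mono (Nat.le_succ n))) fun y u hu => ?_
    have hu' := ih hu
    let S : Submodule k (U k L) := (powSpan k L (n + 1)).comap (LinearMap.mulLeft k (ι y))
    have : powSpan k L n ≤ S := by
      rw [powSpan, Submodule.span_le]
      rintro _ ⟨x, j, hj, rfl⟩
      change ι y * ι x ^ j ∈ powSpan k L (n + 1)
      have h1 : ∑ i ∈ Finset.range (j + 1), ι x ^ i * ι y * ι x ^ (j + 1 - 1 - i) ∈
          powSpan k L (n + 1) := by
        refine ((HasExpansion.add_smul (k := k) (ι x : U k L) (ι y)).pow (j + 1)).mem fun s => ?_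
        rw [← map_smul, ← map_add]
        exact Submodule.subset_span ⟨_, j + 1, by omega, rfl⟩
      -- Moving `y` to the front of a word costs a commutator of degree at most `j`, to which the
      -- induction hypothesis applies.
      have h2 : ∑ i ∈ Finset.range (j + 1), (ι y * ι x ^ j - ι x ^ i * ι y * ι x ^ (j + 1 - 1 - i))
          ∈ powSpan k L (n + 1) := by
        refine Submodule.sum_mem _ fun i hi => ?_
        rw [Finset.mem_range] at hi
        refine powSpan_mono (Nat.le_succ n) (ih (stdFilt_mono hj ?_))
        have h3 : ι y * ι x ^ j - ι x ^ i * ι y * ι x ^ (j + 1 - 1 - i) =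
            (ι y * ι x ^ i - ι x ^ i * ι y) * ι x ^ (j - i) := by
          rw [sub_mul, mul_assoc (ι y), ← pow_add]
          congr 3
          omega
        rw [h3]
        exact mul_mem_stdFilt (by omega)
          (commutator_mem_stdFilt y i _ (ι_pow_mem_stdFilt x i)) (ι_pow_mem_stdFilt x _)
      have h4 := add_mem h1 h2
      rw [← Finset.sum_add_distrib] at h4
      simp only [add_sub_cancel, Finset.sum_const, Finset.card_range] at h4
      rw [← Nat.cast_smul_eq_nsmul k] at h4
      exact (Submodule.smul_mem_iff _ (Nat.cast_ne_zero.2 (Nat.succ_ne_zero j))).1 h4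
    exact this hu'

theorem span_powers [CharZero k] :
    Submodule.span k {u : U k L | ∃ (x : L) (j : ℕ), u = (ι x) ^ j} = ⊤ := by
  rw [eq_top_iff]
  rintro u -
  obtain ⟨n, hn⟩ := exists_mem_stdFilt u
  refine Submodule.span_mono ?_ (stdFilt_le_powSpan n hn)
  rintro _ ⟨x, j, _, rfl⟩
  exact ⟨x, j, rfl⟩

theorem U_linearMap_ext [CharZero k] {V : Type*} [AddCommGroup V] [Module k V]
    {φ ψ : U k L →ₗ[k] V} (h : ∀ (x : L) (j : ℕ), φ ((ι x) ^ j) = ψ ((ι x) ^ j)) : φ = ψ := by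
  refine LinearMap.ext_on span_powers ?_
  rintro _ ⟨x, j, rfl⟩
  exact h x j

variable (k L) in
/-- The coproduct of the enveloping algebra -/
noncomputable def comul : U k L →ₐ[k] U k L ⊗[k] U k L :=
  UniversalEnvelopingAlgebra.lift k
    { ((Algebra.TensorProduct.includeLeft : U k L →ₐ[k] U k L ⊗[k] U k L).toLinearMap +
        (Algebra.TensorProduct.includeRight : U k L →ₐ[k] U k L ⊗[k] U k L).toLinearMap) ∘ₗ
          (ι : L →ₗ⁅k⁆ U k L).toLinearMap with
      map_lie' := by
        intro x y
        simp [LieRing.of_associative_ring_bracket, mul_add, add_mul, TensorProduct.sub_tmul,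
          TensorProduct.tmul_sub]
        abel }

theorem comul_ι (x : L) : comul k L (ι x) = ι x ⊗ₜ 1 + 1 ⊗ₜ ι x := by
  rw [comul, UniversalEnvelopingAlgebra.lift_ι_apply]
  rfl

theorem comul_ι_pow (x : L) (n : ℕ) : comul k L (ι x ^ n) =
    ∑ i ∈ Finset.range (n + 1), (n.choose i : k) • (((ι x : U k L) ^ i) ⊗ₜ[k] ((ι x : U k L) ^ (n - i))) := by
  rw [map_pow, comul_ι, Commute.add_pow]
  · refine Finset.sum_congr rfl fun i _ => ?_
    rw [Algebra.TensorProduct.tmul_pow, Algebra.TensorProduct.tmul_pow, one_pow, one_pow,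
      Algebra.TensorProduct.tmul_mul_tmul, mul_one, one_mul, Algebra.smul_def, map_natCast,
      (Nat.cast_commute _ _).eq]
  · rw [commute_iff_eq]
    simp [Algebra.TensorProduct.tmul_mul_tmul]

/-- The convolution product of linear maps from the enveloping algebra to an algebra -/
noncomputable def conv {B : Type*} [Ring B] [Algebra k B] (F G : U k L →ₗ[k] B) : U k L →ₗ[k] B :=
  LinearMap.mul' k B ∘ₗ TensorProduct.map F G ∘ₗ (comul k L).toLinearMap

theorem conv_ι_pow {B : Type*} [Ring B] [Algebra k B] (F G : U k L →ₗ[k] B) (x : L) (n : ℕ) :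
    conv F G (ι x ^ n) = ∑ i ∈ Finset.range (n + 1),
      (n.choose i : k) • (F (ι x ^ i) * G (ι x ^ (n - i))) := by
  rw [conv, LinearMap.comp_apply, LinearMap.comp_apply, AlgHom.toLinearMap_apply, comul_ι_pow,
    map_sum, map_sum]
  refine Finset.sum_congr rfl fun i _ => ?_
  rw [map_smul, map_smul, TensorProduct.map_tmul, LinearMap.mul'_apply]

variable (k L) in
/-- The Adams operation `x ^ n ↦ 2 ^ n x ^ n` -/
noncomputable def adams : Module.End k (U k L) := conv LinearMap.id LinearMap.id

theorem adams_ι_pow (x : L) (n : ℕ) : adams k L (ι x ^ n) = (2 : k) ^ n • ι x ^ n := by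
  rw [adams, conv_ι_pow]
  simp only [LinearMap.id_apply]
  rw [show (2 : k) ^ n = ∑ i ∈ Finset.range (n + 1), (n.choose i : k) by
    rw [← Nat.cast_sum, Nat.sum_range_choose]; simp, Finset.sum_smul]
  refine Finset.sum_congr rfl fun i hi => ?_
  rw [Finset.mem_range] at hi
  rw [← pow_add, Nat.add_sub_cancel' (by omega)]

/-- The exponent of a power is detected by the Adams operation, whose eigenvalues 2^n are distinct
in characteristic zero. So one linear map can be prescribed for each exponent, before any basis of
`U k L` is known. -/
theorem exists_linearMap_of_powers [CharZero k] {V : Type*} [AddCommGroup V] [Module k V]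
    (F : ℕ → U k L →ₗ[k] V) :
    ∃ Φ : U k L →ₗ[k] V, ∀ (x : L) (n : ℕ), Φ (ι x ^ n) = F n (ι x ^ n) := by
  have hinj : Function.Injective fun n : ℕ => (2 : k) ^ n := by
    intro a b hab
    have : ((2 ^ a : ℕ) : k) = ((2 ^ b : ℕ) : k) := by simpa using hab
    exact Nat.pow_right_injective le_rfl (Nat.cast_injective this)
  obtain ⟨Φ, hΦ⟩ := exists_linearMap_of_eigenspaces (adams k L) hinj
    (iSup_eigenspace_eq_top span_powers (by
      rintro _ ⟨x, j, rfl⟩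
      exact ⟨j, adams_ι_pow x j⟩)) F
  exact ⟨Φ, fun x n => hΦ n _ (adams_ι_pow x n)⟩

variable (k L) in
theorem exists_linearPart [CharZero k] : ∃ e : U k L →ₗ[k] U k L,
    ∀ (x : L) (n : ℕ), e (ι x ^ n) = if n = 1 then ι x else 0 := by
  obtain ⟨e, he⟩ := exists_linearMap_of_powers (k := k) (L := L)
    fun n => if n = 1 then LinearMap.id else 0
  refine ⟨e, fun x n => ?_⟩
  rw [he]
  split_ifs with hn
  · rw [hn, pow_one]; rfl
  · rfl

variable (k L) in
/-- The projection of the enveloping algebra to its linear part, `x ^ n ↦ δ_{n,1} x` -/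
noncomputable def linearPart [CharZero k] : U k L →ₗ[k] U k L := (exists_linearPart k L).choose

theorem linearPart_ι_pow [CharZero k] (x : L) (n : ℕ) :
    linearPart k L (ι x ^ n) = if n = 1 then ι x else 0 :=
  (exists_linearPart k L).choose_spec x n

theorem linearPart_mem_range [CharZero k] (u : U k L) : ∃ x, linearPart k L u = ι x := by
  have h : Submodule.span k {u : U k L | ∃ (x : L) (j : ℕ), u = (ι x) ^ j} ≤
      (LinearMap.range (ι : L →ₗ⁅k⁆ U k L).toLinearMap).comap (linearPart k L) := by
    rw [Submodule.span_le]
    rintro _ ⟨x, j, rfl⟩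
    change linearPart k L _ ∈ LinearMap.range _
    rw [linearPart_ι_pow]
    split_ifs
    · exact ⟨x, rfl⟩
    · exact zero_mem _
  rw [span_powers] at h
  obtain ⟨x, hx⟩ := h (Submodule.mem_top (x := u))
  exact ⟨x, hx.symm⟩

/-- The functoriality of the enveloping algebra -/
noncomputable def mapU {L' : Type*} [LieRing L'] [LieAlgebra k L'] (f : L →ₗ⁅k⁆ L') :
    U k L →ₐ[k] U k L' :=
  UniversalEnvelopingAlgebra.lift k ((UniversalEnvelopingAlgebra.ι k).comp f)

theorem mapU_ι {L' : Type*} [LieRing L'] [LieAlgebra k L'] (f : L →ₗ⁅k⁆ L') (x : L) :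
    mapU f (ι x) = ι (f x) := by
  rw [mapU, UniversalEnvelopingAlgebra.lift_ι_apply]
  rfl

theorem linearPart_mapU [CharZero k] {L' : Type*} [LieRing L'] [LieAlgebra k L']
    (f : L →ₗ⁅k⁆ L') (u : U k L) :
    linearPart k L' (mapU f u) = mapU f (linearPart k L u) := by
  have : linearPart k L' ∘ₗ (mapU f).toLinearMap = (mapU f).toLinearMap ∘ₗ linearPart k L := by
    refine U_linearMap_ext fun x j => ?_
    simp only [LinearMap.comp_apply, AlgHom.toLinearMap_apply, map_pow, mapU_ι, linearPart_ι_pow]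
    split_ifs
    · rw [mapU_ι]
    · rw [map_zero]
  exact LinearMap.congr_fun this u

end Powers

/-! ### The Euler derivation; a free Lie algebra embeds in its enveloping algebra -/

section FreeLie

attribute [local instance 100] LieRing.ofAssociativeRing

variable {k : Type*} [Field k] {X : Type*}

local notation "ι" => UniversalEnvelopingAlgebra.ι k

theorem freeLie_subalgebra_eq_top (S : LieSubalgebra k (FreeLieAlgebra k X))
    (hS : ∀ x, FreeLieAlgebra.of k x ∈ S) (f : FreeLieAlgebra k X) : f ∈ S := by
  have h : S.incl.comp (FreeLieAlgebra.lift k fun x => (⟨FreeLieAlgebra.of k x, hS x⟩ : S)) =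
      LieHom.id := by
    apply FreeLieAlgebra.hom_ext
    intro x
    rw [LieHom.comp_apply, FreeLieAlgebra.lift_of_apply]
    rfl
  have := DFunLike.congr_fun h f
  rw [LieHom.id_apply] at this
  rw [← this]
  exact Subtype.property _

/-- The representation of the free Lie algebra `F` on `F × k` that is the extension of the adjoint
representation by the Euler derivation -/
noncomputable def eulerRep : FreeLieAlgebra k X →ₗ⁅k⁆ Module.End k (FreeLieAlgebra k X × k) :=
  FreeLieAlgebra.lift k fun x => LinearMap.prod
    ((LieAlgebra.ad k (FreeLieAlgebra k X) (FreeLieAlgebra.of k x)) ∘ₗ LinearMap.fst k _ _ +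
      (LinearMap.snd k _ _).smulRight (FreeLieAlgebra.of k x)) 0

/-- The Euler derivation of the free Lie algebra -/
noncomputable def euler : Module.End k (FreeLieAlgebra k X) where
  toFun f := (eulerRep f (0, 1)).1
  map_add' f f' := by simp
  map_smul' c f := by simp

theorem euler_of (x : X) : euler (FreeLieAlgebra.of k x) = FreeLieAlgebra.of k x := by
  simp [euler, eulerRep]

theorem eulerRep_apply (f z : FreeLieAlgebra k X) (c : k) :
    eulerRep f (z, c) = (⁅f, z⁆ + c • euler f, 0) := by
  let S : LieSubalgebra k (FreeLieAlgebra k X) :=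
    { carrier := {f | ∀ z c, eulerRep f (z, c) = (⁅f, z⁆ + c • euler f, 0)}
      add_mem' := fun {a b} ha hb z c => by
        rw [map_add, LinearMap.add_apply, ha z c, hb z c, map_add, add_lie, smul_add,
          Prod.mk_add_mk, add_zero]
        congr 1
        abel
      zero_mem' := fun z c => by simp [Prod.zero_eq_mk]
      smul_mem' := fun r a ha z c => by
        rw [map_smul, LinearMap.smul_apply, ha z c, map_smul, smul_lie, Prod.smul_mk, smul_zero,
          smul_add, smul_comm r c]
      lie_mem' := fun {a b} ha hb => by
        have h1 : ∀ z c, eulerRep ⁅a, b⁆ (z, c) =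
            (⁅⁅a, b⁆, z⁆ + c • (⁅a, euler b⁆ - ⁅b, euler a⁆), 0) := by
          intro z c
          rw [LieHom.map_lie, LieRing.of_associative_ring_bracket, LinearMap.sub_apply,
            Module.End.mul_apply, Module.End.mul_apply, hb z c, ha z c, ha, hb, Prod.mk_sub_mk]
          congr 1
          · rw [lie_lie]
            simp only [lie_add, lie_smul, zero_smul, add_zero, smul_sub]
            abel
          · simp
        intro z c
        rw [h1]
        congr 3
        change _ = (eulerRep ⁅a, b⁆ (0, 1)).1
        rw [h1]
        simp }
  refine freeLie_subalgebra_eq_top S (fun x z c => ?_) f z c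
  rw [euler_of]
  simp [eulerRep]

theorem euler_lie (f f' : FreeLieAlgebra k X) :
    euler ⁅f, f'⁆ = ⁅euler f, f'⁆ + ⁅f, euler f'⁆ := by
  change (eulerRep ⁅f, f'⁆ (0, 1)).1 = _
  rw [LieHom.map_lie, LieRing.of_associative_ring_bracket, LinearMap.sub_apply,
    Module.End.mul_apply, Module.End.mul_apply, eulerRep_apply, eulerRep_apply, eulerRep_apply,
    eulerRep_apply]
  simp only [lie_zero, zero_add, one_smul, zero_smul, add_zero, Prod.fst_sub]
  rw [← lie_skew (euler f) f']
  abel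

/-- The span of these eigenvectors contains the generators and is closed under the bracket: `euler`
is a derivation, so eigenvalues add under the bracket, and `(a + 1) + (b + 1) = (a + b + 1) + 1`. -/
theorem euler_iSup_eigenspace :
    ⨆ n : ℕ, Module.End.eigenspace (euler : Module.End k (FreeLieAlgebra k X)) ((n + 1 : ℕ) : k) =
      ⊤ := by
  let E : Submodule k (FreeLieAlgebra k X) :=
    ⨆ n : ℕ, Module.End.eigenspace (euler : Module.End k (FreeLieAlgebra k X)) ((n + 1 : ℕ) : k)
  have hE : ∀ n f, euler f = ((n + 1 : ℕ) : k) • f → f ∈ E := fun n f hf =>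
    Submodule.mem_iSup_of_mem n (Module.End.mem_eigenspace_iff.2 hf)
  let S : LieSubalgebra k (FreeLieAlgebra k X) :=
    { E with
      lie_mem' := fun {f f'} hf hf' => by
        change ⁅f, f'⁆ ∈ E
        replace hf : f ∈ E := hf
        replace hf' : f' ∈ E := hf'
        refine Submodule.iSup_induction _ (motive := fun f => ⁅f, f'⁆ ∈ E) hf (fun a f ha => ?_)
          (by simp) fun x y hx hy => by rw [add_lie]; exact add_mem hx hy
        refine Submodule.iSup_induction _ (motive := fun f' => ⁅f, f'⁆ ∈ E) hf' (fun b f' hb => ?_)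
          (by simp) fun x y hx hy => by rw [lie_add]; exact add_mem hx hy
        rw [Module.End.mem_eigenspace_iff] at ha hb
        refine hE (a + b + 1) _ ?_
        rw [euler_lie, ha, hb, smul_lie, lie_smul, ← add_smul]
        congr 1
        push_cast
        ring }
  rw [eq_top_iff]
  rintro f -
  refine freeLie_subalgebra_eq_top S (fun x => ?_) f
  exact hE 0 _ (by rw [euler_of]; simp)

/-- All eigenvalues are positive integers, so division by the eigenvalue is a left inverse. -/
theorem euler_injective [CharZero k] :
    Function.Injective (euler : Module.End k (FreeLieAlgebra k X)) := by
  have hinj : Function.Injective fun n : ℕ => ((n + 1 : ℕ) : k) := fun a b hab => by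
    have := Nat.cast_injective (R := k) hab
    omega
  obtain ⟨Φ, hΦ⟩ := exists_linearMap_of_eigenspaces _ hinj (euler_iSup_eigenspace (k := k) (X := X))
    fun n => ((n + 1 : ℕ) : k)⁻¹ • LinearMap.id
  have h : ∀ f, Φ (euler f) = f := by
    intro f
    have hf : f ∈ ⨆ n : ℕ, Module.End.eigenspace
      (euler : Module.End k (FreeLieAlgebra k X)) ((n + 1 : ℕ) : k) := by
      rw [euler_iSup_eigenspace]; exact Submodule.mem_top
    refine Submodule.iSup_induction _ (motive := fun f => Φ (euler f) = f) hf (fun n f hn => ?_)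
      (by simp) fun x y hx hy => by rw [map_add, map_add, hx, hy]
    rw [Module.End.mem_eigenspace_iff] at hn
    rw [hn, map_smul, hΦ n f hn, LinearMap.smul_apply, smul_smul, mul_inv_cancel₀, one_smul,
      LinearMap.id_apply]
    exact Nat.cast_ne_zero.2 (Nat.succ_ne_zero n)
  exact Function.LeftInverse.injective h

/-- `eulerRep` extends to the enveloping algebra, so `ι f` determines the action of `f` on `(0, 1)`,
which is `euler f`. -/
theorem ι_freeLie_injective [CharZero k] :
    Function.Injective (ι : FreeLieAlgebra k X → U k (FreeLieAlgebra k X)) := by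
  intro f f' h
  apply euler_injective (k := k) (X := X)
  have h1 := congrArg (UniversalEnvelopingAlgebra.lift k eulerRep) h
  rw [UniversalEnvelopingAlgebra.lift_ι_apply, UniversalEnvelopingAlgebra.lift_ι_apply] at h1
  change (eulerRep f (0, 1)).1 = (eulerRep f' (0, 1)).1
  rw [h1]

end FreeLie

/-! ### Every Lie algebra embeds in its enveloping algebra -/

section Injectivity

attribute [local instance 100] LieRing.ofAssociativeRing

variable {k : Type*} [Field k] {L L' : Type*} [LieRing L] [LieAlgebra k L]
  [LieRing L'] [LieAlgebra k L']

local notation "ι" => UniversalEnvelopingAlgebra.ι k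

/-- The fibre product `L ×_{L'} L` -/
def fibreProd (f : L →ₗ⁅k⁆ L') : LieSubalgebra k (L × L) where
  carrier := {p | f p.1 = f p.2}
  add_mem' {a b} ha hb := by
    change f (a.1 + b.1) = f (a.2 + b.2)
    rw [map_add, map_add, show f a.1 = f a.2 from ha, show f b.1 = f b.2 from hb]
  zero_mem' := by simp
  smul_mem' c a ha := by
    change f (c • a.1) = f (c • a.2)
    rw [map_smul, map_smul, show f a.1 = f a.2 from ha]
  lie_mem' {a b} ha hb := by
    change f ⁅a.1, b.1⁆ = f ⁅a.2, b.2⁆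
    rw [LieHom.map_lie, LieHom.map_lie, show f a.1 = f a.2 from ha, show f b.1 = f b.2 from hb]

/-- The first projection of the fibre product -/
def fibreFst (f : L →ₗ⁅k⁆ L') : fibreProd f →ₗ⁅k⁆ L where
  toFun p := p.1.1
  map_add' _ _ := rfl
  map_smul' _ _ := rfl
  map_lie' := rfl

/-- The second projection of the fibre product -/
def fibreSnd (f : L →ₗ⁅k⁆ L') : fibreProd f →ₗ⁅k⁆ L where
  toFun p := p.1.2
  map_add' _ _ := rfl
  map_smul' _ _ := rfl
  map_lie' := rfl

/-- The diagonal of the fibre product -/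
def fibreDiag (f : L →ₗ⁅k⁆ L') : L →ₗ⁅k⁆ fibreProd f where
  toFun x := ⟨(x, x), rfl⟩
  map_add' _ _ := rfl
  map_smul' _ _ := rfl
  map_lie' := rfl

theorem mapU_comp_apply {L'' : Type*} [LieRing L''] [LieAlgebra k L''] (f : L →ₗ⁅k⁆ L')
    (f' : L' →ₗ⁅k⁆ L'') (u : U k L) : mapU f' (mapU f u) = mapU (f'.comp f) u := by
  have : (mapU f').comp (mapU f) = mapU (f'.comp f) := U_algHom_ext fun x => by
    rw [AlgHom.comp_apply, mapU_ι, mapU_ι, mapU_ι]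
    rfl
  exact DFunLike.congr_fun this u

theorem mapU_id_apply (u : U k L) : mapU (LieHom.id : L →ₗ⁅k⁆ L) u = u := by
  have : mapU (LieHom.id : L →ₗ⁅k⁆ L) = AlgHom.id k (U k L) := U_algHom_ext fun x => by
    rw [mapU_ι]
    rfl
  exact DFunLike.congr_fun this u

/-- The congruence on `U L` given by the image of the enveloping algebra of `L ×_{L'} L` -/
def fibreCon (f : L →ₗ⁅k⁆ L') : RingCon (U k L) where
  r u v := ∃ d : U k (fibreProd f), mapU (fibreFst f) d = u ∧ mapU (fibreSnd f) d = v
  iseqv := by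
    have hd : ∀ u, mapU (fibreFst f) (mapU (fibreDiag f) u) = u ∧
        mapU (fibreSnd f) (mapU (fibreDiag f) u) = u := fun u => by
      rw [mapU_comp_apply, mapU_comp_apply]
      exact ⟨mapU_id_apply u, mapU_id_apply u⟩
    refine ⟨fun u => ⟨_, hd u⟩, ?_, ?_⟩
    · rintro _ _ ⟨d, rfl, rfl⟩
      let sw : fibreProd f →ₗ⁅k⁆ fibreProd f :=
        { toFun := fun p => ⟨(p.1.2, p.1.1), p.2.symm⟩
          map_add' := fun _ _ => rfl
          map_smul' := fun _ _ => rfl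
          map_lie' := rfl }
      exact ⟨mapU sw d, by rw [mapU_comp_apply]; rfl, by rw [mapU_comp_apply]; rfl⟩
    · rintro _ v _ ⟨d, rfl, hv⟩ ⟨d', hv', rfl⟩
      -- Both projections of the diagonal of `v` are `v`, so subtracting it removes the middle
      -- element.
      refine ⟨d + d' - mapU (fibreDiag f) v, ?_, ?_⟩
      · rw [map_sub, map_add, (hd v).1, hv', add_sub_cancel_right]
      · rw [map_sub, map_add, (hd v).2, hv, add_sub_cancel_left]
  add' := by
    rintro _ _ _ _ ⟨d, rfl, rfl⟩ ⟨d', rfl, rfl⟩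
    exact ⟨d + d', map_add _ _ _, map_add _ _ _⟩
  mul' := by
    rintro _ _ _ _ ⟨d, rfl, rfl⟩ ⟨d', rfl, rfl⟩
    exact ⟨d * d', map_mul _ _ _, map_mul _ _ _⟩

/-- Choosing preimages defines a Lie morphism from `L'` to the quotient of `U k L` by `fibreCon f`.
The quotient map therefore factors through `U k L'`, and elements with equal image there are
congruent. -/
theorem exists_fibre_of_mapU_eq {f : L →ₗ⁅k⁆ L'} (hf : Function.Surjective f) {u v : U k L}
    (h : mapU f u = mapU f v) :
    ∃ d : U k (fibreProd f), mapU (fibreFst f) d = u ∧ mapU (fibreSnd f) d = v := by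
  let q : U k L →ₐ[k] (fibreCon f).Quotient := RingCon.mkₐ k _
  have hq : ∀ x y : L, f x = f y → q (ι x) = q (ι y) := fun x y hxy =>
    Quotient.sound ⟨ι (⟨(x, y), hxy⟩ : fibreProd f), mapU_ι _ _, mapU_ι _ _⟩
  let s := Function.surjInv hf
  have hs : ∀ x, f (s x) = x := Function.surjInv_eq hf
  let t : L' →ₗ⁅k⁆ (fibreCon f).Quotient :=
    { toFun := fun x => q (ι (s x))
      map_add' := fun x y => by
        rw [← map_add, ← map_add]
        exact hq _ _ (by rw [map_add, hs, hs, hs])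
      map_smul' := fun c x => by
        rw [RingHom.id_apply, ← map_smul, ← map_smul]
        exact hq _ _ (by rw [map_smul, hs, hs])
      map_lie' := fun {x y} => by
        rw [LieRing.of_associative_ring_bracket, ← map_mul q, ← map_mul q, ← map_sub q,
          ι_mul_sub_mul_ι]
        exact hq _ _ (by rw [LieHom.map_lie, hs, hs, hs]) }
  have h1 : (UniversalEnvelopingAlgebra.lift k t).comp (mapU f) = q := U_algHom_ext fun x => by
    rw [AlgHom.comp_apply, mapU_ι, UniversalEnvelopingAlgebra.lift_ι_apply]
    exact hq _ _ (hs _)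
  have h2 : q u = q v := by
    rw [← h1, AlgHom.comp_apply, AlgHom.comp_apply, h]
  exact Quotient.exact h2

/-- If `ι (f x) = 0`, some element over the fibre product projects to `ι x` and to 0. Its linear
part is `ι p`; by naturality and injectivity for `L`, the pair `p` is `(x, 0)`, and membership in
the fibre product says `f x = f 0`. -/
theorem ι_injective_of_surjective [CharZero k] {f : L →ₗ⁅k⁆ L'} (hf : Function.Surjective f)
    (hL : Function.Injective (ι : L → U k L)) : Function.Injective (ι : L' → U k L') := by
  rw [← LieHom.coe_toLinearMap, ← LinearMap.ker_eq_bot, LinearMap.ker_eq_bot']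
  intro x hx
  obtain ⟨x, rfl⟩ := hf x
  rw [LieHom.coe_toLinearMap, ← mapU_ι, ← map_zero (mapU f)] at hx
  obtain ⟨d, hd, hd'⟩ := exists_fibre_of_mapU_eq hf hx
  obtain ⟨p, hp⟩ := linearPart_mem_range d
  have h1 : p.1.1 = x := hL (by
    have := linearPart_mapU (fibreFst f) d
    rw [hd, hp, mapU_ι] at this
    have h2 := linearPart_ι_pow (k := k) x 1
    rw [pow_one, if_pos rfl] at h2
    rw [← h2, this]
    rfl)
  have h2 : p.1.2 = 0 := hL (by
    have := linearPart_mapU (fibreSnd f) d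
    rw [hd', hp, mapU_ι, map_zero] at this
    rw [map_zero, this]
    rfl)
  rw [← h1, p.2, h2, map_zero]

theorem ι_injective [CharZero k] : Function.Injective (ι : L → U k L) := by
  refine ι_injective_of_surjective (f := FreeLieAlgebra.lift k (id : L → L)) (fun x => ?_)
    ι_freeLie_injective
  exact ⟨FreeLieAlgebra.of k x, FreeLieAlgebra.lift_of_apply _ x⟩

end Injectivity

/-! ### Coordinates on the enveloping algebra adapted to 𝔤 = 𝔥 ⊕ 𝔪 -/

section Coordinates

attribute [local instance 100] LieRing.ofAssociativeRing

variable {k : Type*} [Field k] [CharZero k] {L : Type*} [LieRing L] [LieAlgebra k L]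

local notation "ι" => UniversalEnvelopingAlgebra.ι k

variable (k L) in
theorem exists_linearCoord :
    ∃ X : U k L →ₗ[k] L, ∀ (x : L) (n : ℕ), X (ι x ^ n) = if n = 1 then x else 0 := by
  obtain ⟨r, hr⟩ := LinearMap.exists_leftInverse_of_injective
    (ι : L →ₗ⁅k⁆ U k L).toLinearMap (LinearMap.ker_eq_bot.2 ι_injective)
  refine ⟨r ∘ₗ linearPart k L, fun x n => ?_⟩
  rw [LinearMap.comp_apply, linearPart_ι_pow]
  split_ifs
  · exact LinearMap.congr_fun hr x
  · exact map_zero r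

variable (k L) in
/-- The linear coordinate `x ^ n ↦ δ_{n,1} x` on the enveloping algebra -/
noncomputable def linearCoord : U k L →ₗ[k] L := (exists_linearCoord k L).choose

theorem linearCoord_ι_pow (x : L) (n : ℕ) :
    linearCoord k L (ι x ^ n) = if n = 1 then x else 0 :=
  (exists_linearCoord k L).choose_spec x n

/-- The convolution powers of the linear coordinate followed by `f` -/
noncomputable def convPow (f : L →ₗ[k] L) : ℕ → (U k L →ₗ[k] U k L)
  | 0 => Algebra.linearMap k (U k L) ∘ₗ (counit k L).toLinearMap
  | n + 1 => conv ((ι : L →ₗ⁅k⁆ U k L).toLinearMap ∘ₗ f ∘ₗ linearCoord k L) (convPow f n)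

theorem convPow_ι_pow (f : L →ₗ[k] L) (n N : ℕ) (x : L) :
    convPow f n (ι x ^ N) = if N = n then (n.factorial : k) • ι (f x) ^ n else 0 := by
  induction n generalizing N with
  | zero =>
    rw [convPow, LinearMap.comp_apply, AlgHom.toLinearMap_apply, map_pow, counit_ι]
    rcases Nat.eq_zero_or_pos N with rfl | hN
    · simp
    · rw [zero_pow hN.ne', map_zero, if_neg hN.ne']
  | succ n ih =>
    rw [convPow, conv_ι_pow]
    rcases Nat.eq_zero_or_pos N with rfl | hN
    · have h0 := linearCoord_ι_pow (k := k) x 0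
      simp only [zero_add, Finset.sum_range_one, LinearMap.comp_apply, h0]
      simp
    · rw [Finset.sum_eq_single 1]
      · rw [ih]
        simp only [LinearMap.comp_apply, linearCoord_ι_pow, if_true, Nat.choose_one_right]
        by_cases hn : N = n + 1
        · subst hn
          rw [if_pos (Nat.add_sub_cancel n 1), if_pos rfl, mul_smul_comm, smul_smul, pow_succ',
            Nat.factorial_succ, Nat.cast_mul]
          rfl
        · rw [if_neg hn, if_neg (by omega), mul_zero, smul_zero]
      · intro i _ hi
        simp only [LinearMap.comp_apply, linearCoord_ι_pow, if_neg hi, map_zero, zero_mul,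
          smul_zero]
      · intro hN'
        rw [Finset.mem_range] at hN'
        omega

/-- Here `f` is merely linear: under symmetrization the map is the functor S applied to `f`. On n-th
powers it is the n-th convolution power divided by n!. -/
theorem exists_powMap (f : L →ₗ[k] L) :
    ∃ P : U k L →ₗ[k] U k L, ∀ (x : L) (n : ℕ), P (ι x ^ n) = ι (f x) ^ n := by
  obtain ⟨P, hP⟩ := exists_linearMap_of_powers fun n => ((n.factorial : k)⁻¹) • convPow f n
  refine ⟨P, fun x n => ?_⟩
  rw [hP, LinearMap.smul_apply, convPow_ι_pow, if_pos rfl, smul_smul, inv_mul_cancel₀, one_smul]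
  exact Nat.cast_ne_zero.2 n.factorial_ne_zero

omit [CharZero k] in
theorem tmul_add_tmul_pow {B : Type*} [Ring B] [Algebra k B] (a b : B) (n : ℕ) :
    (a ⊗ₜ[k] (1 : B) + (1 : B) ⊗ₜ[k] b) ^ n =
      ∑ i ∈ Finset.range (n + 1), (n.choose i : k) • ((a ^ i) ⊗ₜ[k] (b ^ (n - i))) := by
  rw [Commute.add_pow]
  · refine Finset.sum_congr rfl fun i _ => ?_
    rw [Algebra.TensorProduct.tmul_pow, Algebra.TensorProduct.tmul_pow, one_pow, one_pow,
      Algebra.TensorProduct.tmul_mul_tmul, mul_one, one_mul, Algebra.smul_def, map_natCast,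
      (Nat.cast_commute _ _).eq]
  · rw [commute_iff_eq]
    simp [Algebra.TensorProduct.tmul_mul_tmul]

/-- The ordered binomial expression `∑ C(n,i) a ^ i b ^ (n-i)` -/
noncomputable def ordPow (k : Type*) [Field k] {B : Type*} [Ring B] [Algebra k B] (a b : B)
    (n : ℕ) : B := ∑ i ∈ Finset.range (n + 1), (n.choose i : k) • (a ^ i * b ^ (n - i))

omit [CharZero k] in
-- The ordered expression is the image under multiplication of (a ⊗ 1 + 1 ⊗ b)^n, whose two summands
-- commute.
theorem ordPow_succ {B : Type*} [Ring B] [Algebra k B] (a b : B) (n : ℕ) :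
    ordPow k a b (n + 1) = a * ordPow k a b n + ordPow k a b n * b := by
  have h : ∀ n, ordPow k a b n =
      LinearMap.mul' k B ((a ⊗ₜ[k] (1 : B) + (1 : B) ⊗ₜ[k] b) ^ n) := fun n => by
    rw [tmul_add_tmul_pow, map_sum, ordPow]
    refine Finset.sum_congr rfl fun i _ => ?_
    rw [map_smul, LinearMap.mul'_apply]
  have h1 : ∀ T : B ⊗[k] B, LinearMap.mul' k B ((a ⊗ₜ[k] (1 : B)) * T) =
      a * LinearMap.mul' k B T := fun T => by
    induction T using TensorProduct.induction_on with
    | zero => simp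
    | tmul x y => simp [Algebra.TensorProduct.tmul_mul_tmul, mul_assoc]
    | add x y hx hy => rw [mul_add, map_add, map_add, mul_add, hx, hy]
  have h2 : ∀ T : B ⊗[k] B, LinearMap.mul' k B (T * ((1 : B) ⊗ₜ[k] b)) =
      LinearMap.mul' k B T * b := fun T => by
    induction T using TensorProduct.induction_on with
    | zero => simp
    | tmul x y => simp [Algebra.TensorProduct.tmul_mul_tmul, mul_assoc]
    | add x y hx hy => rw [add_mul, map_add, map_add, add_mul, hx, hy]
  have h3 : Commute ((a ⊗ₜ[k] (1 : B) + (1 : B) ⊗ₜ[k] b) ^ n) ((1 : B) ⊗ₜ[k] b) := by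
    refine Commute.pow_left ?_ n
    refine Commute.add_left ?_ (Commute.refl _)
    rw [commute_iff_eq]
    simp [Algebra.TensorProduct.tmul_mul_tmul]
  rw [h, h, pow_succ', add_mul, map_add, h1, ← h3.eq, h2]

omit [CharZero k] in
-- By the recursion for `ordPow`, the new difference is `y + z` times the old one minus a commutator
-- with `z`, and that commutator does not raise the degree.
theorem ordPow_sub_pow_mem (y z : L) (n : ℕ) :
    ordPow k (ι y) (ι z) (n + 1) - ι (y + z) ^ (n + 1) ∈ stdFilt k L n := by
  have hmem : ∀ n, ordPow k (ι y : U k L) (ι z) n ∈ stdFilt k L n := fun n => by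
    refine Submodule.sum_mem _ fun i hi => Submodule.smul_mem _ _ ?_
    rw [Finset.mem_range] at hi
    exact mul_mem_stdFilt (by omega) (ι_pow_mem_stdFilt y i) (ι_pow_mem_stdFilt z _)
  induction n with
  | zero =>
    rw [ordPow_succ]
    simp [ordPow]
  | succ n ih =>
    have h : ordPow k (ι y : U k L) (ι z) (n + 1 + 1) - ι (y + z) ^ (n + 1 + 1) =
        ι (y + z) * (ordPow k (ι y) (ι z) (n + 1) - ι (y + z) ^ (n + 1)) -
          (ι z * ordPow k (ι y) (ι z) (n + 1) - ordPow k (ι y) (ι z) (n + 1) * ι z) := by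
      rw [ordPow_succ _ _ (n + 1), pow_succ' _ (n + 1), map_add]
      noncomm_ring
    rw [h]
    exact sub_mem (mul_mem_stdFilt (add_comm 1 n) (ι_mem_stdFilt _) ih)
      (commutator_mem_stdFilt z _ _ (hmem _))

/-- `φ - id` lowers the exhaustive standard filtration and vanishes on its bottom term; both halves
go by induction on the degree. -/
theorem bijective_of_unipotent {φ : U k L →ₗ[k] U k L} (h0 : φ 1 = 1)
    (h : ∀ (x : L) (n : ℕ), φ (ι x ^ (n + 1)) - ι x ^ (n + 1) ∈ stdFilt k L n) :
    Function.Bijective φ := by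
  have h1 : ∀ u ∈ stdFilt k L 0, φ u = u := fun u hu => by
    rw [stdFilt_zero] at hu
    obtain ⟨r, rfl⟩ := Submodule.mem_one.1 hu
    rw [Algebra.algebraMap_eq_smul_one, map_smul, h0]
  have h2 : ∀ n, ∀ u ∈ stdFilt k L (n + 1), φ u - u ∈ stdFilt k L n := fun n u hu => by
    have hle : powSpan k L (n + 1) ≤ (stdFilt k L n).comap (φ - LinearMap.id) := by
      rw [powSpan, Submodule.span_le]
      rintro _ ⟨x, j, hj, rfl⟩
      change φ (ι x ^ j) - ι x ^ j ∈ stdFilt k L n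
      rcases j with _ | j
      · rw [pow_zero, h0, sub_self]
        exact zero_mem _
      · exact stdFilt_mono (by omega) (h x j)
    exact hle (stdFilt_le_powSpan _ hu)
  constructor
  · rw [← LinearMap.ker_eq_bot, LinearMap.ker_eq_bot']
    intro u hu
    obtain ⟨n, hn⟩ := exists_mem_stdFilt u
    induction n with
    | zero => rw [← h1 u hn, hu]
    | succ n ih =>
      refine ih ?_
      have := h2 n u hn
      rwa [hu, zero_sub, neg_mem_iff] at this
  · intro u
    obtain ⟨n, hn⟩ := exists_mem_stdFilt u
    change u ∈ LinearMap.range φ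
    induction n generalizing u with
    | zero => exact ⟨u, h1 u hn⟩
    | succ n ih =>
      have h3 := ih _ (h2 n u hn)
      have h4 : u = φ u - (φ u - u) := by abel
      rw [h4]
      exact sub_mem ⟨u, rfl⟩ h3

variable (h : LieSubalgebra k L) (m : Submodule k L)

/-- In terms of generating series, `φ` sends exp(x) to exp(a x) exp(c x): it is the convolution of
the two power maps, and unipotent by `ordPow_sub_pow_mem`. This is the Poincaré–Birkhoff–Witt
isomorphism for the decomposition. -/
theorem exists_factorization (hm : IsCompl h.toSubmodule m) :
    ∃ (φ : U k L →ₗ[k] U k L) (a : L →ₗ[k] m) (c : L →ₗ[k] h), Function.Bijective φ ∧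
      (∀ (y : m) (z : h), a (y + z) = y ∧ c (y + z) = z) ∧
      ∀ x n, φ (ι x ^ n) = ordPow k (ι (a x : L)) (ι (c x : L)) n := by
  let a : L →ₗ[k] m := m.projectionOnto h.toSubmodule hm.symm
  let c : L →ₗ[k] h := h.toSubmodule.projectionOnto m hm
  obtain ⟨P, hP⟩ := exists_powMap (m.subtype ∘ₗ a)
  obtain ⟨Q, hQ⟩ := exists_powMap (h.toSubmodule.subtype ∘ₗ c)
  have h1 : ∀ x n, conv P Q (ι x ^ n) = ordPow k (ι (a x : L)) (ι (c x : L)) n := by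
    intro x n
    rw [conv_ι_pow, ordPow]
    simp only [hP, hQ]
    rfl
  have h2 : ∀ x, (a x : L) + c x = x := fun x => by
    have := Submodule.projection_add_projection_eq_self hm x
    rw [add_comm] at this
    exact this
  refine ⟨conv P Q, a, c, bijective_of_unipotent ?_ ?_, ?_, h1⟩
  · have := h1 0 0
    rw [pow_zero] at this
    rw [this]
    simp [ordPow]
  · intro x n
    rw [h1]
    have := ordPow_sub_pow_mem (k := k) (a x : L) (c x : L) n
    rwa [h2] at this
  · intro y z
    constructor
    · rw [map_add]
      have e1 : a y = y := Submodule.projectionOnto_apply_left hm.symm y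
      have e2 : a z = 0 := Submodule.projectionOnto_apply_right hm.symm z
      rw [e1, e2, add_zero]
    · rw [map_add]
      have e1 : c y = 0 := Submodule.projectionOnto_apply_right hm y
      have e2 : c z = z := Submodule.projectionOnto_apply_left hm z
      rw [e1, e2, zero_add]

theorem span_mul_powers (hm : IsCompl h.toSubmodule m) :
    Submodule.span k {u : U k L | ∃ y ∈ m, ∃ z ∈ h, ∃ n l, u = ι y ^ n * ι z ^ l} = ⊤ := by
  obtain ⟨φ, a, c, hφ, -, hφ'⟩ := exists_factorization h m hm
  have h1 : LinearMap.range φ ≤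
      Submodule.span k {u : U k L | ∃ y ∈ m, ∃ z ∈ h, ∃ n l, u = ι y ^ n * ι z ^ l} := by
    rw [LinearMap.range_eq_map, ← span_powers, Submodule.map_span, Submodule.span_le]
    rintro _ ⟨_, ⟨x, j, rfl⟩, rfl⟩
    rw [hφ']
    refine Submodule.sum_mem _ fun i _ => Submodule.smul_mem _ _ (Submodule.subset_span ?_)
    exact ⟨_, (a x).2, _, (c x).2, _, _, rfl⟩
  rwa [LinearMap.range_eq_top.2 hφ.2, top_le_iff] at h1

theorem exists_coord (hm : IsCompl h.toSubmodule m) :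
    ∃ θ : U k L →ₗ[k] h, ∀ y ∈ m, ∀ (z : h) (n l : ℕ),
      θ (ι y ^ n * ι (z : L) ^ l) = if n = 0 ∧ l = 1 then z else 0 := by
  obtain ⟨φ, a, c, hφ, hac, hφ'⟩ := exists_factorization h m hm
  let e := LinearEquiv.ofBijective φ hφ
  refine ⟨c ∘ₗ linearCoord k L ∘ₗ e.symm.toLinearMap, fun y hy z n l => ?_⟩
  set θ := c ∘ₗ linearCoord k L ∘ₗ e.symm.toLinearMap with hθ
  have h1 : ∀ u, θ (φ u) = c (linearCoord k L u) := fun u => by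
    simp only [hθ, LinearMap.comp_apply, LinearEquiv.coe_coe]
    rw [show φ u = e u from rfl, LinearEquiv.symm_apply_apply]
  -- `θ ∘ φ` is known on the power n + l of y + s z; the coefficient of s^l is a binomial
  -- coefficient, nonzero in `k`, times the value sought.
  have h2 : ∀ s : k, ∑ i ∈ Finset.range (n + l + 1),
      s ^ i • (((n + l).choose (n + l - i) : k) • θ (ι y ^ (n + l - i) * ι (z : L) ^ i) -
        if i = 1 ∧ n + l = 1 then z else 0) = 0 := by
    intro s
    have h3 := h1 (ι (y + s • (z : L)) ^ (n + l))
    have h4 := hac ⟨y, hy⟩ (s • z)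
    rw [hφ', linearCoord_ι_pow, ordPow] at h3
    have hcs : ((s • z : h) : L) = s • (z : L) := rfl
    rw [hcs] at h4
    rw [h4.1, h4.2, ← Finset.sum_range_reflect] at h3
    simp only [smul_sub, Finset.sum_sub_distrib]
    rw [sub_eq_zero]
    refine Eq.trans ?_ (h3.trans ?_)
    · rw [map_sum]
      refine Finset.sum_congr rfl fun i hi => ?_
      rw [Finset.mem_range] at hi
      rw [show n + l + 1 - 1 - i = n + l - i by omega, show n + l - (n + l - i) = i by omega,
        map_smul, smul_comm, hcs, map_smul, smul_pow, mul_smul_comm, map_smul]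
    · by_cases hnl : n + l = 1
      · rw [if_pos hnl, h4.2, hnl]
        simp
      · simp [hnl]
  have h5 := eq_zero_of_sum_pow_smul h2 l (by omega)
  rw [sub_eq_zero, show n + l - l = n by omega] at h5
  by_cases hnl : n = 0 ∧ l = 1
  · obtain ⟨rfl, rfl⟩ := hnl
    simpa using h5
  · rw [if_neg hnl]
    rw [if_neg (by omega)] at h5
    refine (smul_eq_zero.1 h5).resolve_left (Nat.cast_ne_zero.2 ?_)
    exact (Nat.choose_pos (by omega)).ne'

end Coordinates

/-! ### Polarization, the weight operator and U𝔤 = U𝔪 ⊕ U𝔤·𝔥 -/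

section Decomposition

attribute [local instance 100] LieRing.ofAssociativeRing

theorem mkPiAlgebraFin_sum {k B : Type*} [Field k] [Ring B] [Algebra k B] {n : ℕ}
    (y : Fin n → B) (ε : Fin n → k) :
    (∑ i, ε i • y i) ^ n = ∑ f : Fin n → Fin n, (∏ i, ε (f i)) • (List.ofFn fun i => y (f i)).prod := by
  have h := (MultilinearMap.mkPiAlgebraFin k n B).map_sum fun (_ : Fin n) (j : Fin n) => ε j • y j
  rw [MultilinearMap.mkPiAlgebraFin_apply, List.ofFn_const, List.prod_replicate] at h
  rw [h]
  refine Finset.sum_congr rfl fun f _ => ?_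
  rw [MultilinearMap.map_smul_univ, MultilinearMap.mkPiAlgebraFin_apply]

/-- The sum is a product over `j`, whose factor is 1 if `j` is a value of `f` and -1 + 1 = 0
otherwise. -/
theorem sum_zero_one_weight {k : Type*} [Field k] {n : ℕ} (f : Fin n → Fin n) :
    ∑ ε : Fin n → Fin 2, (∏ j, if ε j = 0 then (-1 : k) else 1) *
      ∏ i, (if ε (f i) = 0 then (0 : k) else 1) = if Function.Surjective f then 1 else 0 := by
  classical
  have h1 : ∀ ε : Fin n → Fin 2, (∏ j, if ε j = 0 then (-1 : k) else 1) *
      ∏ i, (if ε (f i) = 0 then (0 : k) else 1) =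
      ∏ j, ((if ε j = 0 then (-1 : k) else 1) *
        (if ε j = 0 then (0 : k) else 1) ^ (Finset.univ.filter fun i => f i = j).card) := by
    intro ε
    rw [Finset.prod_mul_distrib]
    congr 1
    rw [← Finset.prod_fiberwise Finset.univ f]
    refine Finset.prod_congr rfl fun j _ => ?_
    rw [Finset.prod_congr rfl (g := fun _ => if ε j = 0 then (0 : k) else 1), Finset.prod_const]
    intro i hi
    rw [(Finset.mem_filter.1 hi).2]
  rw [Finset.sum_congr rfl fun ε _ => h1 ε]
  have h2 := Finset.prod_univ_sum (fun _ : Fin n => (Finset.univ : Finset (Fin 2)))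
    (fun j e => (if e = 0 then (-1 : k) else 1) *
        (if e = 0 then (0 : k) else 1) ^ (Finset.univ.filter fun i => f i = j).card)
  rw [Fintype.piFinset_univ] at h2
  rw [← h2]
  split_ifs with hf
  · refine Finset.prod_eq_one fun j _ => ?_
    obtain ⟨i, hi⟩ := hf j
    have : (Finset.univ.filter fun i => f i = j).card ≠ 0 :=
      Finset.card_ne_zero_of_mem (Finset.mem_filter.2 ⟨Finset.mem_univ i, hi⟩)
    simp [Fin.sum_univ_two, zero_pow this]
  · simp only [Function.Surjective, not_forall, not_exists] at hf
    obtain ⟨j, hj⟩ := hf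
    refine Finset.prod_eq_zero (Finset.mem_univ j) ?_
    rw [Finset.filter_false_of_mem fun i _ => hj i]
    simp [Fin.sum_univ_two]

/-- Polarization: the symmetrized product is a linear combination of powers. -/
theorem sum_perm_prod_mem {k B : Type*} [Field k] [Ring B] [Algebra k B] {n : ℕ}
    (y : Fin n → B) {S : Submodule k B} (hS : ∀ ε : Fin n → k, (∑ i, ε i • y i) ^ n ∈ S) :
    ∑ σ : Equiv.Perm (Fin n), (List.ofFn fun i => y (σ i)).prod ∈ S := by
  classical
  -- Inclusion–exclusion over partial sums of the `y i`: only words indexed by surjections survive,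
  -- and these are permutations.
  have h1 : ∑ ε : Fin n → Fin 2, (∏ j, if ε j = 0 then (-1 : k) else 1) •
      (∑ i, (if ε i = 0 then (0 : k) else 1) • y i) ^ n ∈ S :=
    Submodule.sum_mem _ fun ε _ => Submodule.smul_mem _ _ (hS _)
  convert h1
  simp only [mkPiAlgebraFin_sum, Finset.smul_sum, smul_smul]
  rw [Finset.sum_comm]
  simp only [← Finset.sum_smul, sum_zero_one_weight, ite_smul, one_smul, zero_smul]
  rw [← Finset.sum_filter]
  refine Finset.sum_bij (fun σ _ => σ) ?_ ?_ ?_ ?_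
  · intro σ _
    simpa using σ.surjective
  · intro σ _ τ _ h
    exact Equiv.ext (congrFun h)
  · intro f hf
    have hb : Function.Bijective f :=
      Finite.injective_iff_bijective.1 (Finite.injective_iff_surjective.2 (Finset.mem_filter.1 hf).2)
    exact ⟨Equiv.ofBijective f hb, Finset.mem_univ _, rfl⟩
  · exact fun _ _ => rfl

variable {k : Type*} [Field k] [CharZero k] {g : Type*} [LieRing g] [LieAlgebra k g]
  {h : LieSubalgebra k g} {m : Submodule k g}

local notation "ι" => UniversalEnvelopingAlgebra.ι k

theorem Um_eq_span : Um m = Submodule.span k {u : U k g | ∃ y ∈ m, ∃ n, u = ι y ^ n} := by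
  apply le_antisymm
  · rw [Um, Submodule.span_le]
    rintro _ ⟨n, y, rfl⟩
    refine Submodule.smul_mem _ _ (sum_perm_prod_mem (fun i => ι (y i : g)) fun ε => ?_)
    refine Submodule.subset_span ⟨∑ i, ε i • (y i : g),
      Submodule.sum_mem _ fun i _ => Submodule.smul_mem _ _ (y i).2, n, ?_⟩
    rw [map_sum]
    simp only [map_smul]
  · rw [Submodule.span_le]
    rintro _ ⟨y, hy, n, rfl⟩
    refine Submodule.subset_span ⟨n, fun _ => ⟨y, hy⟩, ?_⟩
    change _ = (n.factorial : k)⁻¹ • ∑ _σ : Equiv.Perm (Fin n),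
      (List.ofFn fun _ : Fin n => (ι y : U k g)).prod
    rw [List.ofFn_const, List.prod_replicate, Finset.sum_const, Finset.card_univ,
      Fintype.card_perm, Fintype.card_fin, ← Nat.cast_smul_eq_nsmul k, smul_smul,
      inv_mul_cancel₀ (Nat.cast_ne_zero.2 n.factorial_ne_zero), one_smul]

/-- The component in `h` of the linear part with respect to the coordinates `ι y ^ n * ι z ^ l` -/
noncomputable def coord (hm : IsCompl h.toSubmodule m) : U k g →ₗ[k] h :=
  (exists_coord h m hm).choose

variable (hm : IsCompl h.toSubmodule m)

theorem coord_mul_powers {y : g} (hy : y ∈ m) (z : h) (n l : ℕ) :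
    coord hm (ι y ^ n * ι (z : g) ^ l) = if n = 0 ∧ l = 1 then z else 0 :=
  (exists_coord h m hm).choose_spec y hy z n l

theorem coord_one : coord hm 1 = 0 := by
  simpa using coord_mul_powers hm m.zero_mem 0 0 0

omit [CharZero k] in
theorem ι_mul_pow_sub {L : Type*} [LieRing L] [LieAlgebra k L] (x y : L) (n : ℕ) :
    ι x * ι y ^ n - ι y ^ n * ι x =
      ∑ i ∈ Finset.range n, ι y ^ i * (ι ⁅x, y⁆ : U k L) * ι y ^ (n - 1 - i) := by
  induction n with
  | zero => simp
  | succ n ih =>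
    rw [Finset.sum_range_succ, Finset.sum_congr rfl (g := fun i =>
      ι y ^ i * (ι ⁅x, y⁆ : U k L) * ι y ^ (n - 1 - i) * ι y), ← Finset.sum_mul, ← ih,
      ← ι_mul_sub_mul_ι, show n + 1 - 1 - n = 0 by omega, pow_zero, mul_one, pow_succ]
    · noncomm_ring
    · intro i hi
      rw [Finset.mem_range] at hi
      rw [mul_assoc _ _ (ι y), ← pow_succ]
      congr 2
      omega

/-- The commutator of x with y^n z^l is the derivative at s = 0 of (y + s[x,y])^n (z + s[x,z])^l. As
[𝔥,𝔪] ⊆ 𝔪, this product has the same shape for every s, so `coord` is known on it and is affine in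
s. -/
theorem coord_commutator (hmm : ∀ x ∈ h, ∀ y ∈ m, ⁅x, y⁆ ∈ m) (x : h) (u : U k g) :
    coord hm (ι (x : g) * u - u * ι (x : g)) = ⁅x, coord hm u⁆ := by
  have key : coord hm ∘ₗ (LinearMap.mulLeft k (ι (x : g)) - LinearMap.mulRight k (ι (x : g))) =
      (LieModule.toEnd k h h x) ∘ₗ coord hm := by
    refine LinearMap.ext_on (span_mul_powers h m hm) ?_
    rintro _ ⟨y, hy, z, hz, n, l, rfl⟩
    have h1 := (((HasExpansion.add_smul (k := k) (ι y : U k g) (ι ⁅(x : g), y⁆)).pow n).mul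
      ((HasExpansion.add_smul (k := k) (ι z : U k g) (ι ⁅(x : g), z⁆)).pow l)).map_eq (coord hm)
        (w₀ := if n = 0 ∧ l = 1 then ⟨z, hz⟩ else 0)
        (w₁ := if n = 0 ∧ l = 1 then ⁅x, ⟨z, hz⟩⁆ else 0) (by
          intro s
          rw [← map_smul, ← map_add, ← map_smul, ← map_add]
          have h2 := coord_mul_powers hm (m.add_mem hy (m.smul_mem s (hmm x x.2 y hy)))
            (⟨z, hz⟩ + s • ⁅x, ⟨z, hz⟩⁆) n l
          refine h2.trans ?_
          split_ifs <;> simp)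
    rw [← ι_mul_pow_sub, ← ι_mul_pow_sub] at h1
    have h3 := coord_mul_powers hm hy ⟨z, hz⟩ n l
    simp only [LinearMap.comp_apply, LinearMap.sub_apply, LinearMap.mulLeft_apply,
      LinearMap.mulRight_apply, LieModule.toEnd_apply_apply]
    change coord hm (ι y ^ n * ι z ^ l) = _ at h3
    rw [h3]
    rw [show ι (x : g) * ((ι y : U k g) ^ n * ι z ^ l) - ι y ^ n * ι z ^ l * ι (x : g) =
      ι y ^ n * (ι (x : g) * ι z ^ l - ι z ^ l * ι (x : g)) +
        (ι (x : g) * ι y ^ n - ι y ^ n * ι (x : g)) * ι z ^ l by noncomm_ring, h1]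
    split_ifs <;> simp
  exact LinearMap.congr_fun key u

/-- The operator `ι y ^ n * ι z ^ l ↦ l • ι y ^ n * ι z ^ l` -/
noncomputable def weight : U k g →ₗ[k] U k g :=
  conv LinearMap.id ((ι : g →ₗ⁅k⁆ U k g).toLinearMap ∘ₗ h.toSubmodule.subtype ∘ₗ coord hm)

/-- Only the terms of the coproduct with z alone in the second factor survive `coord`; they have
total coefficient l, and multiplication restores the monomial. -/
theorem weight_mul_powers {y : g} (hy : y ∈ m) {z : g} (hz : z ∈ h) (n l : ℕ) :
    weight hm (ι y ^ n * ι z ^ l) = (l : k) • (ι y ^ n * ι z ^ l) := by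
  have hθ : ∀ i j, coord hm (ι y ^ i * ι z ^ j) = if i = 0 ∧ j = 1 then ⟨z, hz⟩ else 0 :=
    fun i j => coord_mul_powers hm hy ⟨z, hz⟩ i j
  rw [weight, conv, LinearMap.comp_apply, LinearMap.comp_apply, AlgHom.toLinearMap_apply, map_mul,
    comul_ι_pow, comul_ι_pow, Finset.sum_mul_sum]
  simp only [smul_mul_smul_comm, Algebra.TensorProduct.tmul_mul_tmul, map_sum, map_smul,
    TensorProduct.map_tmul, LinearMap.mul'_apply, LinearMap.id_apply, LinearMap.comp_apply, hθ]
  rw [Finset.sum_eq_single n, ]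
  · rcases l with _ | l
    · simp
    · rw [Finset.sum_eq_single l]
      · rw [if_pos (by omega)]
        simp only [Nat.choose_self, Nat.cast_one, one_mul, Nat.choose_succ_self_right]
        rw [mul_assoc]
        congr 2
        exact (pow_succ _ _).symm
      · intro i hi hil
        rw [Finset.mem_range] at hi
        rw [if_neg (by omega)]
        simp
      · intro hl
        exact absurd (Finset.mem_range.2 (by omega)) hl
  · intro i hi hin
    rw [Finset.mem_range] at hi
    refine Finset.sum_eq_zero fun j _ => ?_
    rw [if_neg (by omega)]
    simp
  · intro hn
    exact absurd (Finset.mem_range.2 (by omega)) hn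

theorem U_aug_mem {w : U k h} (hw : counit k h w = 0) :
    w ∈ Submodule.span k {u : U k h | ∃ (z : h) (l : ℕ), u = ι z ^ (l + 1)} := by
  set S := Submodule.span k {u : U k h | ∃ (z : h) (l : ℕ), u = ι z ^ (l + 1)} with hS
  have h1 : (⊤ : Submodule k (U k h)) ≤
      S.comap (LinearMap.id - Algebra.linearMap k (U k h) ∘ₗ (counit k h).toLinearMap) := by
    rw [← span_powers, Submodule.span_le]
    rintro _ ⟨z, j, rfl⟩
    rw [SetLike.mem_coe, Submodule.mem_comap, LinearMap.sub_apply, LinearMap.comp_apply,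
      AlgHom.toLinearMap_apply, LinearMap.id_apply, map_pow, counit_ι]
    rcases j with _ | j
    · simp
    · simp only [ne_eq, Nat.succ_ne_zero, not_false_eq_true, zero_pow, map_zero,
        sub_zero]
      exact Submodule.subset_span ⟨z, j, rfl⟩
  have h2 := h1 (Submodule.mem_top (x := w))
  rw [Submodule.mem_comap, LinearMap.sub_apply, LinearMap.comp_apply, AlgHom.toLinearMap_apply,
    hw, map_zero, sub_zero] at h2
  exact h2

include hm in
-- A product y^n z^l x with x ∈ 𝔥 is y^n times an element of the augmentation ideal of U𝔥, which is
-- spanned by positive powers.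
theorem Ugh_eq_span : Ugh h = Submodule.span k
    {u : U k g | ∃ y ∈ m, ∃ z ∈ h, ∃ n l, u = ι y ^ n * ι z ^ (l + 1)} := by
  apply le_antisymm
  · intro u hu
    set S := Submodule.span k {u : U k g | ∃ y ∈ m, ∃ z ∈ h, ∃ n l, u = ι y ^ n * ι z ^ (l + 1)}
    have h1 : ∀ (a : U k g) (x : h), a * ι (x : g) ∈ S := by
      intro a x
      have h2 : (⊤ : Submodule k (U k g)) ≤ S.comap (LinearMap.mulRight k (ι (x : g))) := by
        rw [← span_mul_powers h m hm, Submodule.span_le]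
        rintro _ ⟨y, hy, z, hz, n, l, rfl⟩
        have h3 : Submodule.span k {u : U k h | ∃ (z : h) (l : ℕ), u = ι z ^ (l + 1)} ≤
            S.comap (LinearMap.mulLeft k (ι y ^ n) ∘ₗ (mapU h.incl).toLinearMap) := by
          rw [Submodule.span_le]
          rintro _ ⟨z, l, rfl⟩
          rw [SetLike.mem_coe, Submodule.mem_comap, LinearMap.comp_apply,
            AlgHom.toLinearMap_apply, map_pow, mapU_ι]
          exact Submodule.subset_span ⟨y, hy, z, z.2, n, l, rfl⟩
        have h4 := h3 (U_aug_mem (w := ι (⟨z, hz⟩ : h) ^ l * ι x) (by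
          rw [map_mul, counit_ι, mul_zero]))
        rw [Submodule.mem_comap, LinearMap.comp_apply, AlgHom.toLinearMap_apply, map_mul,
          map_pow, mapU_ι, mapU_ι, LinearMap.mulLeft_apply, ← mul_assoc] at h4
        exact h4
      exact h2 (Submodule.mem_top (x := a))
    have h5 : ∀ v ∈ Ideal.span (Set.range fun x : h => (ι (x : g) : U k g)), ∀ a, a * v ∈ S := by
      intro v hv
      induction hv using Submodule.span_induction with
      | mem v hv =>
        obtain ⟨x, rfl⟩ := hv
        exact fun a => h1 a x
      | zero => exact fun a => by rw [mul_zero]; exact zero_mem _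
      | add v w _ _ hv hw => exact fun a => by rw [mul_add]; exact add_mem (hv a) (hw a)
      | smul c v _ hv => exact fun a => by rw [smul_eq_mul, ← mul_assoc]; exact hv _
    have h6 := h5 u hu 1
    rwa [one_mul] at h6
  · rw [Submodule.span_le]
    rintro _ ⟨y, hy, z, hz, n, l, rfl⟩
    change _ ∈ Ideal.span _
    rw [pow_succ, ← mul_assoc]
    exact Ideal.mul_mem_left _ _ (Ideal.subset_span ⟨⟨z, hz⟩, rfl⟩)

include hm in
-- The monomials of weight 0 span `Um m`, those of positive weight span `Ugh h`; the spectral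
-- projection `Φ` on weight 0 separates the two.
theorem isCompl_Um_Ugh : IsCompl (Um m) (Ugh h) := by
  obtain ⟨Φ, hΦ⟩ := exists_linearMap_of_eigenspaces (weight hm) (c := fun n : ℕ => (n : k))
    Nat.cast_injective (iSup_eigenspace_eq_top (span_mul_powers h m hm) (by
      rintro _ ⟨y, hy, z, hz, n, l, rfl⟩
      exact ⟨l, weight_mul_powers hm hy hz n l⟩))
    (fun l => if l = 0 then LinearMap.id else 0)
  have h0 : ∀ u ∈ Um m, Φ u = u := by
    intro u hu
    rw [Um_eq_span] at hu
    have : Submodule.span k {u : U k g | ∃ y ∈ m, ∃ n, u = ι y ^ n} ≤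
        LinearMap.ker (Φ - LinearMap.id) := by
      rw [Submodule.span_le]
      rintro _ ⟨y, hy, n, rfl⟩
      have h1 := weight_mul_powers hm hy h.zero_mem n 0
      rw [pow_zero, mul_one] at h1
      have h2 := hΦ 0 _ h1
      rw [SetLike.mem_coe, LinearMap.mem_ker, LinearMap.sub_apply, h2]
      simp
    have h3 := this hu
    rwa [LinearMap.mem_ker, LinearMap.sub_apply, sub_eq_zero] at h3
  have h1 : Ugh h ≤ LinearMap.ker Φ := by
    rw [Ugh_eq_span hm, Submodule.span_le]
    rintro _ ⟨y, hy, z, hz, n, l, rfl⟩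
    rw [SetLike.mem_coe, LinearMap.mem_ker, hΦ (l + 1) _ (weight_mul_powers hm hy hz n (l + 1))]
    simp
  constructor
  · rw [Submodule.disjoint_def]
    intro u hu hu'
    rw [← h0 u hu]
    exact h1 hu'
  · rw [codisjoint_iff, eq_top_iff, ← span_mul_powers h m hm, Submodule.span_le]
    rintro _ ⟨y, hy, z, hz, n, l, rfl⟩
    rcases l with _ | l
    · rw [pow_zero, mul_one]
      refine Submodule.mem_sup_left ?_
      rw [Um_eq_span]
      exact Submodule.subset_span ⟨y, hy, n, rfl⟩
    · refine Submodule.mem_sup_right ?_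
      rw [Ugh_eq_span hm]
      exact Submodule.subset_span ⟨y, hy, z, hz, n, l, rfl⟩

end Decomposition

/-! ### The coradical filtration is the filtration by powers -/

section Coradical

attribute [local instance 100] LieRing.ofAssociativeRing

variable {k : Type*} [Field k] {L : Type*} [LieRing L] [LieAlgebra k L]

local notation "ι" => UniversalEnvelopingAlgebra.ι k

theorem tprod_eq_noncommProd {N : ℕ} (u : Fin N → U k L)
    (hc : ((Finset.univ : Finset (Fin N)) : Set (Fin N)).Pairwise
      (Function.onFun Commute fun s => place k L s (u s))) :
    Finset.univ.noncommProd (fun s => place k L s (u s)) hc = PiTensorProduct.tprod k u := by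
  classical
  have h1 := Finset.map_noncommProd Finset.univ (fun s : Fin N => (Pi.mulSingle s (u s) :
    Fin N → U k L)) (fun i _ j _ _ => Pi.mulSingle_apply_commute u i j)
    (PiTensorProduct.tprodMonoidHom k)
  rw [Finset.noncommProd_mulSingle] at h1
  exact h1.symm

theorem cop_univ_ι_pow (N l : ℕ) (x : L) :
    cop (Finset.univ : Finset (Fin N)) (ι x ^ l) =
      ∑ c ∈ Finset.piAntidiag (Finset.univ : Finset (Fin N)) l,
        ((Nat.multinomial Finset.univ c : ℕ) : k) • PiTensorProduct.tprod k fun s => (ι x : U k L) ^ c s := by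
  classical
  rw [map_pow, cop_ι, Finset.sum_pow_eq_sum_piAntidiag_of_commute]
  · refine Finset.sum_congr rfl fun c _ => ?_
    rw [Algebra.smul_def, map_natCast, ← tprod_eq_noncommProd]
    · congr 1
      exact Finset.noncommProd_congr rfl (fun s _ => (map_pow _ _ _).symm) _
  · intro i _ j _ hij
    exact place_commute k L hij _ _

/-- The number of surjections from a set with `l` elements to `Fin N` -/
def surjCount (N l : ℕ) : ℕ :=
  ∑ c ∈ Finset.piAntidiag (Finset.univ : Finset (Fin N)) l,
    if ∀ s, c s ≠ 0 then Nat.multinomial Finset.univ c else 0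

theorem surjCount_pos {N l : ℕ} (hl : N + 1 ≤ l) : surjCount (N + 1) l ≠ 0 := by
  classical
  -- One fibre of size `l - N`, all others of size 1.
  let c : Fin (N + 1) → ℕ := Fin.cons (l - N) fun _ => 1
  have hc : c ∈ Finset.piAntidiag (Finset.univ : Finset (Fin (N + 1))) l := by
    rw [Finset.mem_piAntidiag]
    refine ⟨?_, fun _ _ => Finset.mem_univ _⟩
    rw [Fin.sum_univ_succ]
    simp
    omega
  have h0 : ∀ s, c s ≠ 0 := by
    intro s
    refine Fin.cases ?_ (fun s => ?_) s
    · simp [c]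
      omega
    · simp [c]
  rw [surjCount, ← Nat.pos_iff_ne_zero]
  refine Finset.sum_pos' (fun _ _ => Nat.zero_le _) ⟨c, hc, ?_⟩
  rw [if_pos h0]
  exact Nat.multinomial_pos _ _

theorem reduced_ι_pow (x : L) (n : ℕ) :
    (LinearMap.id - Algebra.linearMap k (U k L) ∘ₗ (counit k L).toLinearMap :
      U k L →ₗ[k] U k L) (ι x ^ n) = if n ≠ 0 then ι x ^ n else 0 := by
  rw [LinearMap.sub_apply, LinearMap.comp_apply, AlgHom.toLinearMap_apply, LinearMap.id_apply,
    map_pow, counit_ι]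
  rcases n with _ | n <;> simp

/-- Multiplying out the reduced iterated coproduct of x^l gives x^l times the number of surjections
from l to j + 1 elements, which is nonzero exactly for l > j. So the kernel contains nothing beyond
powers with exponent ≤ j. -/
theorem filtU_eq_powSpan [CharZero k] (j : ℕ) : filtU k L j = powSpan k L j := by
  classical
  have h1 : ∀ (x : L) (l : ℕ), (PiTensorProduct.map fun _ : Fin (j + 1) =>
        (LinearMap.id - Algebra.linearMap k (U k L) ∘ₗ (counit k L).toLinearMap :
          U k L →ₗ[k] U k L)) (cop (Finset.univ : Finset (Fin (j + 1))) (ι x ^ l)) =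
      ∑ c ∈ Finset.piAntidiag (Finset.univ : Finset (Fin (j + 1))) l,
        if ∀ s, c s ≠ 0 then ((Nat.multinomial Finset.univ c : ℕ) : k) •
          PiTensorProduct.tprod k fun s => (ι x : U k L) ^ c s else 0 := by
    intro x l
    rw [cop_univ_ι_pow, map_sum]
    refine Finset.sum_congr rfl fun c _ => ?_
    rw [map_smul, PiTensorProduct.map_tprod]
    simp only [reduced_ι_pow]
    split_ifs with hc
    · simp only [hc, ne_eq, not_false_eq_true, if_true]
    · push Not at hc
      obtain ⟨s, hs⟩ := hc
      rw [MultilinearMap.map_coord_zero _ s (by simp [hs]), smul_zero]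
  apply le_antisymm
  · intro w hw
    let μ : T k L (j + 1) →ₗ[k] U k L :=
      PiTensorProduct.lift (MultilinearMap.mkPiAlgebraFin k (j + 1) (U k L))
    let O : U k L →ₗ[k] U k L := μ ∘ₗ (PiTensorProduct.map fun _ : Fin (j + 1) =>
        (LinearMap.id - Algebra.linearMap k (U k L) ∘ₗ (counit k L).toLinearMap :
          U k L →ₗ[k] U k L)) ∘ₗ (cop (Finset.univ : Finset (Fin (j + 1)))).toLinearMap
    have hO : ∀ (x : L) (l : ℕ), O (ι x ^ l) = (surjCount (j + 1) l : k) • ι x ^ l := by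
      intro x l
      simp only [O, LinearMap.comp_apply, AlgHom.toLinearMap_apply]
      rw [h1, map_sum, surjCount, Nat.cast_sum, Finset.sum_smul]
      refine Finset.sum_congr rfl fun c hc => ?_
      split_ifs
      · rw [map_smul]
        congr 1
        simp only [μ, PiTensorProduct.lift.tprod, MultilinearMap.mkPiAlgebraFin_apply]
        rw [Finset.mem_piAntidiag] at hc
        rw [← hc.1]
        clear hc
        have : ∀ (N : ℕ) (c : Fin N → ℕ), (List.ofFn fun s => (ι x : U k L) ^ c s).prod =
            ι x ^ ∑ s, c s := by
          intro N c
          induction N with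
          | zero => simp
          | succ N ih => rw [List.ofFn_succ, List.prod_cons, ih, Fin.sum_univ_succ, pow_add]
        exact this _ c
      · simp
    obtain ⟨Ψ, hΨ⟩ := exists_linearMap_of_powers (k := k) (L := L) fun l =>
      if l ≤ j then 0 else (surjCount (j + 1) l : k)⁻¹ • LinearMap.id
    obtain ⟨Q, hQ⟩ := exists_linearMap_of_powers (k := k) (L := L) fun l =>
      if l ≤ j then LinearMap.id else 0
    -- `Ψ` inverts `O` on exponents above `j` and `Q` keeps the others, so on the kernel of `O` the
    -- truncation `Q` is the identity.
    have h2 : Ψ ∘ₗ O + Q = LinearMap.id := by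
      refine U_linearMap_ext fun x l => ?_
      rw [LinearMap.add_apply, LinearMap.comp_apply, hO, map_smul, hΨ, hQ]
      split_ifs with hl
      · simp
      · rw [LinearMap.smul_apply, smul_smul, mul_inv_cancel₀, one_smul]
        · simp
        · exact Nat.cast_ne_zero.2 (surjCount_pos (by omega))
    have h3 : LinearMap.range Q ≤ powSpan k L j := by
      rw [LinearMap.range_eq_map, ← span_powers, Submodule.map_span, Submodule.span_le]
      rintro _ ⟨_, ⟨x, l, rfl⟩, rfl⟩
      rw [hQ]
      split_ifs with hl
      · exact Submodule.subset_span ⟨x, l, hl, rfl⟩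
      · exact zero_mem _
    have h4 : O w = 0 := by
      have : (PiTensorProduct.map fun _ : Fin (j + 1) =>
        (LinearMap.id - Algebra.linearMap k (U k L) ∘ₗ (counit k L).toLinearMap :
          U k L →ₗ[k] U k L)) (cop (Finset.univ : Finset (Fin (j + 1))) w) = 0 := hw
      simp only [O, LinearMap.comp_apply, AlgHom.toLinearMap_apply]
      rw [this, map_zero]
    have h5 := LinearMap.congr_fun h2 w
    rw [LinearMap.add_apply, LinearMap.comp_apply, h4, map_zero, zero_add, LinearMap.id_apply] at h5
    rw [← h5]
    exact h3 ⟨w, rfl⟩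
  · rw [powSpan, Submodule.span_le]
    rintro _ ⟨x, l, hl, rfl⟩
    change (PiTensorProduct.map fun _ : Fin (j + 1) =>
        (LinearMap.id - Algebra.linearMap k (U k L) ∘ₗ (counit k L).toLinearMap :
          U k L →ₗ[k] U k L)) (cop (Finset.univ : Finset (Fin (j + 1))) (ι x ^ l)) = 0
    rw [h1]
    refine Finset.sum_eq_zero fun c hc => if_neg fun hc' => ?_
    rw [Finset.mem_piAntidiag] at hc
    have h6 : ∑ s : Fin (j + 1), 1 ≤ ∑ s, c s :=
      Finset.sum_le_sum fun s _ => Nat.one_le_iff_ne_zero.2 (hc' s)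
    rw [hc.1] at h6
    simp at h6
    omega

end Coradical

/-! ### Adjoining one more algebra factor -/

section TensorAlg

/-- The tensor product of two algebras, with its structure of an algebra -/
def TensorAlg (k B C : Type*) [Field k] [Ring B] [Algebra k B] [Ring C] [Algebra k C] :=
  B ⊗[k] C

variable {k B C : Type*} [Field k] [Ring B] [Algebra k B] [Ring C] [Algebra k C]

noncomputable instance : Ring (TensorAlg k B C) := inferInstanceAs (Ring (B ⊗[k] C))

noncomputable instance : Algebra k (TensorAlg k B C) := inferInstanceAs (Algebra k (B ⊗[k] C))

namespace TensorAlg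

variable (k B C) in
/-- `b ↦ b ⊗ 1` -/
noncomputable def inl : B →ₐ[k] TensorAlg k B C :=
  (Algebra.TensorProduct.includeLeft : B →ₐ[k] B ⊗[k] C)

variable (k B C) in
/-- `c ↦ 1 ⊗ c` -/
noncomputable def inr : C →ₐ[k] TensorAlg k B C :=
  (Algebra.TensorProduct.includeRight : C →ₐ[k] B ⊗[k] C)

theorem commute (b : B) (c : C) : Commute (inl k B C b) (inr k B C c) := by
  change (b ⊗ₜ[k] (1 : C)) * ((1 : B) ⊗ₜ[k] c) = ((1 : B) ⊗ₜ[k] c) * (b ⊗ₜ[k] (1 : C))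
  simp [Algebra.TensorProduct.tmul_mul_tmul]

theorem induction {p : TensorAlg k B C → Prop} (h : ∀ b c, p (inl k B C b * inr k B C c))
    (h_add : ∀ x y, p x → p y → p (x + y)) (x : TensorAlg k B C) : p x := by
  have h' : ∀ b c, p (b ⊗ₜ[k] c : B ⊗[k] C) := fun b c => by
    have := h b c
    change p ((b ⊗ₜ[k] (1 : C)) * ((1 : B) ⊗ₜ[k] c) : B ⊗[k] C) at this
    rwa [Algebra.TensorProduct.tmul_mul_tmul, one_mul, mul_one] at this
  refine TensorProduct.induction_on (motive := p) x ?_ h' h_add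
  rw [← TensorProduct.zero_tmul B (0 : C)]
  exact h' 0 0

/-- The linear map `b ⊗ c ↦ b * φ c` -/
noncomputable def mulMap (φ : C →ₗ[k] B) : TensorAlg k B C →ₗ[k] B :=
  (LinearMap.mul' k B ∘ₗ TensorProduct.map LinearMap.id φ : B ⊗[k] C →ₗ[k] B)

theorem mulMap_apply (φ : C →ₗ[k] B) (b : B) (c : C) :
    mulMap φ (inl k B C b * inr k B C c) = b * φ c := by
  change (LinearMap.mul' k B ∘ₗ TensorProduct.map LinearMap.id φ)
    ((b ⊗ₜ[k] (1 : C)) * ((1 : B) ⊗ₜ[k] c)) = _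
  rw [Algebra.TensorProduct.tmul_mul_tmul, one_mul, mul_one]
  rfl

theorem mulMap_inl_mul (φ : C →ₗ[k] B) (b : B) (x : TensorAlg k B C) :
    mulMap φ (inl k B C b * x) = b * mulMap φ x := by
  induction x using TensorAlg.induction with
  | h b' c => rw [← mul_assoc, ← map_mul, mulMap_apply, mulMap_apply, mul_assoc]
  | h_add x y hx hy => rw [mul_add, map_add, map_add, mul_add, hx, hy]

/-- The morphism `φ ⊗ ψ` -/
noncomputable def mapPair {D D' : Type*} [Ring D] [Algebra k D] [Ring D'] [Algebra k D']
    (φ : D →ₐ[k] B) (ψ : D' →ₐ[k] C) : D ⊗[k] D' →ₐ[k] TensorAlg k B C :=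
  (Algebra.TensorProduct.map φ ψ : D ⊗[k] D' →ₐ[k] B ⊗[k] C)

theorem mapPair_tmul {D D' : Type*} [Ring D] [Algebra k D] [Ring D'] [Algebra k D']
    (φ : D →ₐ[k] B) (ψ : D' →ₐ[k] C) (a : D) (b : D') :
    mapPair φ ψ (a ⊗ₜ b) = inl k B C (φ a) * inr k B C (ψ b) := by
  change Algebra.TensorProduct.map φ ψ (a ⊗ₜ b) = ((φ a) ⊗ₜ[k] (1 : C)) * ((1 : B) ⊗ₜ[k] (ψ b))
  rw [Algebra.TensorProduct.map_tmul, Algebra.TensorProduct.tmul_mul_tmul, one_mul, mul_one]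

variable {B' : Type*} [Ring B'] [Algebra k B']

variable (C) in
/-- The morphism `f ⊗ id` -/
noncomputable def mapLeft (f : B →ₐ[k] B') : TensorAlg k B C →ₐ[k] TensorAlg k B' C :=
  (Algebra.TensorProduct.map f (AlgHom.id k C) : B ⊗[k] C →ₐ[k] B' ⊗[k] C)

theorem mapLeft_inl (f : B →ₐ[k] B') (b : B) :
    mapLeft C f (inl k B C b) = inl k B' C (f b) := by
  change Algebra.TensorProduct.map f (AlgHom.id k C) (b ⊗ₜ[k] (1 : C)) = _
  rw [Algebra.TensorProduct.map_tmul, map_one]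
  rfl

theorem mapLeft_inr (f : B →ₐ[k] B') (c : C) :
    mapLeft C f (inr k B C c) = inr k B' C c := by
  change Algebra.TensorProduct.map f (AlgHom.id k C) ((1 : B) ⊗ₜ[k] c) = _
  rw [Algebra.TensorProduct.map_tmul, map_one]
  rfl

theorem map_mulMap (f : B →ₐ[k] B') {φ : C →ₗ[k] B} {φ' : C →ₗ[k] B'}
    (hφ : ∀ c, f (φ c) = φ' c) (x : TensorAlg k B C) :
    f (mulMap φ x) = mulMap φ' (mapLeft C f x) := by
  induction x using TensorAlg.induction with
  | h b c => rw [mulMap_apply, map_mul, hφ, map_mul, mapLeft_inl, mapLeft_inr, mulMap_apply]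
  | h_add x y hx hy => rw [map_add, map_add, map_add, map_add, hx, hy]

end TensorAlg

end TensorAlg

/-! ### The contraction C and the identity for bC + Cb -/

section Contraction

attribute [local instance 100] LieRing.ofAssociativeRing

variable {k : Type*} [Field k] {g : Type*} [LieRing g] [LieAlgebra k g] {h : LieSubalgebra k g}

local notation "ι" => UniversalEnvelopingAlgebra.ι k

variable (h) in
/-- The algebra `(U𝔤)^{⊗ n} ⊗ U𝔥 ⊗ U𝔤` -/
abbrev AU (n : ℕ) := TensorAlg k (A h n) (U k g)

variable (h) in
/-- The elements of `(U𝔤)^{⊗ n} ⊗ U𝔥` in `(U𝔤)^{⊗ n} ⊗ U𝔥 ⊗ U𝔤` -/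
noncomputable abbrev inA (n : ℕ) : A h n →ₐ[k] AU h n := TensorAlg.inl k (A h n) (U k g)

variable (h) in
/-- The elements of the additional factor `U𝔤` of `(U𝔤)^{⊗ n} ⊗ U𝔥 ⊗ U𝔤` -/
noncomputable abbrev inU (n : ℕ) : U k g →ₐ[k] AU h n := TensorAlg.inr k (A h n) (U k g)

variable (h) in
/-- The factor `0` is split off. -/
noncomputable def splitHead (n : ℕ) : A h (n + 1) →ₐ[k] AU h n :=
  Algebra.TensorProduct.lift
    (liftT (fun s => (Fin.cons (inU h n) fun s => (inA h n).comp (slotU h s) :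
        Fin (n + 1) → U k g →ₐ[k] AU h n) s)
      (by
        intro i j hij a b
        induction i using Fin.cases with
        | zero =>
          induction j using Fin.cases with
          | zero => exact absurd rfl hij
          | succ j => exact (TensorAlg.commute _ _).symm
        | succ i =>
          induction j using Fin.cases with
          | zero => exact TensorAlg.commute _ _
          | succ j =>
            simp only [Fin.cons_succ, AlgHom.comp_apply]
            exact (slotU_commute (fun e => hij (congrArg Fin.succ e)) a b).map (inA h n)))
    ((inA h n).comp (lastU h n))
    (by
      intro X w
      induction X using PiTensorProduct.induction_on with
      | smul_tprod r u =>
        rw [map_smul, liftT_tprod]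
        refine Commute.smul_left ?_ r
        refine (Commute.list_prod_right _ _ ?_).symm
        intro x hx
        obtain ⟨i, rfl⟩ := (List.mem_ofFn' _ _).1 hx
        induction i using Fin.cases with
        | zero => exact TensorAlg.commute _ _
        | succ i =>
          simp only [Fin.cons_succ, AlgHom.comp_apply]
          exact (slotU_lastU_commute i _ w).symm.map (inA h n)
      | add X Y hX hY =>
        rw [map_add]
        exact hX.add_left hY)

theorem splitHead_slotU {n : ℕ} (s : Fin (n + 1)) (u : U k g) :
    splitHead h n (slotU h s u) = (Fin.cons (inU h n) fun s => (inA h n).comp (slotU h s) :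
        Fin (n + 1) → U k g →ₐ[k] AU h n) s u := by
  change splitHead h n (place k g s u ⊗ₜ[k] 1) = _
  rw [splitHead, Algebra.TensorProduct.lift_tmul, map_one, mul_one, liftT_place]

theorem splitHead_slotU_zero {n : ℕ} (u : U k g) :
    splitHead h n (slotU h 0 u) = inU h n u := by
  rw [splitHead_slotU]
  rfl

theorem splitHead_slotU_succ {n : ℕ} (s : Fin n) (u : U k g) :
    splitHead h n (slotU h s.succ u) = inA h n (slotU h s u) := by
  rw [splitHead_slotU]
  rfl

theorem splitHead_lastU {n : ℕ} (w : U k h) :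
    splitHead h n (lastU h (n + 1) w) = inA h n (lastU h n w) := by
  change splitHead h n (1 ⊗ₜ[k] w) = _
  rw [splitHead, Algebra.TensorProduct.lift_tmul, map_one, one_mul]
  rfl

theorem sum_fib_succ {M : Type*} [AddCommMonoid M] (f : ℕ → ℕ) (n s : ℕ) (F : Fin (n + 1) → M) :
    ∑ t ∈ fib f (n + 1) s, F t =
      (if f 0 = s then F 0 else 0) + ∑ t ∈ fib (fun t => f (t + 1)) n s, F t.succ := by
  rw [fib, Finset.sum_filter, Fin.sum_univ_succ, fib, Finset.sum_filter]
  rfl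

theorem splitHead_ins_slot {n p : ℕ} (f : ℕ → ℕ) (s : Fin p) (x : g) :
    splitHead h n (ins h f p (n + 1) (slot h s x)) =
      (if f 0 = s then inU h n (ι x) else 0) +
        inA h n (∑ t ∈ fib (fun t => f (t + 1)) n s, slot h t x) := by
  rw [ins_slot, sum_fib_succ, map_add, map_sum, map_sum]
  congr 1
  · split_ifs
    · exact splitHead_slotU_zero _
    · exact map_zero _
  · exact Finset.sum_congr rfl fun t _ => splitHead_slotU_succ _ _

theorem splitHead_ins_last {n p : ℕ} (f : ℕ → ℕ) (z : h) :
    splitHead h n (ins h f p (n + 1) (last h p z)) =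
      (if f 0 = p then inU h n (ι (z : g)) else 0) +
        inA h n (∑ t ∈ fib (fun t => f (t + 1)) n p, slot h t (z : g) + last h n z) := by
  rw [ins_last, sum_fib_succ, add_assoc, map_add, map_add, map_add, map_sum, map_sum]
  congr 1
  · split_ifs
    · exact splitHead_slotU_zero _
    · exact map_zero _
  · congr 1
    · exact Finset.sum_congr rfl fun t _ => splitHead_slotU_succ _ _
    · exact splitHead_lastU _

/-- Applies `f` to all factors but the first one. -/
def consF (f : ℕ → ℕ) : ℕ → ℕ
  | 0 => 0
  | s + 1 => f s + 1

theorem map_ins_splitHead {f : ℕ → ℕ} {n N : ℕ} (X : A h (n + 1)) :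
    TensorAlg.mapLeft (U k g) (ins h f n N) (splitHead h n X) =
      splitHead h N (ins h (consF f) (n + 1) (N + 1) X) := by
  have key : (TensorAlg.mapLeft (U k g) (ins h f n N)).comp (splitHead h n) =
      (splitHead h N).comp (ins h (consF f) (n + 1) (N + 1)) := by
    apply A_algHom_ext
    · intro s x
      rw [AlgHom.comp_apply, AlgHom.comp_apply, splitHead_ins_slot]
      induction s using Fin.cases with
      | zero =>
        rw [slot, splitHead_slotU_zero, TensorAlg.mapLeft_inr,
          if_pos (show consF f 0 = ((0 : Fin (n + 1)) : ℕ) from rfl), Finset.sum_eq_zero,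
          map_zero, add_zero]
        intro t ht
        rw [mem_fib] at ht
        exact absurd ht (Nat.succ_ne_zero _)
      | succ s =>
        rw [slot, splitHead_slotU_succ, TensorAlg.mapLeft_inl,
          if_neg (show ¬ consF f 0 = (s.succ : ℕ) from (Nat.succ_ne_zero _).symm), zero_add, ← slot,
          ins_slot]
        congr 1
        refine Finset.sum_congr ?_ fun _ _ => rfl
        ext t
        simp [mem_fib, consF]
    · intro z
      rw [AlgHom.comp_apply, AlgHom.comp_apply, splitHead_ins_last, last, splitHead_lastU,
        TensorAlg.mapLeft_inl, if_neg (show ¬ consF f 0 = n + 1 from (Nat.succ_ne_zero _).symm),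
        zero_add, ← last, ins_last]
      congr 2
      refine Finset.sum_congr ?_ fun _ _ => rfl
      ext t
      simp [mem_fib, consF]
  exact DFunLike.congr_fun key X

theorem mem_fromOn {N i : ℕ} {s : Fin N} : s ∈ fromOn N i ↔ i ≤ (s : ℕ) := by
  simp [fromOn]

theorem ins_copLast {f : ℕ → ℕ} {n N : ℕ} {J : Finset (Fin n)} {J' : Finset (Fin N)}
    (hJ : ∀ t, t ∈ J' ↔ f t = n ∨ ∃ s ∈ J, f t = (s : ℕ)) (w : U k h) :
    ins h f n N (copLast h J w) = copLast h J' w := by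
  have key : (ins h f n N).comp (copLast h J) = copLast h J' := by
    apply U_algHom_ext
    intro z
    rw [AlgHom.comp_apply, copLast_ι, copLast_ι, map_add, map_sum, ins_last, ← add_assoc]
    congr 1
    simp only [ins_slot]
    rw [← Finset.sum_biUnion, ← Finset.sum_union]
    · refine Finset.sum_congr ?_ fun _ _ => rfl
      ext t
      simp only [Finset.mem_union, Finset.mem_biUnion, mem_fib, hJ]
      exact or_comm
    · rw [Finset.disjoint_left]
      intro t ht ht'
      obtain ⟨s, _, hs⟩ := Finset.mem_biUnion.1 ht
      rw [mem_fib] at hs ht'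
      have := s.2
      omega
    · intro s _ s' _ hss
      exact fib_disjoint f N fun e => hss (Fin.ext e)
  exact DFunLike.congr_fun key w

variable (θ : U k g →ₗ[k] h)

/-- The element of `U𝔤` is mapped to `h` by `θ`, and its coproduct with values in the factors
with number in `J` and the last factor is multiplied from the right. -/
noncomputable def absorb {n : ℕ} (J : Finset (Fin n)) : AU h n →ₗ[k] A h n :=
  TensorAlg.mulMap ((copLast h J).toLinearMap ∘ₗ (ι : h →ₗ⁅k⁆ U k h).toLinearMap ∘ₗ θ)

theorem absorb_apply {n : ℕ} (J : Finset (Fin n)) (X : A h n) (u : U k g) :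
    absorb θ J (inA h n X * inU h n u) = X * copLast h J (ι (θ u)) :=
  TensorAlg.mulMap_apply _ _ _

theorem absorb_mul {n : ℕ} (J : Finset (Fin n)) (X : A h n) (Y : AU h n) :
    absorb θ J (inA h n X * Y) = X * absorb θ J Y :=
  TensorAlg.mulMap_inl_mul _ _ _

theorem ins_absorb {f : ℕ → ℕ} {n N : ℕ} {J : Finset (Fin n)} {J' : Finset (Fin N)}
    (hJ : ∀ t, t ∈ J' ↔ f t = n ∨ ∃ s ∈ J, f t = (s : ℕ)) (Y : AU h n) :
    ins h f n N (absorb θ J Y) =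
      absorb θ J' (TensorAlg.mapLeft (U k g) (ins h f n N) Y) :=
  TensorAlg.map_mulMap (ins h f n N) (fun u => ins_copLast hJ (ι (θ u))) Y

/-- The factor `j` is moved to the front. -/
def cycF (j : ℕ) : ℕ → ℕ
  | 0 => j
  | s + 1 => if s < j then s else s + 1

/-- The factor `j` is mapped to `h` by `θ` and absorbed into the following factors. -/
noncomputable def contract (n j : ℕ) : A h (n + 1) →ₗ[k] A h n :=
  absorb θ (fromOn n j) ∘ₗ (splitHead h n).toLinearMap ∘ₗ (ins h (cycF j) (n + 1) (n + 1)).toLinearMap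

theorem contract_apply (n j : ℕ) (X : A h (n + 1)) : contract θ n j X =
    absorb θ (fromOn n j) (splitHead h n (ins h (cycF j) (n + 1) (n + 1) X)) := rfl

theorem contract_ins_dblF {n j i : ℕ} (hj : j < n + 1) (hi : i ≤ n + 1) (X : A h n) :
    contract θ n j (ins h (dblF n i) n (n + 1) X) = absorb θ (fromOn n j)
      (splitHead h n (ins h (fun t => dblF n i (cycF j t)) n (n + 1) X)) := by
  rw [contract_apply, ins_comp]
  · grind [dblF]
  · intro t ht
    rcases t with _ | t <;> grind [dblF, cycF]

/-- Together with `contract_ins_dblF` this puts both orders of a contraction and a coface into the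
form absorb ∘ split ∘ insert, so that only assignments remain to be compared. The absorbing factors
start one place later if the coface adds a factor before them. -/
theorem ins_dblF_contract {n j i : ℕ} (hj : j < n + 1) (hi : i ≤ n + 1) (X : A h (n + 1)) :
    ins h (dblF n i) n (n + 1) (contract θ n j X) =
      absorb θ (fromOn (n + 1) (if i ≤ j then j + 1 else j)) (splitHead h (n + 1)
        (ins h (fun t => cycF j (consF (dblF n i) t)) (n + 1) (n + 1 + 1) X)) := by
  rw [contract_apply, ins_absorb (J' := fromOn (n + 1) (if i ≤ j then j + 1 else j)),
    map_ins_splitHead, ins_comp]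
  · grind [cycF]
  · intro t ht
    rcases t with _ | t <;> grind [consF, dblF, cycF]
  · intro t
    have := t.2
    rw [mem_fromOn]
    have e : (∃ s ∈ fromOn n j, dblF n i t = (s : ℕ)) ↔ j ≤ dblF n i t ∧ dblF n i t < n := by
      constructor
      · rintro ⟨s, hs, hs'⟩
        rw [mem_fromOn] at hs
        have := s.2
        omega
      · rintro ⟨h1, h2⟩
        exact ⟨⟨_, h2⟩, mem_fromOn.2 h1, rfl⟩
    rw [e]
    simp only [dblF]
    split_ifs <;> omega

/-- With the next lemma, the analogue of the cosimplicial identities: a contraction commutes, up to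
a shift of indices, with every coface that does not create the contracted factor. -/
theorem contract_ins_dblF_of_lt {n j i : ℕ} (hij : i ≤ j) (hj : j < n + 1) (X : A h (n + 1)) :
    contract θ (n + 1) (j + 1) (ins h (dblF (n + 1) i) (n + 1) (n + 1 + 1) X) =
      ins h (dblF n i) n (n + 1) (contract θ n j X) := by
  rw [contract_ins_dblF θ (by omega) (by omega), ins_dblF_contract θ (by omega) (by omega),
    if_pos hij]
  congr 2
  rw [ins_congr]
  intro t ht
  rcases t with _ | _ | t <;> grind [consF, dblF, cycF]

theorem contract_ins_dblF_of_gt {n j i : ℕ} (hij : j + 1 ≤ i) (hi : i ≤ n + 1) (X : A h (n + 1)) :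
    contract θ (n + 1) j (ins h (dblF (n + 1) (i + 1)) (n + 1) (n + 1 + 1) X) =
      ins h (dblF n i) n (n + 1) (contract θ n j X) := by
  rw [contract_ins_dblF θ (by omega) (by omega), ins_dblF_contract θ (by omega) (by omega),
    if_neg (by omega)]
  congr 2
  rw [ins_congr]
  intro t ht
  rcases t with _ | _ | t <;> grind [consF, dblF, cycF]

/-- The factor `j` is doubled, with the copy put in front. -/
def copyF (j : ℕ) : ℕ → ℕ
  | 0 => j
  | s + 1 => s

/-- The coface `j + 1` doubles the factor `j`, which is the last factor if `j = n`. Here the first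
copy is contracted, so the remaining copy absorbs as well; in the next lemma the second copy is
contracted and only later factors absorb. -/
theorem contract_ins_dblF_succ {n j : ℕ} (hj : j ≤ n) (X : A h n) :
    contract θ n j (ins h (dblF n (j + 1)) n (n + 1) X) =
      absorb θ (fromOn n j) (splitHead h n (ins h (copyF j) n (n + 1) X)) := by
  rw [contract_ins_dblF θ (by omega) (by omega)]
  congr 2
  rw [ins_congr]
  intro t ht
  rcases t with _ | t <;> grind [dblF, cycF, copyF]

theorem contract_succ_ins_dblF_succ {n j : ℕ} (hj : j < n) (X : A h n) :
    contract θ n (j + 1) (ins h (dblF n (j + 1)) n (n + 1) X) =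
      absorb θ (fromOn n (j + 1)) (splitHead h n (ins h (copyF j) n (n + 1) X)) := by
  rw [contract_ins_dblF θ (by omega) (by omega)]
  congr 2
  rw [ins_congr]
  intro t ht
  rcases t with _ | t <;> grind [dblF, cycF, copyF]

theorem contract_zero_ins_dblF_zero (hθ : θ 1 = 0) {n : ℕ} (X : A h n) :
    contract θ n 0 (ins h (dblF n 0) n (n + 1) X) = 0 := by
  rw [contract_ins_dblF θ (by omega) (by omega)]
  have key : (splitHead h n).comp (ins h (fun t => dblF n 0 (cycF 0 t)) n (n + 1)) =
      inA h n := by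
    have hf : ∀ s, fib (fun t => dblF n 0 (cycF 0 (t + 1))) n s = fib (fun t => t) n s := by
      intro s
      ext t
      simp [mem_fib, dblF, cycF]
    have hf' : ∀ s : Fin n, fib (fun t => t) n s = {s} := by
      intro s
      ext t
      rw [mem_fib, Finset.mem_singleton, Fin.ext_iff]
    have hf'' : fib (fun t => t) n n = ∅ := by
      ext t
      have := t.2
      rw [mem_fib]
      simp
      omega
    apply A_algHom_ext
    · intro s x
      have := s.2
      rw [AlgHom.comp_apply, splitHead_ins_slot, hf, hf', Finset.sum_singleton, if_neg, zero_add]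
      simp [dblF, cycF]
      omega
    · intro z
      rw [AlgHom.comp_apply, splitHead_ins_last, hf, hf'', Finset.sum_empty, if_neg, zero_add,
        zero_add]
      simp [dblF, cycF]
  have h2 := DFunLike.congr_fun key X
  rw [AlgHom.comp_apply] at h2
  rw [h2, ← mul_one (inA h n X), ← map_one (inU h n), absorb_apply, hθ, map_zero, map_zero,
    mul_zero]

/-- The alternating sum of the contractions -/
noncomputable def contraction (n : ℕ) : A h (n + 1) →ₗ[k] A h n :=
  ∑ j ∈ Finset.range (n + 1), (-1 : k) ^ j • contract θ n j

/-- The factor `j` is multiplied by the image of `θ` in the factor `j`. -/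
noncomputable def slotWeight (n j : ℕ) : A h n →ₗ[k] A h n :=
  (absorb θ (fromOn n j) - if j < n then absorb θ (fromOn n (j + 1)) else 0) ∘ₗ
    (splitHead h n).toLinearMap ∘ₗ (ins h (copyF j) n (n + 1)).toLinearMap

/-- `F i j` stands for the contraction `j` after the coface `i`, and `G i j` for the opposite order.
All terms cancel in pairs except those whose coface creates the contracted factor. -/
theorem sum_cancel {M : Type*} [AddCommGroup M] [Module k M] (F G : ℕ → ℕ → M) (n : ℕ)
    (h₁ : ∀ i j, i ≤ j → j < n + 1 → F i (j + 1) = G i j)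
    (h₂ : ∀ i j, j + 1 ≤ i → i ≤ n + 1 → F (i + 1) j = G i j) :
    ∑ i ∈ Finset.range (n + 2), (-1 : k) ^ i • ∑ j ∈ Finset.range (n + 1), (-1 : k) ^ j • G i j +
      ∑ j ∈ Finset.range (n + 2), (-1 : k) ^ j •
        ∑ i ∈ Finset.range (n + 3), (-1 : k) ^ i • F i j =
      ∑ j ∈ Finset.range (n + 2), (F j j - F (j + 1) j) := by
  have e1 : ∀ j ∈ Finset.range (n + 2), (-1 : k) ^ j •
        ∑ i ∈ Finset.range (n + 3), (-1 : k) ^ i • F i j = (F j j - F (j + 1) j) +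
        (∑ i ∈ Finset.range j, (-1 : k) ^ (i + j) • F i j +
        ∑ i ∈ Finset.range (n + 1 - j), (-1 : k) ^ (i + j + j) • F (j + 2 + i) j) := by
    intro j hj
    rw [Finset.mem_range] at hj
    rw [show n + 3 = (j + 1 + 1) + (n + 1 - j) by omega, Finset.sum_range_add,
      Finset.sum_range_succ, Finset.sum_range_succ, smul_add, smul_add, smul_add, Finset.smul_sum,
      Finset.smul_sum, smul_smul, smul_smul, ← pow_add, ← pow_add, (Even.add_self j).neg_one_pow,
      show j + (j + 1) = (j + j) + 1 by ring, pow_succ, (Even.add_self j).neg_one_pow]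
    have e2 : ∀ i, (-1 : k) ^ j • (-1 : k) ^ i • F i j = (-1 : k) ^ (i + j) • F i j := fun i => by
      rw [smul_smul, ← pow_add, add_comm]
    have e3 : ∀ i, (-1 : k) ^ (j + 1 + 1 + i + j) • F (j + 1 + 1 + i) j =
        (-1 : k) ^ (i + j + j) • F (j + 2 + i) j := fun i => by
      congr 1
      apply neg_one_pow_congr
      omega
    simp only [e2, e3]
    module
  have e4 : ∀ j ∈ Finset.range (n + 1), ∑ i ∈ Finset.range (n + 2), (-1 : k) ^ i •
      (-1 : k) ^ j • G i j = ∑ i ∈ Finset.range (j + 1), (-1 : k) ^ (i + j) • G i j +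
        ∑ i ∈ Finset.range (n + 1 - j), (-1 : k) ^ (i + j + j + 1) • G (j + 1 + i) j := by
    intro j hj
    rw [Finset.mem_range] at hj
    rw [show n + 2 = (j + 1) + (n + 1 - j) by omega, Finset.sum_range_add]
    congr 1
    · exact Finset.sum_congr rfl fun i _ => by rw [smul_smul, ← pow_add]
    · refine Finset.sum_congr rfl fun i _ => ?_
      rw [smul_smul, ← pow_add]
      congr 1
      apply neg_one_pow_congr
      omega
  rw [Finset.sum_congr rfl e1, Finset.sum_add_distrib]
  simp only [Finset.smul_sum]
  rw [Finset.sum_comm, Finset.sum_congr rfl e4, Finset.sum_add_distrib, Finset.sum_add_distrib,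
    Finset.sum_range_succ' (fun j => ∑ i ∈ Finset.range j, (-1 : k) ^ (i + j) • F i j),
    Finset.sum_range_succ (fun j => ∑ i ∈ Finset.range (n + 1 - j), _ • F (j + 2 + i) j),
    Nat.sub_self, Finset.sum_range_zero, Finset.sum_range_zero, add_zero, add_zero]
  have e5 : ∑ j ∈ Finset.range (n + 1), ∑ i ∈ Finset.range (j + 1),
      (-1 : k) ^ (i + (j + 1)) • F i (j + 1) =
      -∑ j ∈ Finset.range (n + 1), ∑ i ∈ Finset.range (j + 1), (-1 : k) ^ (i + j) • G i j := by
    rw [← Finset.sum_neg_distrib]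
    refine Finset.sum_congr rfl fun j hj => ?_
    rw [← Finset.sum_neg_distrib]
    refine Finset.sum_congr rfl fun i hi => ?_
    rw [Finset.mem_range] at hi hj
    rw [h₁ i j (by omega) hj, ← add_assoc, pow_succ]
    module
  have e6 : ∑ j ∈ Finset.range (n + 1), ∑ i ∈ Finset.range (n + 1 - j),
      (-1 : k) ^ (i + j + j) • F (j + 2 + i) j =
      -∑ j ∈ Finset.range (n + 1), ∑ i ∈ Finset.range (n + 1 - j),
        (-1 : k) ^ (i + j + j + 1) • G (j + 1 + i) j := by
    rw [← Finset.sum_neg_distrib]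
    refine Finset.sum_congr rfl fun j hj => ?_
    rw [← Finset.sum_neg_distrib]
    refine Finset.sum_congr rfl fun i hi => ?_
    rw [Finset.mem_range] at hi hj
    rw [← h₂ (j + 1 + i) j (by omega) (by omega), pow_succ,
      show j + 1 + i + 1 = j + 2 + i by ring]
    module
  rw [e5, e6]
  abel

/-- The coface 0 creates a factor 1, killed by `θ`. After a shift of index, each doubled factor
contributes two terms, absorbing with and without the factor itself; their difference is
`slotWeight`. The last factor contributes one term. -/
theorem sum_diagonal (hθ : θ 1 = 0) (n : ℕ) (X : A h n) :
    ∑ j ∈ Finset.range (n + 1), (contract θ n j (ins h (dblF n j) n (n + 1) X) -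
      contract θ n j (ins h (dblF n (j + 1)) n (n + 1) X)) =
    -∑ j ∈ Finset.range (n + 1), slotWeight θ n j X := by
  rw [Finset.sum_sub_distrib, Finset.sum_range_succ', contract_zero_ins_dblF_zero θ hθ, add_zero,
    Finset.sum_range_succ, Finset.sum_range_succ, ← sub_sub, ← Finset.sum_sub_distrib, neg_add,
    sub_eq_add_neg]
  congr 1
  · rw [← Finset.sum_neg_distrib]
    refine Finset.sum_congr rfl fun j hj => ?_
    rw [Finset.mem_range] at hj
    rw [contract_succ_ins_dblF_succ θ hj, contract_ins_dblF_succ θ hj.le, slotWeight, if_pos hj]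
    simp
  · rw [contract_ins_dblF_succ θ le_rfl, slotWeight, if_neg (lt_irrefl n)]
    simp

theorem contraction_apply (n : ℕ) (X : A h (n + 1)) : contraction θ n X =
    ∑ j ∈ Finset.range (n + 1), (-1 : k) ^ j • contract θ n j X := by
  simp [contraction]

theorem contraction_b_zero (hθ : θ 1 = 0) (X : A h 0) :
    contraction θ 0 (b h 0 X) = -∑ j ∈ Finset.range 1, slotWeight θ 0 j X := by
  rw [← sum_diagonal θ hθ, contraction_apply, b_apply]
  simp only [Finset.sum_range_succ, Finset.sum_range_zero, pow_zero, pow_one, map_add, map_smul,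
    one_smul, zero_add]
  module

theorem b_contraction_add (hθ : θ 1 = 0) (n : ℕ) (X : A h (n + 1)) :
    b h n (contraction θ n X) + contraction θ (n + 1) (b h (n + 1) X) =
      -∑ j ∈ Finset.range (n + 2), slotWeight θ (n + 1) j X := by
  rw [← sum_diagonal θ hθ, ← sum_cancel (k := k)
    (fun i j => contract θ (n + 1) j (ins h (dblF (n + 1) i) (n + 1) (n + 1 + 1) X))
    (fun i j => ins h (dblF n i) n (n + 1) (contract θ n j X)) n
    (fun i j hij hj => contract_ins_dblF_of_lt θ hij hj X)
    (fun i j hij hi => contract_ins_dblF_of_gt θ hij hi X)]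
  rw [b_apply, b_apply, contraction_apply, contraction_apply]
  simp only [map_sum, map_smul]

end Contraction

/-! ### The operators `slotWeight` on pure tensors and the action of 𝔥 -/

section Weights

attribute [local instance 100] LieRing.ofAssociativeRing

variable {k : Type*} [Field k] {g : Type*} [LieRing g] [LieAlgebra k g] {h : LieSubalgebra k g}

local notation "ι" => UniversalEnvelopingAlgebra.ι k

theorem fib_id {n : ℕ} (s : Fin n) : fib (fun t => t) n s = {s} := by
  ext t
  rw [mem_fib, Finset.mem_singleton, Fin.ext_iff]

theorem fib_id_self (n : ℕ) : fib (fun t => t) n n = ∅ := by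
  ext t
  have := t.2
  rw [mem_fib]
  simp
  omega

/-- Multilinearity, one factor at a time; the induction is on the set of factors not yet known to
lie in `S`. -/
theorem tprod_mem_of_forall {n : ℕ} {S : Set (U k g)} (hS : Submodule.span k S = ⊤)
    {Q : Submodule k (T k g n)} (hQ : ∀ u : Fin n → U k g, (∀ s, u s ∈ S) →
      PiTensorProduct.tprod k u ∈ Q) (t : T k g n) : t ∈ Q := by
  classical
  have key : ∀ (F : Finset (Fin n)) (u : Fin n → U k g), (∀ s ∉ F, u s ∈ S) →
      PiTensorProduct.tprod k u ∈ Q := by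
    intro F
    induction F using Finset.induction_on with
    | empty => exact fun u hu => hQ u fun s => hu s (Finset.notMem_empty s)
    | insert a F _ ih =>
      intro u hu
      have h1 : (⊤ : Submodule k (U k g)) ≤
          Q.comap ((PiTensorProduct.tprod k (s := fun _ : Fin n => U k g)).toLinearMap u a) := by
        rw [← hS, Submodule.span_le]
        intro v hv
        refine ih _ fun s hs => ?_
        by_cases hsa : s = a
        · subst hsa
          rwa [Function.update_self]
        · rw [Function.update_of_ne hsa]
          exact hu s fun hs' => (Finset.mem_insert.1 hs').elim hsa hs
      have h2 := h1 (Submodule.mem_top (x := u a))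
      rw [Submodule.mem_comap, MultilinearMap.toLinearMap_apply, Function.update_eq_self] at h2
      exact h2
  induction t using PiTensorProduct.induction_on with
  | smul_tprod r u => exact Q.smul_mem r (key Finset.univ u fun s hs => absurd (Finset.mem_univ s) hs)
  | add x y hx hy => exact Q.add_mem hx hy

theorem mem_of_forall_tprod_tmul {n : ℕ} {S : Set (U k g)} (hS : Submodule.span k S = ⊤)
    {S' : Set (U k h)} (hS' : Submodule.span k S' = ⊤) {Q : Submodule k (A h n)}
    (hQ : ∀ u : Fin n → U k g, (∀ s, u s ∈ S) → ∀ w ∈ S', PiTensorProduct.tprod k u ⊗ₜ[k] w ∈ Q)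
    (X : A h n) : X ∈ Q := by
  induction X using TensorProduct.induction_on with
  | zero => exact Q.zero_mem
  | tmul t w =>
    have h1 : ∀ w ∈ S', t ⊗ₜ[k] w ∈ Q := fun w hw =>
      tprod_mem_of_forall (Q := Q.comap ((TensorProduct.mk k (T k g n) (U k h)).flip w)) hS
        (fun u hu => hQ u hu w hw) t
    have h2 : (⊤ : Submodule k (U k h)) ≤ Q.comap (TensorProduct.mk k (T k g n) (U k h) t) := by
      rw [← hS', Submodule.span_le]
      exact h1
    exact h2 (Submodule.mem_top (x := w))
  | add X Y hX hY => exact Q.add_mem hX hY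

theorem tprod_tmul_eq_prod {n : ℕ} (u : Fin n → U k g) (w : U k h) :
    PiTensorProduct.tprod k u ⊗ₜ[k] w =
      (List.ofFn fun s => slotU h s (u s)).prod * lastU h n w := by
  have h1 : (Algebra.TensorProduct.includeLeft : T k g n →ₐ[k] A h n) (PiTensorProduct.tprod k u) =
      (List.ofFn fun s => slotU h s (u s)).prod := by
    rw [tprod_eq_prod, map_list_prod, List.map_ofFn]
    rfl
  rw [← h1]
  change _ = (PiTensorProduct.tprod k u ⊗ₜ[k] (1 : U k h)) * ((1 : T k g n) ⊗ₜ[k] w)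
  rw [Algebra.TensorProduct.tmul_mul_tmul, one_mul, mul_one]

theorem tprod_tmul_mul_slotU {n : ℕ} (u : Fin n → U k g) (w : U k h) (j : Fin n) (a : U k g) :
    (PiTensorProduct.tprod k (Function.update u j 1) ⊗ₜ[k] w) * slotU h j a =
      PiTensorProduct.tprod k (Function.update u j a) ⊗ₜ[k] w := by
  change (PiTensorProduct.tprod k (Function.update u j 1) ⊗ₜ[k] w) * (place k g j a ⊗ₜ[k] 1) = _
  rw [Algebra.TensorProduct.tmul_mul_tmul, mul_one, PiTensorProduct.singleAlgHom_apply,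
    PiTensorProduct.tprod_mul_tprod]
  congr 2
  ext s
  by_cases hs : s = j
  · subst hs
    simp
  · simp [Function.update_of_ne hs, Pi.mulSingle_eq_of_ne hs]

variable (h) in
/-- The coproduct is applied to the factor `j`, with one of the values in the additional factor. -/
noncomputable def coact (n j : ℕ) : A h n →ₐ[k] AU h n :=
  (splitHead h n).comp (ins h (copyF j) n (n + 1))

theorem coact_slot {n j : ℕ} (s : Fin n) (x : g) :
    coact h n j (slot h s x) = (if j = s then inU h n (ι x) else 0) + inA h n (slot h s x) := by
  rw [coact, AlgHom.comp_apply, splitHead_ins_slot]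
  change _ + inA h n (∑ t ∈ fib (fun t => t) n s, slot h t x) = _
  rw [fib_id, Finset.sum_singleton]
  rfl

theorem coact_last {n j : ℕ} (z : h) :
    coact h n j (last h n z) =
      (if j = n then inU h n (ι (z : g)) else 0) + inA h n (last h n z) := by
  rw [coact, AlgHom.comp_apply, splitHead_ins_last]
  change _ + inA h n (∑ t ∈ fib (fun t => t) n n, slot h t (z : g) + _) = _
  rw [fib_id_self, Finset.sum_empty, zero_add]
  rfl

theorem coact_slotU_of_ne {n j : ℕ} (s : Fin n) (hs : j ≠ s) (u : U k g) :
    coact h n j (slotU h s u) = inA h n (slotU h s u) := by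
  have key : (coact h n j).comp (slotU h s) = (inA h n).comp (slotU h s) := by
    apply U_algHom_ext
    intro x
    have := coact_slot (h := h) (j := j) s x
    rw [if_neg (fun e => hs e), zero_add] at this
    exact this
  exact DFunLike.congr_fun key u

theorem coact_lastU_of_ne {n j : ℕ} (hj : j ≠ n) (w : U k h) :
    coact h n j (lastU h n w) = inA h n (lastU h n w) := by
  have key : (coact h n j).comp (lastU h n) = (inA h n).comp (lastU h n) := by
    apply U_algHom_ext
    intro x
    have := coact_last (n := n) (j := j) x
    rw [if_neg hj, zero_add] at this
    exact this
  exact DFunLike.congr_fun key w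

theorem coact_slotU {n : ℕ} (j : Fin n) (u : U k g) :
    coact h n j (slotU h j u) =
      TensorAlg.mapPair (slotU h j) (AlgHom.id k (U k g)) (comul k g u) := by
  have key : (coact h n j).comp (slotU h j) =
      (TensorAlg.mapPair (slotU h j) (AlgHom.id k (U k g))).comp (comul k g) := by
    apply U_algHom_ext
    intro x
    have := coact_slot (h := h) (j := j) j x
    rw [if_pos rfl] at this
    rw [AlgHom.comp_apply, AlgHom.comp_apply, comul_ι, map_add, TensorAlg.mapPair_tmul,
      TensorAlg.mapPair_tmul, map_one, map_one, map_one, map_one, mul_one, one_mul, add_comm]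
    exact this
  exact DFunLike.congr_fun key u

theorem coact_lastU (n : ℕ) (w : U k h) :
    coact h n n (lastU h n w) =
      TensorAlg.mapPair (lastU h n) (mapU h.incl) (comul k h w) := by
  have key : (coact h n n).comp (lastU h n) =
      (TensorAlg.mapPair (lastU h n) (mapU h.incl)).comp (comul k h) := by
    apply U_algHom_ext
    intro x
    have := coact_last (n := n) (j := n) x
    rw [if_pos rfl] at this
    rw [AlgHom.comp_apply, AlgHom.comp_apply, comul_ι, map_add, TensorAlg.mapPair_tmul,
      TensorAlg.mapPair_tmul, map_one, map_one, map_one, map_one, mul_one, one_mul, add_comm, mapU_ι]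
    exact this
  exact DFunLike.congr_fun key w

theorem coact_tprod {n : ℕ} (u : Fin n → U k g) (w : U k h) (j : Fin n) :
    coact h n j (PiTensorProduct.tprod k (Function.update u j 1) ⊗ₜ[k] w) =
      inA h n (PiTensorProduct.tprod k (Function.update u j 1) ⊗ₜ[k] w) := by
  have h1 : (⇑(coact h n j) ∘ fun s => slotU h s (Function.update u j 1 s)) =
      ⇑(inA h n) ∘ fun s => slotU h s (Function.update u j 1 s) := by
    funext s
    rw [Function.comp_apply, Function.comp_apply]
    by_cases hs : s = j
    · subst hs
      rw [Function.update_self, map_one, map_one, map_one]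
    · exact coact_slotU_of_ne s (fun e => hs (Fin.ext e.symm)) _
  rw [tprod_tmul_eq_prod, map_mul, map_mul, map_list_prod, map_list_prod, List.map_ofFn,
    List.map_ofFn, coact_lastU_of_ne j.2.ne, h1]

theorem coact_tmul_one {n : ℕ} (t : T k g n) :
    coact h n n (t ⊗ₜ[k] 1) = inA h n (t ⊗ₜ[k] 1) := by
  have key : ((coact h n n).comp (Algebra.TensorProduct.includeLeft : T k g n →ₐ[k] A h n)) =
      (inA h n).comp (Algebra.TensorProduct.includeLeft : T k g n →ₐ[k] A h n) := by
    apply PiTensorProduct.algHom_ext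
    intro s
    apply U_algHom_ext
    intro x
    exact coact_slotU_of_ne s s.2.ne' _
  exact DFunLike.congr_fun key t

theorem fromOn_eq_insert {n : ℕ} (j : Fin n) :
    fromOn n j = insert j (fromOn n (j + 1)) := by
  ext s
  rw [Finset.mem_insert, mem_fromOn, mem_fromOn, Fin.ext_iff]
  omega

theorem fromOn_self (n : ℕ) : fromOn n n = ∅ := by
  ext s
  have := s.2
  rw [mem_fromOn]
  simp

theorem copLast_fromOn_sub {n : ℕ} (j : Fin n) (z : h) :
    copLast h (fromOn n j) (ι z) - copLast h (fromOn n (j + 1)) (ι z) = slot h j (z : g) := by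
  rw [copLast_ι, copLast_ι, fromOn_eq_insert, Finset.sum_insert]
  · abel
  · rw [mem_fromOn]
    omega

variable (θ : U k g →ₗ[k] h)

theorem slotWeight_apply (n j : ℕ) (X : A h n) : slotWeight θ n j X =
    absorb θ (fromOn n j) (coact h n j X) -
      if j < n then absorb θ (fromOn n (j + 1)) (coact h n j X) else 0 := by
  rw [slotWeight, LinearMap.comp_apply, LinearMap.sub_apply]
  congr 1
  split_ifs <;> rfl

/-- Absorbing from `j` on and absorbing from `j + 1` on differ by right multiplication in the factor
`j` alone, so the result is a convolution in that factor. -/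
theorem slotWeight_tprod {n : ℕ} (u : Fin n → U k g) (w : U k h) (j : Fin n) :
    slotWeight θ n j (PiTensorProduct.tprod k u ⊗ₜ[k] w) =
      PiTensorProduct.tprod k (Function.update u j (conv LinearMap.id
        ((ι : g →ₗ⁅k⁆ U k g).toLinearMap ∘ₗ h.toSubmodule.subtype ∘ₗ θ) (u j))) ⊗ₜ[k] w := by
  have h1 : ∀ Y : U k g ⊗[k] U k g,
      absorb θ (fromOn n j) (TensorAlg.mapPair (slotU h j) (AlgHom.id k (U k g)) Y) -
      absorb θ (fromOn n (j + 1)) (TensorAlg.mapPair (slotU h j) (AlgHom.id k (U k g)) Y) =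
      slotU h j (LinearMap.mul' k (U k g) (TensorProduct.map LinearMap.id
        ((ι : g →ₗ⁅k⁆ U k g).toLinearMap ∘ₗ h.toSubmodule.subtype ∘ₗ θ) Y)) := by
    intro Y
    induction Y using TensorProduct.induction_on with
    | zero => simp
    | tmul a b =>
      rw [TensorAlg.mapPair_tmul, absorb_apply, absorb_apply, ← mul_sub,
        AlgHom.id_apply, copLast_fromOn_sub, TensorProduct.map_tmul, LinearMap.mul'_apply, map_mul]
      rfl
    | add x y hx hy =>
      rw [map_add, map_add, map_add, map_add, map_add, map_add, ← hx, ← hy]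
      abel
  have h2 := tprod_tmul_mul_slotU u w j (u j)
  rw [Function.update_eq_self] at h2
  rw [← h2, slotWeight_apply, if_pos j.2, map_mul, coact_tprod, absorb_mul, absorb_mul, ← mul_sub,
    coact_slotU, h1, ← tprod_tmul_mul_slotU (a := conv _ _ _)]
  rfl

theorem slotWeight_last {n : ℕ} (t : T k g n) (w : U k h) :
    slotWeight θ n n (t ⊗ₜ[k] w) = t ⊗ₜ[k] (conv LinearMap.id
      ((ι : h →ₗ⁅k⁆ U k h).toLinearMap ∘ₗ θ ∘ₗ (mapU h.incl).toLinearMap) w) := by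
  have h1 : ∀ Y : U k h ⊗[k] U k h,
      absorb θ ∅ (TensorAlg.mapPair (lastU h n) (mapU h.incl) Y) =
      lastU h n (LinearMap.mul' k (U k h) (TensorProduct.map LinearMap.id
        ((ι : h →ₗ⁅k⁆ U k h).toLinearMap ∘ₗ θ ∘ₗ (mapU h.incl).toLinearMap) Y)) := by
    intro Y
    induction Y using TensorProduct.induction_on with
    | zero => simp
    | tmul a b =>
      rw [TensorAlg.mapPair_tmul, absorb_apply,
        copLast_ι, Finset.sum_empty, zero_add, TensorProduct.map_tmul, LinearMap.mul'_apply, map_mul]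
      rfl
    | add x y hx hy => rw [map_add, map_add, map_add, map_add, map_add, ← hx, ← hy]
  have h2 : ∀ w : U k h, t ⊗ₜ[k] w = (t ⊗ₜ[k] (1 : U k h)) * lastU h n w := fun w => by
    change _ = (t ⊗ₜ[k] (1 : U k h)) * ((1 : T k g n) ⊗ₜ[k] w)
    rw [Algebra.TensorProduct.tmul_mul_tmul, one_mul, mul_one]
  rw [h2, slotWeight_apply, if_neg (lt_irrefl n), sub_zero, map_mul, coact_tmul_one, absorb_mul,
    coact_lastU, fromOn_self, h1, h2 (conv _ _ w)]
  rfl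

theorem commutator_mul {R : Type*} [Ring R] (d x c : R) :
    d * (x * c) - x * c * d = (d * x - x * d) * c + x * (d * c - c * d) := by
  noncomm_ring

/-! Compatibility with the action of `h` -/

theorem splitHead_diag {n : ℕ} (z : h) :
    splitHead h n (diag h (n + 1) z) = inA h n (diag h n z) + inU h n (ι (z : g)) := by
  rw [diag, Fin.sum_univ_succ, map_add, map_add, map_sum, last, splitHead_lastU, slot,
    splitHead_slotU_zero, diag, map_add, map_sum]
  simp only [slot, splitHead_slotU_succ]
  rw [last]
  abel

theorem slot_mul_sub {n : ℕ} (s : Fin n) (x y : g) :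
    slot h s x * slot h s y - slot h s y * slot h s x = slot h s ⁅x, y⁆ := by
  rw [slot, slot, slot, ← ι_mul_sub_mul_ι, map_sub, map_mul, map_mul]

theorem last_mul_sub (n : ℕ) (x y : h) :
    last h n x * last h n y - last h n y * last h n x = last h n ⁅x, y⁆ := by
  rw [last, last, last, ← ι_mul_sub_mul_ι, map_sub, map_mul, map_mul]

theorem diag_mul_copLast {n : ℕ} (J : Finset (Fin n)) (x y : h) :
    diag h n x * copLast h J (ι y) - copLast h J (ι y) * diag h n x = copLast h J (ι ⁅x, y⁆) := by
  classical
  have h1 : ∀ s : Fin n, diag h n x * slot h s (y : g) - slot h s (y : g) * diag h n x =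
      slot h s (⁅x, y⁆ : h) := by
    intro s
    have h2 : diag h n x = slot h s (x : g) +
        (∑ t ∈ Finset.univ.erase s, slot h t (x : g) + last h n x) := by
      rw [diag, ← Finset.add_sum_erase _ _ (Finset.mem_univ s), add_assoc]
    have h3 : Commute (∑ t ∈ Finset.univ.erase s, slot h t (x : g) + last h n x)
        (slot h s (y : g)) := by
      refine Commute.add_left (Commute.sum_left _ _ _ fun t ht => ?_) (slot_last_commute s _ x).symm
      exact slot_commute (Finset.ne_of_mem_erase ht) _ _
    rw [h2, add_mul, mul_add, h3.eq, add_sub_add_right_eq_sub, slot_mul_sub]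
    rfl
  have h4 : diag h n x * last h n y - last h n y * diag h n x = last h n ⁅x, y⁆ := by
    have h5 : Commute (∑ t : Fin n, slot h t (x : g)) (last h n y) :=
      Commute.sum_left _ _ _ fun t _ => slot_last_commute t _ y
    rw [diag, add_mul, mul_add, h5.eq, add_sub_add_left_eq_sub, last_mul_sub]
  rw [copLast_ι, copLast_ι, mul_add, add_mul, Finset.mul_sum, Finset.sum_mul, add_sub_add_comm,
    ← Finset.sum_sub_distrib, h4]
  congr 1
  exact Finset.sum_congr rfl fun s _ => h1 s

variable {θ}

/-- The product rule for commutators, with equivariance of `θ` and of the coproduct of elements of 𝔥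
(`diag_mul_copLast`). -/
theorem absorb_equivariant (hθ : ∀ (x : h) u, θ (ι (x : g) * u - u * ι (x : g)) = ⁅x, θ u⁆) {n : ℕ}
    (J : Finset (Fin n)) (x : h) (Y : AU h n) :
    diag h n x * absorb θ J Y - absorb θ J Y * diag h n x =
      absorb θ J ((inA h n (diag h n x) + inU h n (ι (x : g))) * Y -
        Y * (inA h n (diag h n x) + inU h n (ι (x : g)))) := by
  induction Y using TensorAlg.induction with
  | h X u =>
    have h1 : (inA h n (diag h n x) + inU h n (ι (x : g))) * (inA h n X * inU h n u) -
        inA h n X * inU h n u * (inA h n (diag h n x) + inU h n (ι (x : g))) =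
        inA h n (diag h n x * X - X * diag h n x) * inU h n u +
          inA h n X * inU h n (ι (x : g) * u - u * ι (x : g)) := by
      have h2 : Commute (inA h n X) (inU h n (ι (x : g))) := TensorAlg.commute _ _
      have h3 : Commute (inA h n (diag h n x)) (inU h n u) := TensorAlg.commute _ _
      rw [add_mul, mul_add, ← mul_assoc (inU h n _), ← h2.eq, mul_assoc (inA h n X) (inU h n u),
        ← h3.eq]
      simp only [map_mul, map_sub]
      noncomm_ring
    rw [h1, map_add, absorb_apply, absorb_apply, absorb_apply, hθ, ← diag_mul_copLast]
    exact commutator_mul _ _ _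
  | h_add x y hx hy =>
    rw [map_add, mul_add, add_mul, mul_add _ x y, add_mul x y, add_sub_add_comm, hx, hy, ← map_add]
    congr 1
    exact (add_sub_add_comm _ _ _ _).symm

theorem absorb_splitHead_mem
    (hθ : ∀ (x : h) u, θ (ι (x : g) * u - u * ι (x : g)) = ⁅x, θ u⁆) {n : ℕ}
    (J : Finset (Fin n)) {X : A h (n + 1)} (hX : X ∈ g2 h (n + 1)) :
    absorb θ J (splitHead h n X) ∈ g2 h n := by
  rw [mem_g2]
  intro z
  have h1 := (mem_g2.1 hX z).map (splitHead h n)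
  rw [splitHead_diag] at h1
  rw [commute_iff_eq, ← sub_eq_zero, absorb_equivariant hθ, h1.eq, sub_self, map_zero]

theorem contraction_mem (hθ : ∀ (x : h) u, θ (ι (x : g) * u - u * ι (x : g)) = ⁅x, θ u⁆) {n : ℕ}
    {X : A h (n + 1)} (hX : X ∈ g2 h (n + 1)) : contraction θ n X ∈ g2 h n := by
  rw [contraction_apply]
  exact Submodule.sum_mem _ fun j _ =>
    Submodule.smul_mem _ _ (absorb_splitHead_mem hθ _ (ins_mem_g2 hX))

theorem slotWeight_mem (hθ : ∀ (x : h) u, θ (ι (x : g) * u - u * ι (x : g)) = ⁅x, θ u⁆) {n : ℕ}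
    (j : ℕ) {X : A h n} (hX : X ∈ g2 h n) : slotWeight θ n j X ∈ g2 h n := by
  rw [slotWeight_apply]
  refine sub_mem (absorb_splitHead_mem hθ _ (ins_mem_g2 hX)) ?_
  split_ifs
  · exact absorb_splitHead_mem hθ _ (ins_mem_g2 hX)
  · exact zero_mem _

end Weights

/-! ### The total weight W and its functional calculus -/

section TotalWeight

attribute [local instance 100] LieRing.ofAssociativeRing

variable {k : Type*} [Field k] [CharZero k] {g : Type*} [LieRing g] [LieAlgebra k g]
  {h : LieSubalgebra k g} {m : Submodule k g} (hm : IsCompl h.toSubmodule m)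

local notation "ι" => UniversalEnvelopingAlgebra.ι k

/-- The operator `ι z ^ l ↦ l • ι z ^ l` on `U𝔥` -/
noncomputable def weightLast : U k h →ₗ[k] U k h :=
  conv LinearMap.id ((ι : h →ₗ⁅k⁆ U k h).toLinearMap ∘ₗ coord hm ∘ₗ (mapU h.incl).toLinearMap)

theorem weightLast_ι_pow (z : h) (l : ℕ) : weightLast hm (ι z ^ l) = (l : k) • ι z ^ l := by
  have h1 : ∀ j, coord hm (mapU h.incl (ι z ^ j)) = if j = 1 then z else 0 := by
    intro j
    have := coord_mul_powers hm m.zero_mem z 0 j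
    rw [pow_zero, one_mul] at this
    rw [map_pow, mapU_ι]
    refine this.trans ?_
    simp
  rw [weightLast, conv_ι_pow]
  rcases l with _ | l
  · simp only [LinearMap.comp_apply, AlgHom.toLinearMap_apply, h1]
    simp
  · rw [Finset.sum_eq_single l]
    · simp only [LinearMap.comp_apply, AlgHom.toLinearMap_apply, h1]
      rw [if_pos (by omega), Nat.choose_succ_self_right, pow_succ]
      rfl
    · intro i hi hil
      rw [Finset.mem_range] at hi
      simp only [LinearMap.comp_apply, AlgHom.toLinearMap_apply, h1]
      rw [if_neg (by omega)]
      simp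
    · intro hl
      exact absurd (Finset.mem_range.2 (by omega)) hl

/-- The operator on `(U𝔤)^{⊗ n} ⊗ U𝔥` that counts the factors in `h` in the coordinates
`ι y ^ n * ι z ^ l` -/
noncomputable def totalWeight (n : ℕ) : A h n →ₗ[k] A h n :=
  ∑ j ∈ Finset.range (n + 1), slotWeight (coord hm) n j

theorem totalWeight_apply (n : ℕ) (X : A h n) :
    totalWeight hm n X = ∑ j ∈ Finset.range (n + 1), slotWeight (coord hm) n j X := by
  simp [totalWeight]

theorem totalWeight_tmul {n : ℕ} {u : Fin n → U k g} {c : Fin n → ℕ}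
    (hu : ∀ s, weight hm (u s) = (c s : k) • u s) (w : U k h) :
    totalWeight hm n (PiTensorProduct.tprod k u ⊗ₜ[k] w) =
      ((∑ s, c s : ℕ) : k) • (PiTensorProduct.tprod k u ⊗ₜ[k] w) +
        PiTensorProduct.tprod k u ⊗ₜ[k] weightLast hm w := by
  rw [totalWeight_apply, Finset.sum_range_succ, slotWeight_last, Finset.sum_range, Nat.cast_sum,
    Finset.sum_smul]
  congr 1
  refine Finset.sum_congr rfl fun j _ => ?_
  rw [slotWeight_tprod]
  change PiTensorProduct.tprod k (Function.update u j (weight hm (u j))) ⊗ₜ[k] w = _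
  rw [hu, MultilinearMap.map_update_smul, Function.update_eq_self, TensorProduct.smul_tmul']

/-- The elements `ι y ^ n * ι z ^ l` -/
def monomials (h : LieSubalgebra k g) (m : Submodule k g) : Set (U k g) :=
  {u | ∃ y ∈ m, ∃ z ∈ h, ∃ n l, u = ι y ^ n * ι z ^ l}

theorem exists_weight {u : U k g} (hu : u ∈ monomials h m) :
    ∃ c : ℕ, weight hm u = (c : k) • u ∧ (coord hm u = 0 ∨ c = 1) ∧ (u ∈ Um m ∧ c = 0 ∨
      u ∈ Ugh h ∧ c ≠ 0) := by
  obtain ⟨y, hy, z, hz, n, l, rfl⟩ := hu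
  refine ⟨l, weight_mul_powers hm hy hz n l, ?_, ?_⟩
  · have h1 := coord_mul_powers hm hy ⟨z, hz⟩ n l
    by_cases hl : l = 1
    · exact Or.inr hl
    · rw [if_neg fun h => hl h.2] at h1
      exact Or.inl h1
  · rcases l with _ | l
    · left
      rw [pow_zero, mul_one, Um_eq_span]
      exact ⟨Submodule.subset_span ⟨y, hy, n, rfl⟩, rfl⟩
    · right
      rw [Ugh_eq_span hm]
      exact ⟨Submodule.subset_span ⟨y, hy, z, hz, n, l, rfl⟩, Nat.succ_ne_zero l⟩

include hm in
theorem mem_of_forall_monomial {n : ℕ} {Q : Submodule k (A h n)}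
    (hQ : ∀ u : Fin n → U k g, (∀ s, u s ∈ monomials h m) → ∀ (z : h) (l : ℕ),
      PiTensorProduct.tprod k u ⊗ₜ[k] (ι z ^ l) ∈ Q) (X : A h n) : X ∈ Q :=
  mem_of_forall_tprod_tmul (span_mul_powers h m hm) span_powers
    (fun u hu w hw => by
      obtain ⟨z, l, rfl⟩ := hw
      exact hQ u hu z l) X

theorem totalWeight_monomial {n : ℕ} {u : Fin n → U k g} {c : Fin n → ℕ}
    (hu : ∀ s, weight hm (u s) = (c s : k) • u s) (z : h) (l : ℕ) :
    totalWeight hm n (PiTensorProduct.tprod k u ⊗ₜ[k] (ι z ^ l)) =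
      ((∑ s, c s + l : ℕ) : k) • (PiTensorProduct.tprod k u ⊗ₜ[k] (ι z ^ l)) := by
  rw [totalWeight_tmul hm hu, weightLast_ι_pow, TensorProduct.tmul_smul, ← add_smul, Nat.cast_add]

theorem iSup_eigenspace_totalWeight (n : ℕ) :
    ⨆ N : ℕ, Module.End.eigenspace (totalWeight hm n) (N : k) = ⊤ := by
  rw [eq_top_iff]
  rintro X -
  refine mem_of_forall_monomial hm (fun u hu z l => ?_) X
  choose c hc _ using fun s => exists_weight hm (hu s)
  exact Submodule.mem_iSup_of_mem _
    (Module.End.mem_eigenspace_iff.2 (totalWeight_monomial hm hc z l))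

theorem exists_functionOfWeight (n : ℕ) (r : ℕ → k) :
    ∃ Φ : A h n →ₗ[k] A h n, ∀ (N : ℕ) X, totalWeight hm n X = (N : k) • X → Φ X = r N • X :=
  exists_linearMap_of_eigenspaces (totalWeight hm n) Nat.cast_injective
    (iSup_eigenspace_totalWeight hm n) fun N => r N • LinearMap.id

/-- The operator with the value `r N` on the vectors of weight `N` -/
noncomputable def functionOfWeight (n : ℕ) (r : ℕ → k) : A h n →ₗ[k] A h n :=
  (exists_functionOfWeight hm n r).choose

theorem functionOfWeight_apply {n : ℕ} (r : ℕ → k) {N : ℕ} {X : A h n}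
    (hX : totalWeight hm n X = (N : k) • X) : functionOfWeight hm n r X = r N • X :=
  (exists_functionOfWeight hm n r).choose_spec N X hX

theorem functionOfWeight_mem {n : ℕ} (r : ℕ → k) {S : Submodule k (A h n)}
    (hS : ∀ X ∈ S, totalWeight hm n X ∈ S) {X : A h n} (hX : X ∈ S) :
    functionOfWeight hm n r X ∈ S := by
  obtain ⟨F, v, hv, hvS, rfl⟩ := exists_sum_eigenvectors_of_mem Nat.cast_injective
    (iSup_eigenspace_totalWeight hm n) hS hX
  rw [map_sum]
  refine Submodule.sum_mem _ fun N hN => ?_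
  rw [functionOfWeight_apply hm r (hv N)]
  exact S.smul_mem _ (hvS N hN)

/-- Since `b` is only shown to commute with W on invariants, the decomposition into eigenvectors
must stay inside the stable subspace `S`. -/
theorem functionOfWeight_comm {n n' : ℕ} (r : ℕ → k) {S : Submodule k (A h n)}
    (hS : ∀ X ∈ S, totalWeight hm n X ∈ S) (d : A h n →ₗ[k] A h n')
    (hd : ∀ X ∈ S, d (totalWeight hm n X) = totalWeight hm n' (d X)) {X : A h n} (hX : X ∈ S) :
    d (functionOfWeight hm n r X) = functionOfWeight hm n' r (d X) := by
  obtain ⟨F, v, hv, hvS, rfl⟩ := exists_sum_eigenvectors_of_mem Nat.cast_injective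
    (iSup_eigenspace_totalWeight hm n) hS hX
  simp only [map_sum]
  refine Finset.sum_congr rfl fun N hN => ?_
  rw [functionOfWeight_apply hm r (hv N), map_smul, functionOfWeight_apply hm r (N := N)]
  rw [← hd _ (hvS N hN), hv, map_smul]

/-- The inverse of the weight on the vectors of positive weight -/
noncomputable def weightInv (n : ℕ) : A h n →ₗ[k] A h n := functionOfWeight hm n fun N => (N : k)⁻¹

/-- The projection on the vectors of weight zero -/
noncomputable def weightProj (n : ℕ) : A h n →ₗ[k] A h n :=
  functionOfWeight hm n fun N => if N = 0 then 1 else 0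

theorem linearMap_ext_eigen {n : ℕ} {V : Type*} [AddCommGroup V] [Module k V]
    {φ ψ : A h n →ₗ[k] V} (hφ : ∀ (N : ℕ) X, totalWeight hm n X = (N : k) • X → φ X = ψ X)
    (X : A h n) : φ X = ψ X := by
  obtain ⟨F, v, hv, rfl⟩ := exists_sum_eigenvectors (iSup_eigenspace_totalWeight hm n) X
  rw [map_sum, map_sum]
  exact Finset.sum_congr rfl fun N _ => hφ N _ (hv N)

/-- On weight 0 both sides vanish; there `weightInv` is zero by the convention `0⁻¹ = 0`. -/
theorem weightInv_totalWeight {n : ℕ} (X : A h n) :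
    weightInv hm n (totalWeight hm n X) = X - weightProj hm n X := by
  refine linearMap_ext_eigen hm (φ := weightInv hm n ∘ₗ totalWeight hm n)
    (ψ := LinearMap.id - weightProj hm n) (fun N X hX => ?_) X
  rw [LinearMap.comp_apply, hX, map_smul, weightInv, functionOfWeight_apply hm _ hX,
    LinearMap.sub_apply, weightProj, functionOfWeight_apply hm _ hX, LinearMap.id_apply, smul_smul]
  split_ifs with hN
  · subst hN
    simp
  · rw [mul_inv_cancel₀ (Nat.cast_ne_zero.2 hN)]
    simp

theorem weightProj_weightInv {n : ℕ} (X : A h n) : weightProj hm n (weightInv hm n X) = 0 := by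
  refine linearMap_ext_eigen hm (φ := weightProj hm n ∘ₗ weightInv hm n)
    (ψ := 0) (fun N X hX => ?_) X
  rw [LinearMap.comp_apply, weightInv, functionOfWeight_apply hm _ hX, map_smul, weightProj,
    functionOfWeight_apply hm _ hX, LinearMap.zero_apply, smul_smul]
  split_ifs with hN
  · subst hN
    simp
  · simp

theorem weightProj_weightProj {n : ℕ} (X : A h n) :
    weightProj hm n (weightProj hm n X) = weightProj hm n X := by
  refine linearMap_ext_eigen hm (φ := weightProj hm n ∘ₗ weightProj hm n)
    (ψ := weightProj hm n) (fun N X hX => ?_) X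
  rw [LinearMap.comp_apply, weightProj, functionOfWeight_apply hm _ hX, map_smul,
    functionOfWeight_apply hm _ hX, smul_smul]
  split_ifs <;> simp

variable (hmm : ∀ x ∈ h, ∀ y ∈ m, ⁅x, y⁆ ∈ m)

include hmm in
theorem totalWeight_mem {n : ℕ} {X : A h n} (hX : X ∈ g2 h n) : totalWeight hm n X ∈ g2 h n := by
  rw [totalWeight_apply]
  exact Submodule.sum_mem _ fun j _ => slotWeight_mem (coord_commutator hm hmm) j hX

include hmm in
-- Both sides equal -bCb, by W = -(bC + Cb) and bb = 0. Invariance of CX is needed, as bb = 0 is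
-- available on invariants only.
theorem b_totalWeight {n : ℕ} {X : A h n} (hX : X ∈ g2 h n) :
    b h n (totalWeight hm n X) = totalWeight hm (n + 1) (b h n X) := by
  have hb := fun n X => (isDGLA_g2 (h := h)).d_d n X
  have h1 : totalWeight hm (n + 1) (b h n X) = -b h n (contraction (coord hm) n (b h n X)) := by
    rw [totalWeight_apply, ← neg_neg (∑ j ∈ _, _), ← b_contraction_add _ (coord_one hm), hb n X hX,
      map_zero, add_zero]
  rw [h1, ← map_neg]
  rcases n with _ | n
  · rw [contraction_b_zero _ (coord_one hm), neg_neg, ← totalWeight_apply]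
  · have h2 := b_contraction_add _ (coord_one hm) n X
    rw [← totalWeight_apply, ← neg_eq_iff_eq_neg] at h2
    rw [← h2, neg_add, map_add, map_neg,
      hb n _ (contraction_mem (coord_commutator hm hmm) hX), neg_zero, zero_add]

end TotalWeight

/-! ### Contractions and the filtration by the last factor -/

section Filtration

attribute [local instance 100] LieRing.ofAssociativeRing

variable {k : Type*} [Field k] {g : Type*} [LieRing g] [LieAlgebra k g] {h : LieSubalgebra k g}

local notation "ι" => UniversalEnvelopingAlgebra.ι k

variable (h) in
/-- The elements with last factor in the term `i` of the standard filtration of `U𝔥` -/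
noncomputable def filt (i n : ℕ) : Submodule k (A h n) :=
  LinearMap.range (LinearMap.lTensor (T k g n) (stdFilt k h i).subtype)

theorem tmul_mem_filt {i n : ℕ} (t : T k g n) {w : U k h} (hw : w ∈ stdFilt k h i) :
    t ⊗ₜ[k] w ∈ filt h i n :=
  ⟨t ⊗ₜ ⟨w, hw⟩, by rw [LinearMap.lTensor_tmul]; rfl⟩

theorem filt_le {i n : ℕ} {Q : Submodule k (A h n)}
    (hQ : ∀ t, ∀ w ∈ stdFilt k h i, t ⊗ₜ[k] w ∈ Q) : filt h i n ≤ Q := by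
  rintro _ ⟨X, rfl⟩
  induction X using TensorProduct.induction_on with
  | zero => rw [map_zero]; exact Q.zero_mem
  | tmul t w => exact hQ t w w.2
  | add X Y hX hY => rw [map_add]; exact Q.add_mem hX hY

theorem filt_le_of_tprod {i n : ℕ} {Q : Submodule k (A h n)}
    (hQ : ∀ u : Fin n → U k g, ∀ w ∈ stdFilt k h i, PiTensorProduct.tprod k u ⊗ₜ[k] w ∈ Q) :
    filt h i n ≤ Q :=
  filt_le fun t w hw => by
    induction t using PiTensorProduct.induction_on with
    | smul_tprod r u =>
      rw [← TensorProduct.smul_tmul']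
      exact Q.smul_mem r (hQ u w hw)
    | add x y hx hy =>
      rw [TensorProduct.add_tmul]
      exact Q.add_mem hx hy

theorem filt_mono {i j n : ℕ} (hij : i ≤ j) : filt h i n ≤ filt h j n :=
  filt_le fun _ _ hw => tmul_mem_filt _ (stdFilt_mono hij hw)

theorem mul_mem_filt {i j l n : ℕ} (hl : i + j = l) {X Y : A h n} (hX : X ∈ filt h i n)
    (hY : Y ∈ filt h j n) : X * Y ∈ filt h l n := by
  have h1 : ∀ t, ∀ w ∈ stdFilt k h i, ∀ Y ∈ filt h j n, (t ⊗ₜ[k] w : A h n) * Y ∈ filt h l n := by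
    intro t w hw Y hY
    have h2 : filt h j n ≤ (filt h l n).comap (LinearMap.mulLeft k (t ⊗ₜ[k] w : A h n)) := by
      refine filt_le fun t' w' hw' => ?_
      rw [Submodule.mem_comap, LinearMap.mulLeft_apply, Algebra.TensorProduct.tmul_mul_tmul]
      exact tmul_mem_filt _ (mul_mem_stdFilt hl hw hw')
    exact h2 hY
  have h3 : filt h i n ≤ (filt h l n).comap (LinearMap.mulRight k Y) :=
    filt_le fun t w hw => h1 t w hw Y hY
  exact h3 hX

theorem tmul_one_mem_filt {n : ℕ} (t : T k g n) : t ⊗ₜ[k] (1 : U k h) ∈ filt h 0 n :=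
  tmul_mem_filt t (one_mem_stdFilt 0)

theorem slot_mem_filt {n : ℕ} (s : Fin n) (x : g) : slot h s x ∈ filt h 0 n :=
  tmul_one_mem_filt _

theorem last_mem_filt {n : ℕ} (z : h) : last h n z ∈ filt h 1 n :=
  tmul_mem_filt _ (ι_mem_stdFilt z)

theorem one_mem_filt {i n : ℕ} : (1 : A h n) ∈ filt h i n :=
  tmul_mem_filt 1 (one_mem_stdFilt i)

theorem copLast_mem_filt {n i : ℕ} (J : Finset (Fin n)) {w : U k h} (hw : w ∈ stdFilt k h i) :
    copLast h J w ∈ filt h i n := by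
  have h1 : ∀ z : h, copLast h J (ι z) ∈ filt h 1 n := fun z => by
    rw [copLast_ι]
    exact add_mem (Submodule.sum_mem _ fun s _ => filt_mono zero_le_one (slot_mem_filt s _))
      (last_mem_filt z)
  induction i generalizing w with
  | zero =>
    rw [stdFilt_zero] at hw
    obtain ⟨r, rfl⟩ := Submodule.mem_one.1 hw
    rw [Algebra.algebraMap_eq_smul_one, map_smul, map_one]
    exact Submodule.smul_mem _ _ one_mem_filt
  | succ i ih =>
    have h2 : stdFilt k h (i + 1) ≤ (filt h (i + 1) n).comap (copLast h J).toLinearMap := by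
      refine stdFilt_succ_induction (fun w hw => filt_mono (Nat.le_succ i) (ih hw)) fun y u hu => ?_
      rw [Submodule.mem_comap, AlgHom.toLinearMap_apply, map_mul]
      exact mul_mem_filt (add_comm 1 i) (h1 y) (ih hu)
    exact h2 hw

theorem ins_mem_filt {f : ℕ → ℕ} {p n i : ℕ} {X : A h p} (hX : X ∈ filt h i p) :
    ins h f p n X ∈ filt h i n := by
  have h1 : filt h i p ≤ (filt h i n).comap (ins h f p n).toLinearMap := by
    refine filt_le_of_tprod fun u w hw => ?_
    rw [Submodule.mem_comap, AlgHom.toLinearMap_apply, tprod_tmul_eq_prod, map_mul, ins_lastU]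
    refine mul_mem_filt (zero_add i) ?_ (copLast_mem_filt _ hw)
    rw [map_list_prod, List.map_ofFn]
    have : ∀ l : List (A h n), (∀ x ∈ l, x ∈ filt h 0 n) → l.prod ∈ filt h 0 n := by
      intro l hl
      induction l with
      | nil => exact one_mem_filt
      | cons a l ih =>
        rw [List.prod_cons]
        exact mul_mem_filt (zero_add 0) (hl a List.mem_cons_self)
          (ih fun x hx => hl x (List.mem_cons_of_mem a hx))
    refine this _ fun x hx => ?_
    obtain ⟨s, rfl⟩ := (List.mem_ofFn' _ _).1 hx
    rw [Function.comp_apply, ins_slotU]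
    exact tmul_one_mem_filt _
  exact h1 hX

theorem b_mem_filt {n i : ℕ} {X : A h n} (hX : X ∈ filt h i n) : b h n X ∈ filt h i (n + 1) := by
  rw [b_apply]
  exact Submodule.sum_mem _ fun j _ => Submodule.smul_mem _ _ (ins_mem_filt hX)

theorem splitHead_tprod {n : ℕ} (u : Fin (n + 1) → U k g) (w : U k h) :
    splitHead h n (PiTensorProduct.tprod k u ⊗ₜ[k] w) =
      inA h n (PiTensorProduct.tprod k (fun s => u s.succ) ⊗ₜ[k] w) * inU h n (u 0) := by
  have h1 : (⇑(splitHead h n) ∘ fun s : Fin n => slotU h s.succ (u s.succ)) =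
      ⇑(inA h n) ∘ fun s => slotU h s (u s.succ) :=
    funext fun s => splitHead_slotU_succ s _
  rw [tprod_tmul_eq_prod, List.ofFn_succ, List.prod_cons, map_mul, map_mul, splitHead_slotU_zero,
    splitHead_lastU, map_list_prod, List.map_ofFn, h1, ← List.map_ofFn, ← map_list_prod, mul_assoc,
    ← map_mul, ← tprod_tmul_eq_prod fun s => u s.succ]
  exact (TensorAlg.commute _ _).symm

theorem ins_tprod_perm {N : ℕ} {f : ℕ → ℕ} (σ : Equiv.Perm (Fin N)) (hf : ∀ t : Fin N, f t = σ t)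
    (u : Fin N → U k g) (w : U k h) :
    ins h f N N (PiTensorProduct.tprod k u ⊗ₜ[k] w) =
      PiTensorProduct.tprod k (u ∘ σ) ⊗ₜ[k] w := by
  classical
  have hlast : ins h f N N (lastU h N w) = lastU h N w := by
    have h1 : (ins h f N N).comp (lastU h N) = lastU h N := by
      apply U_algHom_ext
      intro z
      have h2 : fib f N N = ∅ := by
        ext t
        have := (σ t).2
        rw [mem_fib, hf]
        simp
        omega
      have h3 := ins_last (h := h) f N N z
      rw [h2, Finset.sum_empty, zero_add] at h3
      exact h3
    exact DFunLike.congr_fun h1 w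
  have hslot : ∀ (s : Fin N) (a : U k g), ins h f N N (slotU h s a) = slotU h (σ.symm s) a := by
    intro s a
    have h1 : (ins h f N N).comp (slotU h s) = slotU h (σ.symm s) := by
      apply U_algHom_ext
      intro x
      have h2 : fib f N s = {σ.symm s} := by
        ext t
        rw [mem_fib, hf, Finset.mem_singleton, Equiv.eq_symm_apply, Fin.ext_iff]
      have h3 := ins_slot (h := h) f N N s x
      rw [h2, Finset.sum_singleton] at h3
      exact h3
    exact DFunLike.congr_fun h1 a
  let ρ : (Fin N → U k g) →* (Fin N → U k g) :=
    { toFun := fun u => u ∘ σ, map_one' := rfl, map_mul' := fun _ _ => rfl }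
  have key : (((ins h f N N).comp (Algebra.TensorProduct.includeLeft : T k g N →ₐ[k] A h N)) :
        T k g N →* A h N).comp (PiTensorProduct.tprodMonoidHom k) =
      (((Algebra.TensorProduct.includeLeft : T k g N →ₐ[k] A h N)) :
        T k g N →* A h N).comp ((PiTensorProduct.tprodMonoidHom k).comp ρ) := by
    apply MonoidHom.pi_ext
    intro s a
    have h1 := hslot s a
    have h2 : ρ (Pi.mulSingle s a) = Pi.mulSingle (σ.symm s) a := Pi.mulSingle_comp_equiv σ s a
    rw [MonoidHom.comp_apply, MonoidHom.comp_apply, MonoidHom.comp_apply, h2]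
    exact h1
  have h4 : ∀ u : Fin N → U k g, (PiTensorProduct.tprod k u ⊗ₜ[k] w : A h N) =
      (Algebra.TensorProduct.includeLeft : T k g N →ₐ[k] A h N) (PiTensorProduct.tprod k u) *
        lastU h N w := by
    intro u
    change _ = (PiTensorProduct.tprod k u ⊗ₜ[k] (1 : U k h)) * ((1 : T k g N) ⊗ₜ[k] w)
    rw [Algebra.TensorProduct.tmul_mul_tmul, one_mul, mul_one]
  rw [h4, map_mul, hlast, h4]
  congr 1
  exact DFunLike.congr_fun key u

variable (θ : U k g →ₗ[k] h)

theorem absorb_splitHead_tprod {n : ℕ} (J : Finset (Fin n)) (u : Fin (n + 1) → U k g) (w : U k h) :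
    absorb θ J (splitHead h n (PiTensorProduct.tprod k u ⊗ₜ[k] w)) =
      (PiTensorProduct.tprod k (fun s => u s.succ) ⊗ₜ[k] w) * copLast h J (ι (θ (u 0))) := by
  rw [splitHead_tprod, absorb_apply]

theorem absorb_splitHead_mem_filt {n i : ℕ} (J : Finset (Fin n)) {X : A h (n + 1)}
    (hX : X ∈ filt h i (n + 1)) : absorb θ J (splitHead h n X) ∈ filt h (i + 1) n := by
  have h1 : filt h i (n + 1) ≤ (filt h (i + 1) n).comap
      (absorb θ J ∘ₗ (splitHead h n).toLinearMap) := by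
    refine filt_le_of_tprod fun u w hw => ?_
    rw [Submodule.mem_comap, LinearMap.comp_apply, AlgHom.toLinearMap_apply,
      absorb_splitHead_tprod]
    exact mul_mem_filt rfl (tmul_mem_filt _ hw) (copLast_mem_filt J (ι_mem_stdFilt _))
  exact h1 hX

/-- The coproduct terms with values in `J` do not touch the last factor. -/
theorem absorb_sub_absorb_mem_filt {n i : ℕ} (J : Finset (Fin n)) {X : A h (n + 1)}
    (hX : X ∈ filt h i (n + 1)) :
    absorb θ J (splitHead h n X) - absorb θ ∅ (splitHead h n X) ∈ filt h i n := by
  have h1 : filt h i (n + 1) ≤ (filt h i n).comap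
      ((absorb θ J - absorb θ ∅) ∘ₗ (splitHead h n).toLinearMap) := by
    refine filt_le_of_tprod fun u w hw => ?_
    rw [Submodule.mem_comap, LinearMap.comp_apply, AlgHom.toLinearMap_apply, LinearMap.sub_apply,
      absorb_splitHead_tprod, absorb_splitHead_tprod, ← mul_sub, copLast_ι, copLast_ι,
      Finset.sum_empty, zero_add, add_sub_cancel_right]
    exact mul_mem_filt (add_zero i) (tmul_mem_filt _ hw)
      (Submodule.sum_mem _ fun s _ => slot_mem_filt s _)
  exact h1 hX

/-- The factor `j` is mapped to `h` by `θ` and absorbed into the last factor. -/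
noncomputable def contractLast (n j : ℕ) : A h (n + 1) →ₗ[k] A h n :=
  absorb θ ∅ ∘ₗ (splitHead h n).toLinearMap ∘ₗ (ins h (cycF j) (n + 1) (n + 1)).toLinearMap

theorem contractLast_apply (n j : ℕ) (X : A h (n + 1)) : contractLast θ n j X =
    absorb θ ∅ (splitHead h n (ins h (cycF j) (n + 1) (n + 1) X)) := rfl

/-- The alternating sum of the contractions with the last factor -/
noncomputable def contractionLast (n : ℕ) : A h (n + 1) →ₗ[k] A h n :=
  ∑ j ∈ Finset.range (n + 1), (-1 : k) ^ j • contractLast θ n j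

theorem contractionLast_apply (n : ℕ) (X : A h (n + 1)) : contractionLast θ n X =
    ∑ j ∈ Finset.range (n + 1), (-1 : k) ^ j • contractLast θ n j X := by
  simp [contractionLast]

theorem contraction_mem_filt {n i : ℕ} {X : A h (n + 1)} (hX : X ∈ filt h i (n + 1)) :
    contraction θ n X ∈ filt h (i + 1) n := by
  rw [contraction_apply]
  exact Submodule.sum_mem _ fun j _ =>
    Submodule.smul_mem _ _ (absorb_splitHead_mem_filt θ _ (ins_mem_filt hX))

theorem contraction_sub_mem_filt {n i : ℕ} {X : A h (n + 1)} (hX : X ∈ filt h i (n + 1)) :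
    contraction θ n X - contractionLast θ n X ∈ filt h i n := by
  rw [contraction_apply, contractionLast_apply, ← Finset.sum_sub_distrib]
  refine Submodule.sum_mem _ fun j _ => ?_
  have h1 := (filt h i n).smul_mem ((-1 : k) ^ j) (absorb_sub_absorb_mem_filt θ (fromOn n j)
    (ins_mem_filt (f := cycF j) hX))
  rwa [smul_sub] at h1

/-- The first two factors are exchanged. -/
def swapF : ℕ → ℕ
  | 0 => 1
  | 1 => 0
  | s + 2 => s + 2

/-- Two elements of 𝔥 are multiplied into the last factor in opposite orders; the difference is a
commutator in 𝔥, of degree 1 instead of 2. -/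
theorem absorb_absorb_swap_mem_filt {n i : ℕ} {X : A h (n + 2)} (hX : X ∈ filt h i (n + 2)) :
    absorb θ ∅ (splitHead h n (absorb θ ∅ (splitHead h (n + 1) X))) -
      absorb θ ∅ (splitHead h n (absorb θ ∅ (splitHead h (n + 1)
        (ins h swapF (n + 2) (n + 2) X)))) ∈ filt h (i + 1) n := by
  have h0 : ∀ (u : Fin (n + 2) → U k g) (w : U k h), absorb θ ∅ (splitHead h n (absorb θ ∅
      (splitHead h (n + 1) (PiTensorProduct.tprod k u ⊗ₜ[k] w)))) =
      PiTensorProduct.tprod k (fun s => u s.succ.succ) ⊗ₜ[k] (w * ι (θ (u 0)) * ι (θ (u 1))) := by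
    intro u w
    have hl : ∀ {N : ℕ} (t : T k g N) (w : U k h) (z : h),
        (t ⊗ₜ[k] w) * copLast h ∅ (ι z) = t ⊗ₜ[k] (w * ι z) := fun t w z => by
      rw [copLast_ι, Finset.sum_empty, zero_add]
      change (t ⊗ₜ[k] w) * (1 ⊗ₜ[k] ι z) = _
      rw [Algebra.TensorProduct.tmul_mul_tmul, mul_one]
    rw [absorb_splitHead_tprod, hl, absorb_splitHead_tprod, hl]
    rfl
  have h1 : filt h i (n + 2) ≤ (filt h (i + 1) n).comap
      (absorb θ ∅ ∘ₗ (splitHead h n).toLinearMap ∘ₗ absorb θ ∅ ∘ₗ (splitHead h (n + 1)).toLinearMap ∘ₗ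
        (LinearMap.id - (ins h swapF (n + 2) (n + 2)).toLinearMap)) := by
    refine filt_le_of_tprod fun u w hw => ?_
    rw [Submodule.mem_comap]
    simp only [LinearMap.comp_apply, LinearMap.sub_apply, map_sub, AlgHom.toLinearMap_apply,
      LinearMap.id_apply]
    rw [ins_tprod_perm (Equiv.swap 0 1), h0, h0]
    · have h2 : ∀ s : Fin n, (Equiv.swap (0 : Fin (n + 2)) 1) s.succ.succ = s.succ.succ := fun s =>
        Equiv.swap_apply_of_ne_of_ne (Fin.succ_ne_zero _) (fun e => by
          have := congrArg Fin.val e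
          simp at this)
      simp only [Function.comp_apply, h2, Equiv.swap_apply_left, Equiv.swap_apply_right]
      rw [← TensorProduct.tmul_sub, mul_assoc, mul_assoc, ← mul_sub, ι_mul_sub_mul_ι]
      exact tmul_mem_filt _ (mul_mem_stdFilt rfl hw (ι_mem_stdFilt _))
    · intro t
      induction t using Fin.cases with
      | zero => simp [swapF]
      | succ t =>
        induction t using Fin.cases with
        | zero => simp [swapF]
        | succ t =>
          rw [Equiv.swap_apply_of_ne_of_ne (Fin.succ_ne_zero _) (fun e => by
            have := congrArg Fin.val e
            simp at this)]
          rfl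
  have h3 := h1 hX
  rw [Submodule.mem_comap] at h3
  simpa only [LinearMap.comp_apply, LinearMap.sub_apply, map_sub, AlgHom.toLinearMap_apply,
      LinearMap.id_apply] using h3

theorem contractLast_contractLast {n j j' : ℕ} (hj : j ≤ n) (hj' : j' ≤ n + 1) (X : A h (n + 2)) :
    contractLast θ n j (contractLast θ (n + 1) j' X) = absorb θ ∅ (splitHead h n
      (absorb θ ∅ (splitHead h (n + 1)
        (ins h (fun t => cycF j' (consF (cycF j) t)) (n + 2) (n + 2) X)))) := by
  rw [contractLast_apply, contractLast_apply, ins_absorb (J' := ∅), map_ins_splitHead, ins_comp]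
  · grind [cycF]
  · intro t ht
    rcases t with _ | _ | t <;> grind [cycF, consF]
  · intro t
    have := t.2
    generalize (t : ℕ) = t at *
    rcases t with _ | t <;> simp [cycF] <;> grind

/-- Each pair of contracted factors occurs twice, as `(j, i)` and as `(i, j + 1)` with `i ≤ j`, and
with opposite signs. -/
theorem sum_alternating_pairs {M : Type*} [AddCommGroup M] [Module k M] (F : ℕ → ℕ → M) (n : ℕ) :
    ∑ j ∈ Finset.range (n + 1), (-1 : k) ^ j • ∑ i ∈ Finset.range (n + 2), (-1 : k) ^ i • F j i =
      ∑ j ∈ Finset.range (n + 1), ∑ i ∈ Finset.range (j + 1),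
        (-1 : k) ^ (i + j) • (F j i - F i (j + 1)) := by
  have h1 : ∀ j ∈ Finset.range (n + 1),
      (-1 : k) ^ j • ∑ i ∈ Finset.range (n + 2), (-1 : k) ^ i • F j i =
      ∑ i ∈ Finset.range (j + 1), (-1 : k) ^ (i + j) • F j i +
        ∑ i ∈ Finset.Ico j (n + 1), (-1 : k) ^ (i + 1 + j) • F j (i + 1) := by
    intro j hj
    rw [Finset.mem_range] at hj
    rw [← Finset.sum_range_add_sum_Ico _ (show j + 1 ≤ n + 2 by omega), smul_add, Finset.smul_sum,
      Finset.smul_sum, ← Finset.sum_Ico_add' _ j (n + 1) 1]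
    simp only [smul_smul, ← pow_add, add_comm j]
  rw [Finset.sum_congr rfl h1, Finset.sum_add_distrib,
    Finset.sum_comm' (s := Finset.range (n + 1)) (t := fun j => Finset.Ico j (n + 1))
      (t' := Finset.range (n + 1)) (s' := fun i => Finset.range (i + 1)), ← Finset.sum_add_distrib]
  · refine Finset.sum_congr rfl fun j _ => ?_
    rw [← Finset.sum_add_distrib]
    refine Finset.sum_congr rfl fun i _ => ?_
    rw [show j + 1 + i = (i + j) + 1 by ring, pow_succ]
    module
  · intro x y
    simp only [Finset.mem_range, Finset.mem_Ico]
    omega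

theorem contractionLast_contractionLast_mem_filt {n i : ℕ} {X : A h (n + 2)}
    (hX : X ∈ filt h i (n + 2)) :
    contractionLast θ n (contractionLast θ (n + 1) X) ∈ filt h (i + 1) n := by
  rw [contractionLast_apply, contractionLast_apply]
  simp only [map_sum, map_smul]
  rw [sum_alternating_pairs fun j i => contractLast θ n j (contractLast θ (n + 1) i X)]
  refine Submodule.sum_mem _ fun j hj => Submodule.sum_mem _ fun i hi => Submodule.smul_mem _ _ ?_
  rw [Finset.mem_range] at hi hj
  rw [contractLast_contractLast θ (by omega) (by omega),
    contractLast_contractLast θ (by omega) (by omega)]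
  -- Once the two contracted factors are moved to the front, the two orders of contraction differ by
  -- exchanging them.
  have h1 : ins h (fun t => cycF (j + 1) (consF (cycF i) t)) (n + 2) (n + 2) X =
      ins h swapF (n + 2) (n + 2)
        (ins h (fun t => cycF i (consF (cycF j) t)) (n + 2) (n + 2) X) := by
    rw [ins_comp, ins_congr]
    · intro t ht
      rcases t with _ | _ | t <;> grind [cycF, consF, swapF]
    · grind [cycF, consF]
    · intro t ht
      rcases t with _ | _ | t <;> grind [cycF, consF, swapF]
  rw [h1]
  exact absorb_absorb_swap_mem_filt θ (ins_mem_filt hX)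

end Filtration

/-! ### The homotopy H, its normalization κ and the filtration estimate -/

section Homotopy

attribute [local instance 100] LieRing.ofAssociativeRing

variable {k : Type*} [Field k] [CharZero k] {g : Type*} [LieRing g] [LieAlgebra k g]
  {h : LieSubalgebra k g} {m : Submodule k g} (hm : IsCompl h.toSubmodule m)

local notation "ι" => UniversalEnvelopingAlgebra.ι k

theorem weightLast_sub_mem {i : ℕ} {w : U k h} (hw : w ∈ stdFilt k h (i + 1)) :
    weightLast hm w - ((i + 1 : ℕ) : k) • w ∈ stdFilt k h i := by
  have h1 : powSpan k h (i + 1) ≤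
      (stdFilt k h i).comap (weightLast hm - ((i + 1 : ℕ) : k) • LinearMap.id) := by
    rw [powSpan, Submodule.span_le]
    rintro _ ⟨z, l, hl, rfl⟩
    rw [SetLike.mem_coe, Submodule.mem_comap, LinearMap.sub_apply, weightLast_ι_pow,
      LinearMap.smul_apply, LinearMap.id_apply]
    rcases Nat.lt_or_ge i l with hil | hil
    · obtain rfl : l = i + 1 := by omega
      rw [sub_self]
      exact zero_mem _
    · rw [← sub_smul]
      exact Submodule.smul_mem _ _ (stdFilt_mono hil (ι_pow_mem_stdFilt z l))
  exact h1 (stdFilt_le_powSpan _ hw)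

include hm in
theorem filt_le_of_monomial {i n : ℕ} {Q : Submodule k (A h n)}
    (hQ : ∀ u : Fin n → U k g, (∀ s, u s ∈ monomials h m) → ∀ (z : h), ∀ l ≤ i,
      PiTensorProduct.tprod k u ⊗ₜ[k] (ι z ^ l) ∈ Q) : filt h i n ≤ Q := by
  refine filt_le fun t w hw => ?_
  have h1 : powSpan k h i ≤ Q.comap (TensorProduct.mk k (T k g n) (U k h) t) := by
    rw [powSpan, Submodule.span_le]
    rintro _ ⟨z, l, hl, rfl⟩
    exact tprod_mem_of_forall (S := monomials h m)
      (Q := Q.comap ((TensorProduct.mk k (T k g n) (U k h)).flip (ι z ^ l)))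
      (span_mul_powers h m hm) (fun u hu => hQ u hu z l hl) t
  exact h1 (stdFilt_le_powSpan i hw)

theorem totalWeight_mem_filt {i n : ℕ} {X : A h n} (hX : X ∈ filt h i n) :
    totalWeight hm n X ∈ filt h i n := by
  have h1 : filt h i n ≤ (filt h i n).comap (totalWeight hm n) := by
    refine filt_le_of_monomial hm fun u hu z l hl => ?_
    choose c hc _ using fun s => exists_weight hm (hu s)
    rw [Submodule.mem_comap, totalWeight_monomial hm hc]
    exact Submodule.smul_mem _ _ (tmul_mem_filt _ (stdFilt_mono hl (ι_pow_mem_stdFilt z l)))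
  exact h1 hX

theorem functionOfWeight_mem_filt {i n : ℕ} (r : ℕ → k) {X : A h n} (hX : X ∈ filt h i n) :
    functionOfWeight hm n r X ∈ filt h i n :=
  functionOfWeight_mem hm r (fun _ => totalWeight_mem_filt hm) hX

theorem weightProj_mem_filt {n : ℕ} (X : A h n) : weightProj hm n X ∈ filt h 0 n := by
  have h1 : X ∈ (filt h 0 n).comap (weightProj hm n) := by
    refine mem_of_forall_monomial hm (fun u hu z l => ?_) X
    choose c hc _ using fun s => exists_weight hm (hu s)
    rw [Submodule.mem_comap, weightProj, functionOfWeight_apply hm _ (totalWeight_monomial hm hc z l)]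
    split_ifs with h0
    · obtain rfl : l = 0 := by omega
      exact Submodule.smul_mem _ _ (tmul_mem_filt _ (ι_pow_mem_stdFilt z 0))
    · rw [zero_smul]
      exact zero_mem _
  exact h1

/-- A factor that `coord` does not kill has weight 1, and its image in 𝔥 adds 1 to the leading
weight of the last factor. So the total weight is preserved modulo lower filtration. -/
theorem totalWeight_contractionLast_mem_filt {n : ℕ} {u : Fin (n + 1) → U k g} {c : Fin (n + 1) → ℕ}
    (hu : ∀ s, weight hm (u s) = (c s : k) • u s) (hu' : ∀ s, coord hm (u s) = 0 ∨ c s = 1)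
    (z : h) (l : ℕ) :
    totalWeight hm n (contractionLast (coord hm) n (PiTensorProduct.tprod k u ⊗ₜ[k] (ι z ^ l))) -
      ((∑ s, c s + l : ℕ) : k) •
        contractionLast (coord hm) n (PiTensorProduct.tprod k u ⊗ₜ[k] (ι z ^ l)) ∈
      filt h l n := by
  have key : ∀ (u : Fin (n + 1) → U k g) (c : Fin (n + 1) → ℕ)
      (_ : ∀ s, weight hm (u s) = (c s : k) • u s) (_ : ∀ s, coord hm (u s) = 0 ∨ c s = 1),
      totalWeight hm n (absorb (coord hm) ∅ (splitHead h n
        (PiTensorProduct.tprod k u ⊗ₜ[k] (ι z ^ l)))) - ((∑ s, c s + l : ℕ) : k) •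
        absorb (coord hm) ∅ (splitHead h n (PiTensorProduct.tprod k u ⊗ₜ[k] (ι z ^ l))) ∈
        filt h l n := by
    intro u c hu hu'
    have hl : (PiTensorProduct.tprod k (fun s : Fin n => u s.succ) ⊗ₜ[k] (ι z ^ l)) *
        copLast h ∅ (ι (coord hm (u 0))) =
        PiTensorProduct.tprod k (fun s : Fin n => u s.succ) ⊗ₜ[k]
          (ι z ^ l * ι (coord hm (u 0))) := by
      rw [copLast_ι, Finset.sum_empty, zero_add]
      change (_ ⊗ₜ[k] _) * (1 ⊗ₜ[k] ι (coord hm (u 0))) = _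
      rw [Algebra.TensorProduct.tmul_mul_tmul, mul_one]
    rw [absorb_splitHead_tprod, hl, totalWeight_tmul hm (c := fun s => c s.succ) fun s => hu s.succ]
    rcases hu' 0 with h0 | h0
    · rw [h0, map_zero, mul_zero, map_zero, TensorProduct.tmul_zero, smul_zero, smul_zero, add_zero,
        sub_zero]
      exact zero_mem _
    · rw [Fin.sum_univ_succ, h0, show 1 + ∑ s : Fin n, c s.succ + l =
        ∑ s : Fin n, c s.succ + (l + 1) by ring, Nat.cast_add _ (l + 1), add_smul,
        add_sub_add_left_eq_sub, ← TensorProduct.tmul_smul, ← TensorProduct.tmul_sub]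
      exact tmul_mem_filt _ (weightLast_sub_mem hm
        (mul_mem_stdFilt rfl (ι_pow_mem_stdFilt z l) (ι_mem_stdFilt _)))
  rw [contractionLast_apply, map_sum, Finset.smul_sum, ← Finset.sum_sub_distrib]
  refine Submodule.sum_mem _ fun j hj => ?_
  rw [Finset.mem_range] at hj
  -- `cycF j` is a permutation of the factors, which reduces the contraction `j` to the contraction
  -- of the first factor.
  have h1 : ∀ t : Fin (n + 1), cycF j t < n + 1 := by
    intro t
    have := t.2
    generalize (t : ℕ) = t at *
    rcases t with _ | t <;> grind [cycF]
  let σ₀ : Fin (n + 1) → Fin (n + 1) := fun t => ⟨cycF j t, h1 t⟩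
  have hσ : Function.Bijective σ₀ := by
    refine Finite.injective_iff_bijective.1 fun s t hst => ?_
    have h2 : cycF j s = cycF j t := congrArg Fin.val hst
    rw [Fin.ext_iff]
    generalize (s : ℕ) = s at *
    generalize (t : ℕ) = t at *
    rcases s with _ | s <;> rcases t with _ | t <;> grind [cycF]
  let σ := Equiv.ofBijective σ₀ hσ
  have h3 := key (u ∘ σ) (c ∘ σ) (fun s => hu _) (fun s => hu' _)
  rw [← ins_tprod_perm (f := cycF j) σ fun _ => rfl] at h3
  have h4 : ∑ s, (c ∘ σ) s = ∑ s, c s := Equiv.sum_comp σ c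
  rw [h4] at h3
  have h5 := (filt h l n).smul_mem ((-1 : k) ^ j) h3
  rw [smul_sub, smul_comm, ← map_smul] at h5
  exact h5

/-- The homotopy before normalization -/
noncomputable def homotopy (n : ℕ) : A h (n + 1) →ₗ[k] A h n :=
  -(weightInv hm n ∘ₗ contraction (coord hm) n ∘ₗ (LinearMap.id - weightProj hm (n + 1)))

theorem homotopy_apply (n : ℕ) (X : A h (n + 1)) : homotopy hm n X =
    -weightInv hm n (contraction (coord hm) n (X - weightProj hm (n + 1) X)) := rfl

theorem homotopy_weightProj {n : ℕ} (X : A h (n + 1)) :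
    homotopy hm n (weightProj hm (n + 1) X) = 0 := by
  rw [homotopy_apply, weightProj_weightProj, sub_self, map_zero, map_zero, neg_zero]

theorem weightProj_homotopy {n : ℕ} (X : A h (n + 1)) :
    weightProj hm n (homotopy hm n X) = 0 := by
  rw [homotopy_apply, map_neg, weightProj_weightInv, neg_zero]

theorem homotopy_mem_filt {i n : ℕ} {X : A h (n + 1)} (hX : X ∈ filt h i (n + 1)) :
    homotopy hm n X ∈ filt h (i + 1) n :=
  neg_mem (functionOfWeight_mem_filt hm _ (contraction_mem_filt _
    (sub_mem hX (functionOfWeight_mem_filt hm _ hX))))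

/-- Two contractions could raise the filtration by 2. On a monomial of weight c₀ ≠ 0 the inner W⁻¹
acts on the leading part as 1/c₀, and the double contraction with the last factor drops by one
(`contractionLast_contractionLast_mem_filt`). -/
theorem homotopy_homotopy_mem_filt {i n : ℕ} {X : A h (n + 2)} (hX : X ∈ filt h i (n + 2)) :
    homotopy hm n (homotopy hm (n + 1) X) ∈ filt h (i + 1) n := by
  have h1 : filt h i (n + 2) ≤ (filt h (i + 1) n).comap (homotopy hm n ∘ₗ homotopy hm (n + 1)) := by
    refine filt_le_of_monomial hm fun u hu z l hl => ?_
    choose c hc hc' _ using fun s => exists_weight hm (hu s)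
    -- From here on the exact exponent `l` of the monomial takes the place of the bound `i`.
    refine filt_mono (Nat.add_le_add_right hl 1) ?_
    set X := PiTensorProduct.tprod k u ⊗ₜ[k] (ι z ^ l) with hX
    have hXl : X ∈ filt h l (n + 2) := tmul_mem_filt _ (ι_pow_mem_stdFilt z l)
    have hXw := totalWeight_monomial hm hc z l
    rw [← hX] at hXw
    rw [LinearMap.comp_apply, homotopy_apply, weightProj_homotopy, sub_zero, homotopy_apply hm (n + 1),
      map_neg, map_neg, neg_neg]
    have hp := functionOfWeight_apply hm (fun N => if N = 0 then (1 : k) else 0) hXw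
    rw [weightProj, hp]
    by_cases h0 : ∑ s, c s + l = 0
    · rw [if_pos h0, one_smul, sub_self]
      simp only [map_zero]
      exact zero_mem _
    rw [if_neg h0, zero_smul, sub_zero]
    set c₀ : k := ((∑ s, c s + l : ℕ) : k) with hc₀
    have hc₀' : c₀ ≠ 0 := Nat.cast_ne_zero.2 h0
    set Y := contractionLast (coord hm) (n + 1) X with hY
    set r := totalWeight hm (n + 1) Y - c₀ • Y with hr
    have hrl : r ∈ filt h l (n + 1) := totalWeight_contractionLast_mem_filt hm hc hc' z l
    set e := -weightProj hm (n + 1) Y - weightInv hm (n + 1) r with he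
    have hel : e ∈ filt h l (n + 1) :=
      sub_mem (neg_mem (filt_mono (Nat.zero_le l) (weightProj_mem_filt hm Y)))
        (functionOfWeight_mem_filt hm _ hrl)
    -- Apply W⁻¹ to `WY = c₀ Y + r`; the correction `e` lies in the lower filtration.
    have hG : c₀ • weightInv hm (n + 1) Y = Y + e := by
      have h2 := weightInv_totalWeight hm Y
      have h3 : weightInv hm (n + 1) r =
          weightInv hm (n + 1) (totalWeight hm (n + 1) Y) - c₀ • weightInv hm (n + 1) Y := by
        rw [hr, map_sub, map_smul]
      rw [he, h3, h2]
      abel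
    have h4 : contraction (coord hm) n (weightInv hm (n + 1) Y) ∈ filt h (l + 1) n := by
      refine (Submodule.smul_mem_iff _ hc₀').1 ?_
      rw [← map_smul, hG, map_add]
      refine add_mem ?_ (contraction_mem_filt _ hel)
      have h5 : Y ∈ filt h (l + 1) (n + 1) := by
        have h6 := sub_mem (contraction_mem_filt (coord hm) hXl)
          (filt_mono (Nat.le_succ l) (contraction_sub_mem_filt (coord hm) hXl))
        rwa [sub_sub_cancel] at h6
      have h7 := add_mem (contraction_sub_mem_filt (coord hm) h5)
        (contractionLast_contractionLast_mem_filt (coord hm) hXl)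
      rwa [sub_add_cancel] at h7
    refine functionOfWeight_mem_filt hm _ ?_
    have h8 : contraction (coord hm) (n + 1) X =
        Y + (contraction (coord hm) (n + 1) X - Y) := by abel
    rw [h8, map_add, map_add]
    exact add_mem h4 (contraction_mem_filt _ (functionOfWeight_mem_filt hm _
      (contraction_sub_mem_filt (coord hm) hXl)))
  exact h1 hX

variable (hmm : ∀ x ∈ h, ∀ y ∈ m, ⁅x, y⁆ ∈ m)

include hmm

theorem functionOfWeight_mem_g2 {n : ℕ} (r : ℕ → k) {X : A h n} (hX : X ∈ g2 h n) :
    functionOfWeight hm n r X ∈ g2 h n :=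
  functionOfWeight_mem hm r (fun _ => totalWeight_mem hm hmm) hX

theorem b_functionOfWeight {n : ℕ} (r : ℕ → k) {X : A h n} (hX : X ∈ g2 h n) :
    b h n (functionOfWeight hm n r X) = functionOfWeight hm (n + 1) r (b h n X) :=
  functionOfWeight_comm hm r (fun _ => totalWeight_mem hm hmm) (b h n)
    (fun _ => b_totalWeight hm hmm) hX

theorem homotopy_mem {n : ℕ} {X : A h (n + 1)} (hX : X ∈ g2 h (n + 1)) :
    homotopy hm n X ∈ g2 h n :=
  neg_mem (functionOfWeight_mem_g2 hm hmm _ (contraction_mem (coord_commutator hm hmm)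
    (sub_mem hX (functionOfWeight_mem_g2 hm hmm _ hX))))

theorem homotopy_b_zero {X : A h 0} (hX : X ∈ g2 h 0) :
    homotopy hm 0 (b h 0 X) = X - weightProj hm 0 X := by
  rw [homotopy_apply, weightProj, ← b_functionOfWeight hm hmm _ hX, ← weightProj, ← map_sub,
    contraction_b_zero _ (coord_one hm), ← totalWeight_apply, map_neg, neg_neg,
    weightInv_totalWeight, map_sub, weightProj_weightProj, sub_self, sub_zero]

theorem b_homotopy_add {n : ℕ} {X : A h (n + 1)} (hX : X ∈ g2 h (n + 1)) :
    b h n (homotopy hm n X) + homotopy hm (n + 1) (b h (n + 1) X) =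
      X - weightProj hm (n + 1) X := by
  have hY : X - weightProj hm (n + 1) X ∈ g2 h (n + 1) :=
    sub_mem hX (functionOfWeight_mem_g2 hm hmm _ hX)
  have h1 : weightProj hm (n + 2) (b h (n + 1) X) = b h (n + 1) (weightProj hm (n + 1) X) :=
    (b_functionOfWeight hm hmm _ hX).symm
  rw [homotopy_apply, homotopy_apply hm (n + 1), h1, ← map_sub, map_neg, ← neg_add, weightInv,
    b_functionOfWeight hm hmm _ (contraction_mem (coord_commutator hm hmm) hY), ← weightInv,
    ← map_add, b_contraction_add _ (coord_one hm), ← totalWeight_apply, map_neg, neg_neg,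
    weightInv_totalWeight, map_sub, weightProj_weightProj, sub_self, sub_zero]

omit hmm in
/-- The normalized homotopy -/
noncomputable def kappa (n : ℕ) : A h (n + 1) →ₗ[k] A h n :=
  homotopy hm n ∘ₗ b h n ∘ₗ homotopy hm n

omit hmm in
theorem kappa_apply (n : ℕ) (X : A h (n + 1)) :
    kappa hm n X = homotopy hm n (b h n (homotopy hm n X)) := rfl

theorem kappa_mem {n : ℕ} {X : A h (n + 1)} (hX : X ∈ g2 h (n + 1)) : kappa hm n X ∈ g2 h n :=
  homotopy_mem hm hmm (isDGLA_g2.d_mem _ _ (homotopy_mem hm hmm hX))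

/-- For the cocycle bX the homotopy identity reads bH(bX) = bX - p₂(bX), and H kills the image of
the projection. -/
theorem homotopy_b_homotopy_b {n : ℕ} {X : A h n} (hX : X ∈ g2 h n) :
    homotopy hm n (b h n (homotopy hm n (b h n X))) = homotopy hm n (b h n X) := by
  have h1 := b_homotopy_add hm hmm (isDGLA_g2.d_mem n X hX)
  rw [isDGLA_g2.d_d n X hX, map_zero, add_zero] at h1
  rw [h1, map_sub, homotopy_weightProj, sub_zero]

theorem b_homotopy_b_homotopy {n : ℕ} {X : A h (n + 1)} (hX : X ∈ g2 h (n + 1)) :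
    b h n (homotopy hm n (b h n (homotopy hm n X))) = b h n (homotopy hm n X) := by
  have hY := homotopy_mem hm hmm hX
  have h1 := b_homotopy_add hm hmm (isDGLA_g2.d_mem n _ hY)
  rw [isDGLA_g2.d_d n _ hY, map_zero, add_zero, weightProj, ← b_functionOfWeight hm hmm _ hY,
    ← weightProj, weightProj_homotopy, map_zero, sub_zero] at h1
  exact h1

theorem kappa_b_zero {X : A h 0} (hX : X ∈ g2 h 0) :
    kappa hm 0 (b h 0 X) = X - weightProj hm 0 X := by
  rw [kappa_apply, homotopy_b_homotopy_b hm hmm hX, homotopy_b_zero hm hmm hX]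

theorem b_kappa_add {n : ℕ} {X : A h (n + 1)} (hX : X ∈ g2 h (n + 1)) :
    kappa hm (n + 1) (b h (n + 1) X) + b h n (kappa hm n X) = X - weightProj hm (n + 1) X := by
  rw [kappa_apply, kappa_apply, homotopy_b_homotopy_b hm hmm hX, b_homotopy_b_homotopy hm hmm hX]
  exact (add_comm _ _).trans (b_homotopy_add hm hmm hX)

/-- Put Y = κX. Then bY = bHX, so HbY = κX = Y, and the homotopy identity for Y leaves bHY = 0;
hence κY = HbHY = 0. -/
theorem kappa_kappa {n : ℕ} {X : A h (n + 2)} (hX : X ∈ g2 h (n + 2)) :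
    kappa hm n (kappa hm (n + 1) X) = 0 := by
  have hY := kappa_mem hm hmm hX
  have h1 := b_homotopy_add hm hmm hY
  have h2 : b h (n + 1) (kappa hm (n + 1) X) = b h (n + 1) (homotopy hm (n + 1) X) :=
    b_homotopy_b_homotopy hm hmm hX
  rw [h2, ← kappa_apply, kappa_apply hm (n + 1), weightProj_homotopy, sub_zero, add_eq_right] at h1
  rw [kappa_apply, kappa_apply hm (n + 1), h1, map_zero]

/-- Substituting the homotopy identity for bHX into κX = HbHX gives κX = HX - HH(bX), and both terms
rise by 1 only. -/
theorem kappa_mem_filt {i n : ℕ} {X : A h (n + 1)} (hX : X ∈ g2 h (n + 1))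
    (hXi : X ∈ filt h i (n + 1)) : kappa hm n X ∈ filt h (i + 1) n := by
  have h1 := b_homotopy_add hm hmm hX
  rw [← eq_sub_iff_add_eq] at h1
  rw [kappa_apply, h1, map_sub, map_sub, homotopy_weightProj, sub_zero]
  exact sub_mem (homotopy_mem_filt hm hXi) (homotopy_homotopy_mem_filt hm (b_mem_filt hXi))

end Homotopy

/-! ### Transfer of dgla structures and cohomology along chain maps -/

section Transfer

variable {k : Type*} [Field k] {V V' : ℕ → Type*} [∀ n, AddCommGroup (V n)]
  [∀ n, Module k (V n)] [∀ n, AddCommGroup (V' n)] [∀ n, Module k (V' n)]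
  {C : ∀ n, Submodule k (V n)} {d : ∀ n, V n →ₗ[k] V (n + 1)}
  {br : ∀ p q n, V p →ₗ[k] V q →ₗ[k] V n}
  {C' : ∀ n, Submodule k (V' n)} {d' : ∀ n, V' n →ₗ[k] V' (n + 1)}
  {br' : ∀ p q n, V' p →ₗ[k] V' q →ₗ[k] V' n} {f : ∀ n, V n →ₗ[k] V' n}

/-- The image of a dgla under a surjective map compatible with differential and bracket is a
dgla. -/
theorem IsDGLA.of_surjective (hC : IsDGLA k C d br) (hf : IsDGLAHom k C d br C' d' br' f)
    (hsurj : ∀ n, ∀ P' ∈ C' n, ∃ P ∈ C n, f n P = P') (h00 : ∀ n P Q, br' 0 0 n P Q = 0) :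
    IsDGLA k C' d' br' := by
  -- The inner brackets of the Jacobi identity use truncated degrees. For two elements of degree 0
  -- compatibility of `f` says nothing, and the vanishing of both brackets replaces it.
  have hmem : ∀ p q n, n = p + q - 1 → ∀ P ∈ C p, ∀ Q ∈ C q, br p q n P Q ∈ C n := by
    intro p q n hn P hP Q hQ
    rcases Nat.eq_zero_or_pos (p + q) with h | h
    · obtain ⟨rfl, rfl⟩ := Nat.add_eq_zero_iff.1 h
      rw [hC.br_zero_zero n P hP Q hQ]
      exact zero_mem _
    · exact hC.br_mem p q n (by omega) P hP Q hQ
  have hmap : ∀ p q n, n = p + q - 1 → ∀ P ∈ C p, ∀ Q ∈ C q,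
      f n (br p q n P Q) = br' p q n (f p P) (f q Q) := by
    intro p q n hn P hP Q hQ
    rcases Nat.eq_zero_or_pos (p + q) with h | h
    · obtain ⟨rfl, rfl⟩ := Nat.add_eq_zero_iff.1 h
      rw [hC.br_zero_zero n P hP Q hQ, h00, map_zero]
    · exact hf.map_br p q n (by omega) P hP Q hQ
  have hright : ∀ p q r n l, n + 2 = p + q + r → l = q + r - 1 → ∀ P ∈ C p, ∀ Q ∈ C q,
      ∀ R ∈ C r, f n (br p l n P (br q r l Q R)) = br' p l n (f p P) (br' q r l (f q Q) (f r R)) := by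
    intro p q r n l hn hl P hP Q hQ R hR
    rcases Nat.eq_zero_or_pos (q + r) with h | h
    · obtain ⟨rfl, rfl⟩ := Nat.add_eq_zero_iff.1 h
      rw [hC.br_zero_zero l Q hQ R hR, h00, map_zero, map_zero, map_zero]
    · rw [hf.map_br p l n (by omega) P hP _ (hmem q r l hl Q hQ R hR), hmap q r l hl Q hQ R hR]
  have hleft : ∀ p q r n l, n + 2 = p + q + r → l = p + q - 1 → ∀ P ∈ C p, ∀ Q ∈ C q,
      ∀ R ∈ C r, f n (br l r n (br p q l P Q) R) = br' l r n (br' p q l (f p P) (f q Q)) (f r R) := by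
    intro p q r n l hn hl P hP Q hQ R hR
    rcases Nat.eq_zero_or_pos (p + q) with h | h
    · obtain ⟨rfl, rfl⟩ := Nat.add_eq_zero_iff.1 h
      rw [hC.br_zero_zero l P hP Q hQ, h00, map_zero, map_zero, LinearMap.zero_apply,
        LinearMap.zero_apply, map_zero]
    · rw [hf.map_br l r n (by omega) _ (hmem p q l hl P hP Q hQ) R hR, hmap p q l hl P hP Q hQ]
  refine ⟨?_, ?_, fun n P _ Q _ => h00 n P Q, ?_, ?_, ?_, ?_, ?_⟩
  · intro n P' hP'
    obtain ⟨P, hP, rfl⟩ := hsurj n P' hP'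
    rw [← hf.map_d n P hP]
    exact hf.map_mem _ _ (hC.d_mem n P hP)
  · intro p q n hn P' hP' Q' hQ'
    obtain ⟨P, hP, rfl⟩ := hsurj p P' hP'
    obtain ⟨Q, hQ, rfl⟩ := hsurj q Q' hQ'
    rw [← hf.map_br p q n hn P hP Q hQ]
    exact hf.map_mem _ _ (hC.br_mem p q n hn P hP Q hQ)
  · intro n P' hP'
    obtain ⟨P, hP, rfl⟩ := hsurj n P' hP'
    rw [← hf.map_d n P hP, ← hf.map_d _ _ (hC.d_mem n P hP), hC.d_d n P hP, map_zero]
  · intro p q n hn P' hP' Q' hQ'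
    obtain ⟨P, hP, rfl⟩ := hsurj p P' hP'
    obtain ⟨Q, hQ, rfl⟩ := hsurj q Q' hQ'
    rw [← hf.map_br p q n hn P hP Q hQ, ← hf.map_br q p n (by omega) Q hQ P hP, ← map_smul,
      ← map_neg, ← hC.antisymm p q n hn P hP Q hQ]
  · intro p q r n hn P' hP' Q' hQ' R' hR'
    obtain ⟨P, hP, rfl⟩ := hsurj p P' hP'
    obtain ⟨Q, hQ, rfl⟩ := hsurj q Q' hQ'
    obtain ⟨R, hR, rfl⟩ := hsurj r R' hR'
    rw [← hright p q r n _ hn rfl P hP Q hQ R hR, ← hleft p q r n _ hn rfl P hP Q hQ R hR,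
      ← hright q p r n _ (by omega) rfl Q hQ P hP R hR, ← map_smul, ← map_add,
      ← hC.jacobi p q r n hn P hP Q hQ R hR]
  · intro p q n hn P' hP' Q' hQ'
    obtain ⟨P, hP, rfl⟩ := hsurj p P' hP'
    obtain ⟨Q, hQ, rfl⟩ := hsurj q Q' hQ'
    rw [← hf.map_br p q n hn P hP Q hQ, ← hf.map_d _ _ (hC.br_mem p q n hn P hP Q hQ),
      ← hf.map_d q Q hQ, ← hf.map_d p P hP,
      ← hf.map_br p (q + 1) (n + 1) (by omega) P hP _ (hC.d_mem q Q hQ),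
      ← hf.map_br (p + 1) q (n + 1) (by omega) _ (hC.d_mem p P hP) Q hQ, ← map_smul, ← map_add,
      ← hC.leibniz p q n hn P hP Q hQ]
  · intro P' hP' Q' hQ'
    obtain ⟨P, hP, rfl⟩ := hsurj 0 P' hP'
    obtain ⟨Q, hQ, rfl⟩ := hsurj 0 Q' hQ'
    rw [← hf.map_d 0 Q hQ, ← hf.map_d 0 P hP,
      ← hf.map_br 0 1 0 rfl P hP _ (hC.d_mem 0 Q hQ),
      ← hf.map_br 1 0 0 rfl _ (hC.d_mem 0 P hP) Q hQ, ← map_sub, ← hC.leibniz_zero P hP Q hQ,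
      map_zero]

theorem map_mem_cocycles (hfC : ∀ n, ∀ P ∈ C n, f n P ∈ C' n)
    (hfd : ∀ n, ∀ P ∈ C n, f (n + 1) (d n P) = d' n (f n P)) (n : ℕ) :
    ∀ P ∈ cocycles C d n, f n P ∈ cocycles C' d' n := by
  rintro P ⟨hP, hdP⟩
  refine ⟨hfC n P hP, ?_⟩
  rw [SetLike.mem_coe, LinearMap.mem_ker] at hdP ⊢
  rw [← hfd n P hP, hdP, map_zero]

theorem map_mem_coboundaries (hfC : ∀ n, ∀ P ∈ C n, f n P ∈ C' n)
    (hfd : ∀ n, ∀ P ∈ C n, f (n + 1) (d n P) = d' n (f n P)) (n : ℕ) :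
    ∀ P ∈ coboundaries C d n, f n P ∈ coboundaries C' d' n := by
  intro P hP
  rcases n with _ | n
  · rw [coboundaries, Submodule.mem_bot] at hP ⊢
    rw [hP, map_zero]
  · obtain ⟨Q, hQ, rfl⟩ := hP
    exact ⟨f n Q, hfC n Q hQ, (hfd n Q hQ).symm⟩

/-- A map of complexes with a section that is an inverse up to coboundaries induces an
isomorphism in cohomology. -/
theorem exists_cohomology_equiv {f' : ∀ n, V' n →ₗ[k] V n}
    (hfC : ∀ n, ∀ P ∈ C n, f n P ∈ C' n)
    (hfd : ∀ n, ∀ P ∈ C n, f (n + 1) (d n P) = d' n (f n P))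
    (hfC' : ∀ n, ∀ P ∈ C' n, f' n P ∈ C n)
    (hfd' : ∀ n, ∀ P ∈ C' n, f' (n + 1) (d' n P) = d n (f' n P))
    (hff' : ∀ n, ∀ P ∈ C' n, f n (f' n P) = P)
    (hcob : ∀ n, ∀ P ∈ cocycles C d n, P - f' n (f n P) ∈ coboundaries C d n) (n : ℕ) :
    ∃ e : Cohomology C d n ≃ₗ[k] Cohomology C' d' n,
      ∀ (z : cocycles C d n) (w : cocycles C' d' n), f n z = w →
        e (cohomologyClass C d n z) = cohomologyClass C' d' n w := by
  let F : cocycles C d n →ₗ[k] cocycles C' d' n := (f n).restrict (map_mem_cocycles hfC hfd n)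
  let G : cocycles C' d' n →ₗ[k] cocycles C d n := (f' n).restrict (map_mem_cocycles hfC' hfd' n)
  let F₁ : Cohomology C d n →ₗ[k] Cohomology C' d' n := Submodule.mapQ _ _ F fun z hz =>
    map_mem_coboundaries hfC hfd n _ hz
  let G₁ : Cohomology C' d' n →ₗ[k] Cohomology C d n := Submodule.mapQ _ _ G fun z hz =>
    map_mem_coboundaries hfC' hfd' n _ hz
  have hF : ∀ z, F₁ (cohomologyClass C d n z) = cohomologyClass C' d' n (F z) := fun z => rfl
  have hG : ∀ z, G₁ (cohomologyClass C' d' n z) = cohomologyClass C d n (G z) := fun z => rfl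
  refine ⟨LinearEquiv.ofLinearMap F₁ G₁ ?_ ?_, ?_⟩
  · ext z
    change F₁ (G₁ (cohomologyClass C' d' n z)) = cohomologyClass C' d' n z
    rw [hG, hF]
    congr 1
    exact Subtype.ext (hff' n z z.2.1)
  · ext z
    change G₁ (F₁ (cohomologyClass C d n z)) = cohomologyClass C d n z
    rw [hF, hG]
    refine ((Submodule.Quotient.eq _).2 ?_).symm
    exact hcob n z z.2
  · intro z w hzw
    change F₁ (cohomologyClass C d n z) = _
    rw [hF]
    congr 1
    exact Subtype.ext hzw

end Transfer

/-! ### The projection p₂, the ideal generated by 𝔥, and compatibility with brackets -/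

section Projection

attribute [local instance 100] LieRing.ofAssociativeRing

variable {k : Type*} [Field k] {g : Type*} [LieRing g] [LieAlgebra k g]
  {h : LieSubalgebra k g} {m : Submodule k g}

local notation "ι" => UniversalEnvelopingAlgebra.ι k

theorem incl_mul {n : ℕ} (t t' : T k g n) : incl h n (t * t') = incl h n t * incl h n t' :=
  map_mul (Algebra.TensorProduct.includeLeft : T k g n →ₐ[k] A h n) t t'

theorem insA_incl {n N : ℕ} (I : ℕ → Finset (Fin N)) (J : Finset (Fin N)) (t : T k g n) :
    insA h I J (incl h n t) = incl h N (insT I t) := by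
  change incl h N (insT I t) * copLast h J 1 = _
  rw [map_one, mul_one]

theorem b_incl {n : ℕ} (t : T k g n) : b h n (incl h n t) = incl h (n + 1) (bT k g n t) := by
  simp only [b, bT, LinearMap.add_apply, LinearMap.sum_apply, LinearMap.smul_apply, insA_incl,
    map_add, map_sum, map_smul]

theorem brace_incl {p q n : ℕ} (t : T k g p) (t' : T k g q) :
    brace h p q n (incl h p t) (incl h q t') = incl h n (braceT k g p q n t t') := by
  simp only [brace, braceT, LinearMap.sum_apply, LinearMap.smul_apply, LinearMap.compl₁₂_apply,
    LinearMap.mul_apply', insA_incl, map_sum, map_smul, incl_mul]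

theorem p2_tmul (hc : IsCompl (Um m) (Ugh h)) {n : ℕ} (t : T k g n) (w : U k h) :
    p2 hc n (t ⊗ₜ[k] w) = counit k h w • tensorProj hc n t := by
  rw [p2, LinearMap.comp_apply, LinearMap.comp_apply, LinearMap.lTensor_tmul,
    LinearEquiv.coe_coe, TensorProduct.rid_tmul, map_smul]
  rfl

theorem p2_incl (hc : IsCompl (Um m) (Ugh h)) {n : ℕ} (t : T k g n) :
    p2 hc n (incl h n t) = tensorProj hc n t := by
  change p2 hc n (t ⊗ₜ[k] 1) = _
  rw [p2_tmul, map_one, one_smul]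

theorem incl_injective (n : ℕ) : Function.Injective (incl h n) := by
  refine Function.LeftInverse.injective (g := (TensorProduct.rid k (T k g n)).toLinearMap ∘ₗ
    LinearMap.lTensor (T k g n) (counit k h).toLinearMap) fun t => ?_
  change (TensorProduct.rid k (T k g n)) (LinearMap.lTensor (T k g n) _ (t ⊗ₜ[k] 1)) = t
  rw [LinearMap.lTensor_tmul, AlgHom.toLinearMap_apply, map_one, TensorProduct.rid_tmul, one_smul]

theorem tensorProj_tprod (hc : IsCompl (Um m) (Ugh h)) {n : ℕ} (u : Fin n → U k g) :
    tensorProj hc n (PiTensorProduct.tprod k u) =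
      PiTensorProduct.tprod k fun s => (Um m).projection (Ugh h) hc (u s) := by
  rw [tensorProj, PiTensorProduct.map_tprod]

theorem tensorProj_tprod_eq_zero (hc : IsCompl (Um m) (Ugh h)) {n : ℕ} {u : Fin n → U k g}
    {s : Fin n} (hu : u s ∈ Ugh h) : tensorProj hc n (PiTensorProduct.tprod k u) = 0 := by
  rw [tensorProj_tprod]
  exact MultilinearMap.map_coord_zero _ s (Submodule.projection_apply_right hc ⟨u s, hu⟩)

theorem tensorProj_of_mem (hc : IsCompl (Um m) (Ugh h)) {n : ℕ} {t : T k g n}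
    (ht : t ∈ LinearMap.range (PiTensorProduct.map fun _ : Fin n => (Um m).subtype)) :
    tensorProj hc n t = t := by
  obtain ⟨t, rfl⟩ := ht
  rw [tensorProj, ← LinearMap.comp_apply, ← PiTensorProduct.map_comp]
  congr 2
  funext s
  ext u
  exact Submodule.projection_apply_left hc u

theorem tensorProj_mem (hc : IsCompl (Um m) (Ugh h)) {n : ℕ} (t : T k g n) :
    tensorProj hc n t ∈
      LinearMap.range (PiTensorProduct.map fun _ : Fin n => (Um m).subtype) := by
  induction t using PiTensorProduct.induction_on with
  | smul_tprod r u =>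
    rw [map_smul, tensorProj_tprod]
    refine Submodule.smul_mem _ r ⟨PiTensorProduct.tprod k fun s =>
      ⟨_, Submodule.projection_apply_mem hc (u s)⟩, ?_⟩
    rw [PiTensorProduct.map_tprod]
    rfl
  | add x y hx hy => rw [map_add]; exact add_mem hx hy

theorem last_commute_incl {n : ℕ} (z : h) (t : T k g n) : Commute (last h n z) (incl h n t) := by
  change (1 ⊗ₜ[k] ι z) * (t ⊗ₜ[k] 1) = (t ⊗ₜ[k] 1) * (1 ⊗ₜ[k] ι z)
  simp only [Algebra.TensorProduct.tmul_mul_tmul, one_mul, mul_one]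

theorem incl_cop_univ {n : ℕ} (z : h) :
    incl h n (cop Finset.univ (ι (z : g))) = ∑ s : Fin n, slot h s (z : g) := by
  rw [cop_ι, map_sum]
  rfl

theorem incl_mem_g2 {n : ℕ} {t : T k g n} : incl h n t ∈ g2 h n ↔ t ∈ tInv h n := by
  rw [mem_g2, tInv, Submodule.mem_iInf]
  refine forall_congr' fun z => ?_
  rw [LinearMap.mem_ker, LinearMap.sub_apply, LinearMap.mulLeft_apply, LinearMap.mulRight_apply,
    sub_eq_zero, ← (incl_injective (h := h) n).eq_iff, incl_mul, incl_mul, incl_cop_univ, diag]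
  exact ⟨fun H => by
    have h1 := H.sub_left (last_commute_incl z t)
    rwa [add_sub_cancel_right] at h1, fun H =>
    Commute.add_left H (last_commute_incl z t)⟩

theorem insT_congr {n N : ℕ} {I I' : ℕ → Finset (Fin N)} (hI : ∀ l < n, I l = I' l) :
    (insT I : T k g n →ₗ[k] T k g N) = insT I' := by
  have h1 : (fun l : Fin n => ((cop (I l)).toLinearMap : U k g →ₗ[k] T k g N)) =
      fun l : Fin n => (cop (I' l)).toLinearMap := funext fun l => by rw [hI l l.2]
  rw [insT, insT, h1]

theorem ins_incl {f : ℕ → ℕ} {p n : ℕ} (t : T k g p) :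
    ins h f p n (incl h p t) = incl h n (insT (fib f n) t) := by
  rw [← insA_incl _ (fib f n p), insA_eq_ins f p n _ _ (fun _ _ => rfl) rfl]
  rfl

theorem ins_incl_congr {f f' : ℕ → ℕ} {p n : ℕ} (hf : ∀ t < n, ∀ l < p, f t = l ↔ f' t = l)
    (t : T k g p) : ins h f p n (incl h p t) = ins h f' p n (incl h p t) := by
  rw [ins_incl, ins_incl, insT_congr fun l hl => ?_]
  ext s
  rw [mem_fib, mem_fib, hf s s.2 l hl]

variable (h) in
/-- The left ideal of `(U𝔤)^{⊗ n} ⊗ U𝔥` that is generated by the elements of `𝔥` in the factors -/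
noncomputable def idealH (n : ℕ) : Ideal (A h n) :=
  Ideal.span {X | (∃ (s : Fin n) (z : h), slot h s (z : g) = X) ∨ ∃ z : h, last h n z = X}

theorem slot_mem_idealH {n : ℕ} (s : Fin n) (z : h) : slot h s (z : g) ∈ idealH h n :=
  Ideal.subset_span (Or.inl ⟨s, z, rfl⟩)

theorem tmul_mul_last {n : ℕ} (t : T k g n) (w : U k h) (z : h) :
    (t ⊗ₜ[k] w) * last h n z = t ⊗ₜ[k] (w * ι z) := by
  change (t ⊗ₜ[k] w) * (1 ⊗ₜ[k] ι z) = _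
  rw [Algebra.TensorProduct.tmul_mul_tmul, mul_one]

theorem last_mem_idealH {n : ℕ} (z : h) : last h n z ∈ idealH h n :=
  Ideal.subset_span (Or.inr ⟨z, rfl⟩)

theorem idealH_smul_mem {n : ℕ} (r : k) {X : A h n} (hX : X ∈ idealH h n) :
    r • X ∈ idealH h n := by
  have h1 := Ideal.mul_mem_left (idealH h n) (r • 1) hX
  rwa [smul_mul_assoc, one_mul] at h1

/-- Right multiplication by 𝔥 in a numbered factor lands in `Ugh h`, which the projection kills; in
the last factor it is killed by the counit. -/
theorem p2_eq_zero_of_mem (hc : IsCompl (Um m) (Ugh h)) {n : ℕ} {Y : A h n}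
    (hY : Y ∈ idealH h n) : p2 hc n Y = 0 := by
  have hslot : ∀ (s : Fin n) (z : h) (X : A h n), p2 hc n (X * slot h s (z : g)) = 0 := by
    intro s z X
    have h1 : X ∈ LinearMap.ker (p2 hc n ∘ₗ LinearMap.mulRight k (slot h s (z : g))) := by
      refine mem_of_forall_tprod_tmul (Submodule.span_univ) Submodule.span_univ
        (fun u _ w _ => ?_) X
      rw [LinearMap.mem_ker, LinearMap.comp_apply, LinearMap.mulRight_apply]
      change p2 hc n ((PiTensorProduct.tprod k u ⊗ₜ[k] w) * (place k g s (ι (z : g)) ⊗ₜ[k] 1)) = 0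
      rw [Algebra.TensorProduct.tmul_mul_tmul, p2_tmul, PiTensorProduct.singleAlgHom_apply,
        PiTensorProduct.tprod_mul_tprod, tensorProj_tprod_eq_zero hc (s := s), smul_zero]
      rw [Pi.mul_apply, MonoidHom.mulSingle_apply, Pi.mulSingle_eq_same]
      exact Ideal.mul_mem_left _ _ (Ideal.subset_span ⟨z, rfl⟩)
    exact h1
  have hlast : ∀ (z : h) (X : A h n), p2 hc n (X * last h n z) = 0 := by
    intro z X
    have h1 : X ∈ LinearMap.ker (p2 hc n ∘ₗ LinearMap.mulRight k (last h n z)) := by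
      refine mem_of_forall_tprod_tmul (Submodule.span_univ) Submodule.span_univ
        (fun u _ w _ => ?_) X
      rw [LinearMap.mem_ker, LinearMap.comp_apply, LinearMap.mulRight_apply]
      change p2 hc n ((PiTensorProduct.tprod k u ⊗ₜ[k] w) * (1 ⊗ₜ[k] ι z)) = 0
      rw [Algebra.TensorProduct.tmul_mul_tmul, p2_tmul, map_mul, counit_ι, mul_zero, zero_smul]
    exact h1
  have h1 : ∀ X, p2 hc n (X * Y) = 0 := by
    induction hY using Submodule.span_induction with
    | mem Y hY =>
      rcases hY with ⟨s, z, rfl⟩ | ⟨z, rfl⟩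
      · exact hslot s z
      · exact hlast z
    | zero => intro X; rw [mul_zero, map_zero]
    | add Y Y' _ _ hY hY' => intro X; rw [mul_add, map_add, hY, hY', add_zero]
    | smul a Y _ hY => intro X; rw [smul_eq_mul, ← mul_assoc]; exact hY _
  simpa using h1 1

theorem slotU_mem_idealH {n : ℕ} (s : Fin n) {u : U k g} (hu : u ∈ Ugh h) :
    slotU h s u ∈ idealH h n := by
  have h1 : Ideal.span (Set.range fun x : h => ι (x : g)) ≤
      (idealH h n).comap (slotU h s).toRingHom := by
    rw [Ideal.span_le]
    rintro _ ⟨z, rfl⟩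
    exact slot_mem_idealH s z
  exact h1 hu

theorem ins_mem_idealH {f : ℕ → ℕ} {p n : ℕ} {X : A h p} (hX : X ∈ idealH h p) :
    ins h f p n X ∈ idealH h n := by
  have h1 : idealH h p ≤ (idealH h n).comap (ins h f p n).toRingHom := by
    rw [idealH, Ideal.span_le]
    rintro _ (⟨s, z, rfl⟩ | ⟨z, rfl⟩)
    · change ins h f p n (slot h s (z : g)) ∈ idealH h n
      rw [ins_slot]
      exact Submodule.sum_mem _ fun t _ => slot_mem_idealH t z
    · change ins h f p n (last h p z) ∈ idealH h n
      rw [ins_last]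
      exact add_mem (Submodule.sum_mem _ fun t _ => slot_mem_idealH t z) (last_mem_idealH z)
  exact h1 hX

theorem circ_mem_idealH_right {i p q n : ℕ} (P : A h p) {Q : A h q} (hQ : Q ∈ idealH h q) :
    circ i p q n P Q ∈ idealH h n :=
  Ideal.mul_mem_left _ _ (ins_mem_idealH hQ)

/-- The ideal is a left ideal, so a generator of `P` has to be moved past the inserted `t`. A
generator in the factor `i` acts diagonally on the block of `t` and commutes with it by invariance;
all others live outside the block. -/
theorem circ_mem_idealH_left {i p q n : ℕ} (hi : i < p) {P : A h p} (hP : P ∈ idealH h p) {t : T k g q}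
    (ht : t ∈ tInv h q) : circ i p q n P (incl h q t) ∈ idealH h n := by
  -- As `t` has trivial last factor, the assignment may be changed so that factors outside the block
  -- receive nothing.
  let f : ℕ → ℕ := fun r => if i ≤ r ∧ r < i + q then r - i else q + 1
  have hf : ins h (shF i q n) q n (incl h q t) = ins h f q n (incl h q t) :=
    ins_incl_congr (fun r hr l hl => by simp only [shF, f]; split_ifs <;> omega) t
  have hlast : ∀ z, Commute (last h n z) (ins h f q n (incl h q t)) := fun z => by
    rw [ins_incl]
    exact last_commute_incl z _
  have hslot : ∀ (r : Fin n) (x : g), ¬ (i ≤ (r : ℕ) ∧ (r : ℕ) < i + q) →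
      Commute (slot h r x) (ins h f q n (incl h q t)) := fun r x hr =>
    slot_commute_ins (by simp only [f]; rw [if_neg hr]; omega) x _
  have hgen : ∀ Y : A h p, ((∃ (s : Fin p) (z : h), slot h s (z : g) = Y) ∨
      ∃ z : h, last h p z = Y) → Commute (ins h (blkF i q) p n Y) (ins h f q n (incl h q t)) := by
    rintro _ (⟨s, z, rfl⟩ | ⟨z, rfl⟩)
    · rw [ins_slot]
      by_cases hs : (s : ℕ) = i
      · have h1 : Commute (ins h f q n (diag h q z)) (ins h f q n (incl h q t)) :=
          (mem_g2.1 (incl_mem_g2.2 ht) z).map _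
        rw [ins_diag] at h1
        have h2 := h1.sub_left (hlast z)
        rw [add_sub_cancel_right] at h2
        have h3 : fib (blkF i q) n s = Finset.univ.filter fun r : Fin n => f r ≤ q := by
          ext r
          simp only [mem_fib, Finset.mem_filter, Finset.mem_univ, true_and, blkF, f]
          split_ifs <;> omega
        rw [h3]
        exact h2
      · refine Commute.sum_left _ _ _ fun r hr => hslot r _ ?_
        rw [mem_fib, blkF] at hr
        split_ifs at hr <;> omega
    · rw [ins_last]
      refine Commute.add_left (Commute.sum_left _ _ _ fun r hr => hslot r _ ?_) (hlast z)
      rw [mem_fib, blkF] at hr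
      split_ifs at hr <;> omega
  rw [circ, hf]
  induction hP using Submodule.span_induction with
  | mem Y hY =>
    rw [(hgen Y hY).eq]
    exact Ideal.mul_mem_left _ _ (ins_mem_idealH (Ideal.subset_span hY))
  | zero => rw [map_zero, zero_mul]; exact zero_mem _
  | add Y Y' _ _ hY hY' => rw [map_add, add_mul]; exact add_mem hY hY'
  | smul a Y _ hY =>
    rw [smul_eq_mul, map_mul, mul_assoc]
    exact Ideal.mul_mem_left _ _ hY

theorem brace_mem_idealH_right {p q n : ℕ} (hn : n + 1 = p + q) (P : A h p) {Q : A h q}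
    (hQ : Q ∈ idealH h q) : brace h p q n P Q ∈ idealH h n := by
  rw [brace_apply hn]
  exact Submodule.sum_mem _ fun i _ => idealH_smul_mem _ (circ_mem_idealH_right P hQ)

theorem brace_mem_idealH_left {p q n : ℕ} (hn : n + 1 = p + q) {P : A h p}
    (hP : P ∈ idealH h p) {t : T k g q} (ht : t ∈ tInv h q) :
    brace h p q n P (incl h q t) ∈ idealH h n := by
  rw [brace_apply hn]
  exact Submodule.sum_mem _ fun i hi =>
    idealH_smul_mem _ (circ_mem_idealH_left (Finset.mem_range.1 hi) hP ht)

/-- The difference is {P | Q - t'} + {P - t | t'}; the second term uses invariance of t'. -/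
theorem brace_sub_mem_idealH {p q n : ℕ} (hn : n + 1 = p + q) {P : A h p} {Q : A h q}
    {t : T k g p} {t' : T k g q} (ht' : t' ∈ tInv h q) (hP : P - incl h p t ∈ idealH h p)
    (hQ : Q - incl h q t' ∈ idealH h q) :
    brace h p q n P Q - incl h n (braceT k g p q n t t') ∈ idealH h n := by
  have h1 := add_mem (brace_mem_idealH_right hn P hQ) (brace_mem_idealH_left hn hP ht')
  rwa [map_sub, map_sub, LinearMap.sub_apply, brace_incl, sub_add_sub_cancel] at h1

theorem bracketG_sub_mem_idealH {p q n : ℕ} (hn : n + 1 = p + q) {P : A h p} {Q : A h q}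
    {t : T k g p} {t' : T k g q} (ht : t ∈ tInv h p) (ht' : t' ∈ tInv h q)
    (hP : P - incl h p t ∈ idealH h p) (hQ : Q - incl h q t' ∈ idealH h q) :
    bracketG h p q n P Q - incl h n (bracketT k g p q n t t') ∈ idealH h n := by
  have h1 := sub_mem (brace_sub_mem_idealH hn ht' hP hQ) (idealH_smul_mem
    ((-1 : k) ^ ((p + 1) * (q + 1)))
    (brace_sub_mem_idealH (n := n) (by omega) ht hQ hP))
  have h2 : bracketG h p q n P Q - incl h n (bracketT k g p q n t t') =
      brace h p q n P Q - incl h n (braceT k g p q n t t') -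
        (-1 : k) ^ ((p + 1) * (q + 1)) •
          (brace h q p n Q P - incl h n (braceT k g q p n t' t)) := by
    rw [bracketG_apply, bracketT, LinearMap.sub_apply, LinearMap.sub_apply,
      LinearMap.smul_apply, LinearMap.smul_apply, LinearMap.flip_apply, map_sub, map_smul]
    module
  rwa [h2]

theorem bracketT_zero_zero (n : ℕ) : bracketT k g 0 0 n = 0 := by
  refine LinearMap.ext₂ fun P Q => ?_
  simp [bracketT, braceT]

theorem p2_incl_of_mem (hc : IsCompl (Um m) (Ugh h)) {n : ℕ} {t : T k g n} (ht : t ∈ TUmInv h m n) :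
    p2 hc n (incl h n t) = t := by
  rw [p2_incl, tensorProj_of_mem hc ht.1]

theorem incl_mem_g2_of_mem {n : ℕ} {t : T k g n} (ht : t ∈ TUmInv h m n) :
    incl h n t ∈ g2 h n := incl_mem_g2.2 ht.2

section Homotopy

variable [CharZero k] (hm : IsCompl h.toSubmodule m) (hc : IsCompl (Um m) (Ugh h))

/-- On monomials: total weight 0 means that all factors lie in `Um m` and the last one is 1;
otherwise some factor lies in `Ugh h` or the counit vanishes, so both sides are zero. -/
theorem weightProj_eq {n : ℕ} (X : A h n) : weightProj hm n X = incl h n (p2 hc n X) := by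
  have h1 : X ∈ LinearMap.ker (weightProj hm n - incl h n ∘ₗ p2 hc n) := by
    refine mem_of_forall_monomial hm (fun u hu z l => ?_) X
    choose c hcu _ hU using fun s => exists_weight hm (hu s)
    rw [LinearMap.mem_ker, LinearMap.sub_apply, sub_eq_zero, LinearMap.comp_apply, weightProj,
      functionOfWeight_apply hm _ (totalWeight_monomial hm hcu z l), p2_tmul, map_pow, counit_ι]
    by_cases hs : ∃ s, c s ≠ 0
    · obtain ⟨s, hs⟩ := hs
      rw [tensorProj_tprod_eq_zero hc (((hU s).resolve_left fun H => hs H.2).1), smul_zero,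
        map_zero, if_neg, zero_smul]
      intro H
      exact hs (Finset.sum_eq_zero_iff.1 (Nat.add_eq_zero_iff.1 H).1 s (Finset.mem_univ s))
    · push Not at hs
      rw [tensorProj_of_mem hc, Finset.sum_eq_zero fun s _ => hs s, zero_add]
      · rcases l with _ | l
        · rw [if_pos rfl, pow_zero, pow_zero, one_smul, one_smul]
          rfl
        · rw [if_neg (Nat.succ_ne_zero l), zero_smul, pow_succ, mul_zero, zero_smul, map_zero]
      · refine ⟨PiTensorProduct.tprod k fun s =>
          ⟨u s, ((hU s).resolve_right fun H => H.2 (hs s)).1⟩, ?_⟩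
        rw [PiTensorProduct.map_tprod]
        rfl
  exact sub_eq_zero.1 h1

include hm in
theorem sub_incl_p2_mem_idealH {n : ℕ} (X : A h n) : X - incl h n (p2 hc n X) ∈ idealH h n := by
  have h1 : X ∈ ((idealH h n).restrictScalars k).comap (LinearMap.id - incl h n ∘ₗ p2 hc n) := by
    refine mem_of_forall_monomial hm (fun u hu z l => ?_) X
    choose c _ _ hU using fun s => exists_weight hm (hu s)
    rw [Submodule.mem_comap, LinearMap.sub_apply, LinearMap.comp_apply, LinearMap.id_apply, p2_tmul,
      map_pow, counit_ι]
    change _ ∈ idealH h n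
    by_cases hs : ∃ s, c s ≠ 0
    · obtain ⟨s, hs⟩ := hs
      have h2 := ((hU s).resolve_left fun H => hs H.2).1
      rw [tensorProj_tprod_eq_zero hc h2, smul_zero, map_zero, sub_zero]
      have h3 := tprod_tmul_mul_slotU u (ι z ^ l) s (u s)
      rw [Function.update_eq_self] at h3
      rw [← h3]
      exact Ideal.mul_mem_left _ _ (slotU_mem_idealH s h2)
    · push Not at hs
      rcases l with _ | l
      · rw [tensorProj_of_mem hc, pow_zero, pow_zero, one_smul]
        · change _ - _ ⊗ₜ[k] 1 ∈ _
          rw [sub_self]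
          exact zero_mem _
        · refine ⟨PiTensorProduct.tprod k fun s =>
            ⟨u s, ((hU s).resolve_right fun H => H.2 (hs s)).1⟩, ?_⟩
          rw [PiTensorProduct.map_tprod]
          rfl
      · rw [pow_succ 0, mul_zero, zero_smul, map_zero, sub_zero, pow_succ]
        rw [← tmul_mul_last]
        exact Ideal.mul_mem_left _ _ (last_mem_idealH z)
  exact h1

variable (hmm : ∀ x ∈ h, ∀ y ∈ m, ⁅x, y⁆ ∈ m)
include hm hmm

theorem p2_mem {n : ℕ} {X : A h n} (hX : X ∈ g2 h n) : p2 hc n X ∈ TUmInv h m n := by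
  refine ⟨tensorProj_mem hc _, incl_mem_g2.1 ?_⟩
  rw [← weightProj_eq hm hc]
  exact functionOfWeight_mem_g2 hm hmm _ hX

theorem p2_b {n : ℕ} {X : A h n} (hX : X ∈ g2 h n) :
    p2 hc (n + 1) (b h n X) = bT k g n (p2 hc n X) := by
  apply incl_injective (h := h)
  rw [← b_incl, ← weightProj_eq hm hc, ← weightProj_eq hm hc, weightProj, weightProj,
    b_functionOfWeight hm hmm _ hX]

/-- `P` and `Q` are congruent to their projections modulo `idealH`, the bracket respects this
congruence, and `p2` kills the ideal. -/
theorem p2_bracketG {p q n : ℕ} (hn : n + 1 = p + q) {P : A h p} (hP : P ∈ g2 h p) {Q : A h q}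
    (hQ : Q ∈ g2 h q) :
    p2 hc n (bracketG h p q n P Q) = bracketM hc p q n (p2 hc p P) (p2 hc q Q) := by
  have h1 := p2_eq_zero_of_mem hc (bracketG_sub_mem_idealH hn (p2_mem hm hc hmm hP).2
    (p2_mem hm hc hmm hQ).2 (sub_incl_p2_mem_idealH hm hc P) (sub_incl_p2_mem_idealH hm hc Q))
  rw [map_sub, sub_eq_zero, p2_incl] at h1
  exact h1

theorem isDGLAHom_p2 : IsDGLAHom k (g2 h) (b h) (bracketG h) (TUmInv h m) (bT k g) (bracketM hc)
    (p2 hc) where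
  map_mem _ _ hP := p2_mem hm hc hmm hP
  map_d _ _ hP := p2_b hm hc hmm hP
  map_br _ _ _ hn _ hP _ hQ := p2_bracketG hm hc hmm hn hP hQ

theorem isDGLA_TUmInv : IsDGLA k (TUmInv h m) (bT k g) (bracketM hc) :=
  isDGLA_g2.of_surjective (isDGLAHom_p2 hm hc hmm)
    (fun n P' hP' => ⟨incl h n P', incl_mem_g2_of_mem hP', p2_incl_of_mem hc hP'⟩)
    fun n P Q => by
      rw [bracketM, LinearMap.compr₂_apply, bracketT_zero_zero, LinearMap.zero_apply,
        LinearMap.zero_apply, map_zero]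

theorem sub_incl_p2_mem_coboundaries (n : ℕ) {X : A h n} (hX : X ∈ cocycles (g2 h) (b h) n) :
    X - incl h n (p2 hc n X) ∈ coboundaries (g2 h) (b h) n := by
  obtain ⟨hX, hbX⟩ := hX
  rw [SetLike.mem_coe, LinearMap.mem_ker] at hbX
  rw [← weightProj_eq hm hc]
  rcases n with _ | n
  · have h1 := kappa_b_zero hm hmm hX
    rw [hbX, map_zero] at h1
    exact h1.symm
  · have h1 := b_kappa_add hm hmm hX
    rw [hbX, map_zero, zero_add] at h1
    exact ⟨_, kappa_mem hm hmm hX, h1⟩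

theorem exists_cohomology_equiv_p2 (n : ℕ) :
    ∃ e : Cohomology (g2 h) (b h) n ≃ₗ[k] Cohomology (TUmInv h m) (bT k g) n,
      ∀ (z : cocycles (g2 h) (b h) n) (w : cocycles (TUmInv h m) (bT k g) n),
        p2 hc n z = w →
          e (cohomologyClass (g2 h) (b h) n z) = cohomologyClass (TUmInv h m) (bT k g) n w :=
  exists_cohomology_equiv (f := p2 hc) (f' := incl h) (fun _ _ hP => p2_mem hm hc hmm hP)
    (fun _ _ hP => p2_b hm hc hmm hP) (fun _ _ hP => incl_mem_g2_of_mem hP)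
    (fun _ _ _ => (b_incl _).symm) (fun _ _ hP => p2_incl_of_mem hc hP)
    (fun n _ hP => sub_incl_p2_mem_coboundaries hm hc hmm n hP) n

omit hm hmm in
theorem mem_g2Filt {i n : ℕ} {X : A h n} : X ∈ g2Filt h i n ↔ X ∈ g2 h n ∧ X ∈ filt h i n := by
  rw [g2Filt, Submodule.mem_inf, filt, filtU_eq_powSpan,
    le_antisymm (powSpan_le_stdFilt i) (stdFilt_le_powSpan i)]

end Homotopy

end Projection

end DynTwist

open DynTwist in
theorem proposition2p3 {k : Type*} [Field k] [CharZero k] {g : Type*} [LieRing g] [LieAlgebra k g]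
    (h : LieSubalgebra k g) (m : Submodule k g) (hm : IsCompl h.toSubmodule m)
    (hmm : ∀ x ∈ h, ∀ y ∈ m, ⁅x, y⁆ ∈ m) :
    -- the decomposition `U𝔤 = U𝔪 ⊕ U𝔤·𝔥`, by which `p₂` is defined, and the two dgla's
    ∃ hc : IsCompl (Um m) (Ugh h), ∃ hg : IsDGLA k (g2 h) (b h) (bracketG h),
      IsDGLA k (TUmInv h m) (bT k g) (bracketM hc) ∧
      -- `p₂` is a morphism of dgla's
      IsDGLAHom k (g2 h) (b h) (bracketG h) (TUmInv h m) (bT k g) (bracketM hc) (p2 hc) ∧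
      -- the homotopy `κ`, which is zero on degree `0`
      (∃ κ : ∀ n, g2 h (n + 1) →ₗ[k] g2 h n,
        (∀ P : g2 h 0,
          ((κ 0 ⟨b h 0 P, hg.d_mem 0 P P.2⟩ : g2 h 0) : A h 0) = P - incl h 0 (p2 hc 0 P)) ∧
        (∀ n, ∀ P : g2 h (n + 1),
          ((κ (n + 1) ⟨b h (n + 1) P, hg.d_mem (n + 1) P P.2⟩ : g2 h (n + 1)) : A h (n + 1)) +
            b h n (κ n P) = P - incl h (n + 1) (p2 hc (n + 1) P)) ∧
        (∀ n, ∀ P : g2 h (n + 2), κ n (κ (n + 1) P) = 0) ∧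
        (∀ j n, ∀ P : g2 h (n + 1), (P : A h (n + 1)) ∈ g2Filt h j (n + 1) →
          (κ n P : A h n) ∈ g2Filt h (j + 1) n)) ∧
      -- `p₂` induces an isomorphism in cohomology
      (∀ n, ∃ e : Cohomology (g2 h) (b h) n ≃ₗ[k] Cohomology (TUmInv h m) (bT k g) n,
        ∀ (z : cocycles (g2 h) (b h) n) (w : cocycles (TUmInv h m) (bT k g) n),
          p2 hc n z = w →
            e (cohomologyClass (g2 h) (b h) n z) = cohomologyClass (TUmInv h m) (bT k g) n w) := by
  have hc := isCompl_Um_Ugh hm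
  refine ⟨hc, isDGLA_g2, isDGLA_TUmInv hm hc hmm, isDGLAHom_p2 hm hc hmm,
    ⟨fun n => (kappa hm n).restrict fun _ hX => kappa_mem hm hmm hX, fun P => ?_, fun n P => ?_,
      fun n P => ?_, fun j n P hP => ?_⟩, exists_cohomology_equiv_p2 hm hc hmm⟩
  · rw [← weightProj_eq hm hc]
    exact kappa_b_zero hm hmm P.2
  · rw [← weightProj_eq hm hc]
    exact b_kappa_add hm hmm P.2
  · exact Subtype.ext (kappa_kappa hm hmm P.2)
  · exact mem_g2Filt.2 ⟨kappa_mem hm hmm P.2, kappa_mem_filt hm hmm P.2 (mem_g2Filt.1 hP).2⟩
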